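/- Let $A=\{a_1<a_2<\cdots\}$ be a countable totally ordered alphabet and let $\mathbb C\langle A\rangle$ be the algebra of noncommutative polynomials in $A$, infinite sums of words of bounded length being allowed. The *standardization* of a word of length $n$ is the permutation $\mathrm{std}(w)\in\mathfrak S_n$ obtained by numbering the letters of $w$ in increasing order, equal letters from left to right. For a permutation $\sigma$ put $\mathbf F_\sigma=\sum_{\mathrm{std}(w)=\sigma^{-1}}w$ and $\mathbf G_\sigma=\mathbf F_{\sigma^{-1}}$. The span $\mathbf{FQSym}$ of the $\mathbf F_\sigma$ is a subalgebra of $\mathbb C\langle A\rangle$, and a graded Hopf algebra for the coproduct $\Delta\mathbf F_\sigma=\sum_{u\cdot v=\sigma}\mathbf F_{\mathrm{std}(u)}\otimes\mathbf F_{\mathrm{std}(v)}$ (sum over the deconcatenations of the word $\sigma$). The *decreasing tree* $\mathcal T(w)$ of a word $w$ with distinct letters is the labelled binary tree which is empty if $w$ is empty and which, if $w=u\,m\,v$ with $m$ the greatest letter, has root $m$, left subtree $\mathcal T(u)$ and right subtree $\mathcal T(v)$. For a permutation $\sigma$ let $\mathcal P(\sigma)$ be the shape (unlabelled binary tree) of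 $\mathcal T(\sigma^{-1})$. For an unlabelled binary tree $T$ put $\mathbf P_T=\sum_{\mathcal P(\sigma)=T}\mathbf F_\sigma$, and let $\mathbf{PBT}$ be the span of the $\mathbf P_T$, the algebra of planar binary trees. If $T$ has $n$ vertices, let $w_T\in\mathfrak S_n$ be the permutation obtained by labelling the vertices of $T$ by $1,\dots,n$ in infix order and reading the labels in postfix order (left subtree, right subtree, root). The *sylvester monoid* $\mathrm{Sylv}(A)=A^*/\!\equiv$ is the quotient of the free monoid $A^*$ by the congruence generated by the relations $zxuy\equiv xzuy$ for letters $x\le y<z$ and words $u\in A^*$. Let $\pi:\mathbb C\langle A\rangle\to\mathbb C[\mathrm{Sylv}(A)]\simeq\mathbb C\langle A\rangle/\!\equiv$ be the canonical projection. **Theorem.** $\mathbf{PBT}$ is a graded Hopf subalgebra of $\mathbf{FQSym}$, with basis $(\mathbf P_T)$, and the subalgebra $\pi(\mathbf{FQSym})$ of $\mathbb C[\mathrm{Sylv}(A)]$ is a Hopf algebra for a (unique) coproduct that makes $\pi:\mathbf{FQSym}\to\pi(\mathbf{FQSym})$ a morphism of Hopf algebras. The graded dual Hopf algebra $\mathbf{PBT}^*$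 of $\mathbf{PBT}$ is isomorphic, as a graded Hopf algebra, to $\pi(\mathbf{FQSym})$. More precisely, the elements $\mathbf Q_T=\pi(\mathbf G_{w_T})$, for $T$ an unlabelled binary tree, form a basis of $\pi(\mathbf{FQSym})$, and there is such an isomorphism under which $(\mathbf Q_T)$ is the basis of $\mathbf{PBT}^*$ dual to $(\mathbf P_T)$. -/

import Mathlib

open scoped TensorProduct

noncomputable section

namespace Sylvester

/-- An algebra which is also a coalgebra is a Hopf algebra: the coproduct and the counit are
morphisms of algebras, and there is an antipode (which is then unique, and preserved by all the
bialgebra morphisms between Hopf algebras). -/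
structure IsHopf (A : Type*) [Ring A] [Algebra ℂ A] [Coalgebra ℂ A] : Prop where
  counit_one : CoalgebraStruct.counit (R := ℂ) (1 : A) = 1
  counit_mul : ∀ a b : A, CoalgebraStruct.counit (R := ℂ) (a * b) =
    CoalgebraStruct.counit (R := ℂ) a * CoalgebraStruct.counit (R := ℂ) b
  comul_one : CoalgebraStruct.comul (R := ℂ) (1 : A) = 1
  comul_mul : ∀ a b : A, CoalgebraStruct.comul (R := ℂ) (a * b) =
    CoalgebraStruct.comul (R := ℂ) a * CoalgebraStruct.comul (R := ℂ) b
  exists_antipode : ∃ S : A →ₗ[ℂ] A,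
    LinearMap.mul' ℂ A ∘ₗ S.rTensor A ∘ₗ CoalgebraStruct.comul =
      Algebra.linearMap ℂ A ∘ₗ CoalgebraStruct.counit ∧
    LinearMap.mul' ℂ A ∘ₗ S.lTensor A ∘ₗ CoalgebraStruct.comul =
      Algebra.linearMap ℂ A ∘ₗ CoalgebraStruct.counit

/-! ### Formal series over a monoid -/

/-- Every element of `M` has finitely many factorizations as a product of two elements. -/
class FiniteFactorization (M : Type*) [Monoid M] : Prop where
  finite_factors : ∀ m : M, {p : M × M | p.1 * p.2 = m}.Finite

/-- Formal (possibly infinite) complex linear combinations of elements of `M`;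
the product, defined below, extends that of `M`. -/
structure Series (M : Type*) where
  /-- The coefficient of an element of `M`. -/
  coeff : M → ℂ

namespace Series

variable {M N : Type*}

/-- `f m` is the coefficient of `m` in `f`. -/
instance : FunLike (Series M) M ℂ where
  coe := coeff
  coe_injective := fun ⟨_⟩ ⟨_⟩ h => congrArg mk h

/-- A series is the family of its coefficients. -/
def equivFun : Series M ≃ (M → ℂ) := ⟨coeff, mk, fun _ => rfl, fun _ => rfl⟩

instance : AddCommGroup (Series M) := equivFun.addCommGroup
instance : Module ℂ (Series M) := equivFun.module ℂ

@[ext] theorem ext {f g : Series M} (h : ∀ m, f m = g m) : f = g := DFunLike.ext f g h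
@[simp] theorem add_apply (f g : Series M) (m : M) : (f + g) m = f m + g m := rfl
@[simp] theorem zero_apply (m : M) : (0 : Series M) m = 0 := rfl
@[simp] theorem smul_apply (c : ℂ) (f : Series M) (m : M) : (c • f) m = c * f m := rfl
theorem sum_apply {ι : Type*} (s : Finset ι) (f : ι → Series M) (m : M) :
    (∑ i ∈ s, f i) m = ∑ i ∈ s, f i m :=
  map_sum (⟨⟨fun f : Series M => f m, rfl⟩, fun _ _ => rfl⟩ : Series M →+ ℂ) f s

/-- The formal sum of the elements of a set. -/
def ofSet (S : Set M) : Series M := ⟨S.indicator 1⟩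

open scoped Classical in
theorem ofSet_apply (S : Set M) (m : M) : ofSet S m = if m ∈ S then 1 else 0 :=
  Set.indicator_apply S 1 m

variable [Monoid M] [FiniteFactorization M] [Monoid N] [FiniteFactorization N]

/-- The finite set of factorizations `m = a * b`. -/
def factors (m : M) : Finset (M × M) := (FiniteFactorization.finite_factors m).toFinset

@[simp] theorem mem_factors {m : M} {p : M × M} : p ∈ factors m ↔ p.1 * p.2 = m := by
  simp [factors]

instance : Mul (Series M) := ⟨fun f g => ⟨fun m => ∑ p ∈ factors m, f p.1 * g p.2⟩⟩
instance : One (Series M) := ⟨ofSet {1}⟩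

theorem mul_apply (f g : Series M) (m : M) : (f * g) m = ∑ p ∈ factors m, f p.1 * g p.2 := rfl
theorem one_def {M : Type*} [Monoid M] : (1 : Series M) = ofSet {1} := rfl

instance : Ring (Series M) where
  __ := (inferInstance : AddCommGroup (Series M))
  mul_assoc f g h := by
    ext m
    simp only [mul_apply, Finset.sum_mul, Finset.mul_sum]
    rw [Finset.sum_sigma', Finset.sum_sigma']
    refine Finset.sum_nbij' (fun x => ⟨(x.2.1, x.2.2 * x.1.2), (x.2.2, x.1.2)⟩)
      (fun x => ⟨(x.1.1 * x.2.1, x.2.2), (x.1.1, x.2.1)⟩) ?_ ?_ ?_ ?_ ?_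
    · rintro ⟨⟨a, b⟩, ⟨c, d⟩⟩ h
      simp only [Finset.mem_sigma, mem_factors] at h ⊢
      obtain ⟨rfl, rfl⟩ := h
      simp [mul_assoc]
    · rintro ⟨⟨a, b⟩, ⟨c, d⟩⟩ h
      simp only [Finset.mem_sigma, mem_factors] at h ⊢
      obtain ⟨rfl, rfl⟩ := h
      simp [mul_assoc]
    · rintro ⟨⟨a, b⟩, ⟨c, d⟩⟩ h
      simp only [Finset.mem_sigma, mem_factors] at h ⊢
      obtain ⟨rfl, rfl⟩ := h
      rfl
    · rintro ⟨⟨a, b⟩, ⟨c, d⟩⟩ h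
      simp only [Finset.mem_sigma, mem_factors] at h ⊢
      obtain ⟨rfl, rfl⟩ := h
      rfl
    · intros; simp [mul_assoc]
  one_mul f := by
    classical
    ext m
    rw [mul_apply, Finset.sum_eq_single (1, m)]
    · simp [one_def, ofSet_apply]
    · rintro ⟨a, b⟩ h hne
      have : a ≠ 1 := by rintro rfl; simp_all
      simp [one_def, ofSet_apply, this]
    · simp
  mul_one f := by
    classical
    ext m
    rw [mul_apply, Finset.sum_eq_single (m, 1)]
    · simp [one_def, ofSet_apply]
    · rintro ⟨a, b⟩ h hne
      have : b ≠ 1 := by rintro rfl; simp_all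
      simp [one_def, ofSet_apply, this]
    · simp
  left_distrib f g h := by ext m; simp [mul_apply, mul_add, Finset.sum_add_distrib]
  right_distrib f g h := by ext m; simp [mul_apply, add_mul, Finset.sum_add_distrib]
  zero_mul f := by ext m; simp [mul_apply]
  mul_zero f := by ext m; simp [mul_apply]

instance : Algebra ℂ (Series M) :=
  Algebra.ofModule (fun c f g => by ext m; simp [mul_apply, Finset.mul_sum, mul_assoc])
    (fun c f g => by ext m; simp [mul_apply, Finset.mul_sum, mul_left_comm])

/-- A monoid morphism with finite fibres extends to an algebra morphism between formal series:
the coefficient of `n` in the image is the sum of the coefficients over the fibre of `n`. -/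
def pushforward (φ : M →* N) (hφ : ∀ n, (φ ⁻¹' {n}).Finite) : Series M →ₐ[ℂ] Series N :=
  AlgHom.ofLinearMap
    { toFun := fun f => ⟨fun n => ∑ m ∈ (hφ n).toFinset, f m⟩
      map_add' := fun f g => by
        ext n; exact Finset.sum_add_distrib
      map_smul' := fun c f => by
        ext n; exact (Finset.mul_sum _ _ _).symm }
    (by
      classical
      ext n
      change ∑ m ∈ (hφ n).toFinset, (1 : Series M) m = _
      simp only [one_def, ofSet_apply, Set.mem_singleton_iff, Finset.sum_ite_eq']
      simp [eq_comm])
    (by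
      intro f g
      ext n
      change ∑ m ∈ (hφ n).toFinset, (f * g) m =
        ∑ c ∈ factors n, (∑ a ∈ (hφ c.1).toFinset, f a) * (∑ b ∈ (hφ c.2).toFinset, g b)
      simp only [mul_apply, Finset.sum_mul_sum, ← Finset.sum_product']
      rw [Finset.sum_sigma', Finset.sum_sigma']
      refine Finset.sum_nbij' (fun x => ⟨(φ x.2.1, φ x.2.2), x.2⟩)
        (fun x => ⟨x.2.1 * x.2.2, x.2⟩) ?_ ?_ ?_ ?_ ?_
      · rintro ⟨m, ⟨a, b⟩⟩ h
        simp only [Finset.mem_sigma, mem_factors, Set.Finite.mem_toFinset, Set.mem_preimage,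
          Set.mem_singleton_iff, Finset.mem_product] at h ⊢
        obtain ⟨rfl, rfl⟩ := h
        simp
      · rintro ⟨⟨c, d⟩, ⟨a, b⟩⟩ h
        simp only [Finset.mem_sigma, mem_factors, Set.Finite.mem_toFinset, Set.mem_preimage,
          Set.mem_singleton_iff, Finset.mem_product] at h ⊢
        obtain ⟨rfl, rfl, rfl⟩ := h
        simp
      · rintro ⟨m, ⟨a, b⟩⟩ h
        simp only [Finset.mem_sigma, mem_factors, Set.Finite.mem_toFinset, Set.mem_preimage,
          Set.mem_singleton_iff] at h ⊢
        obtain ⟨rfl, rfl⟩ := h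
        rfl
      · rintro ⟨⟨c, d⟩, ⟨a, b⟩⟩ h
        simp only [Finset.mem_sigma, mem_factors, Set.Finite.mem_toFinset, Set.mem_preimage,
          Set.mem_singleton_iff, Finset.mem_product] at h ⊢
        obtain ⟨rfl, rfl, rfl⟩ := h
        rfl
      · intros; rfl)

end Series

/-! ### Words, the sylvester monoid and the canonical projection -/

/-- Words over the ordered alphabet `A = {0 < 1 < 2 < ⋯}`. -/
abbrev Word : Type := FreeMonoid ℕ

/-- The sylvester relations `z x u y ≡ x z u y` for letters `x ≤ y < z` and a word `u`. -/
inductive SylvRel : Word → Word → Prop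
  | mk (x y z : ℕ) (u : Word) (hxy : x ≤ y) (hyz : y < z) :
      SylvRel (.of z * .of x * u * .of y) (.of x * .of z * u * .of y)

/-- The sylvester congruence. -/
def sylvCon : Con Word := conGen SylvRel

/-- The sylvester monoid `Sylv(A)`. -/
abbrev Sylv : Type := sylvCon.Quotient

/-- The multiset of letters of a word. -/
def letters : Word →* Multiplicative (Multiset ℕ) :=
  FreeMonoid.lift fun a => Multiplicative.ofAdd {a}

theorem letters_apply (w : Word) :
    letters w = Multiplicative.ofAdd (w.toList : Multiset ℕ) := by
  induction w using FreeMonoid.inductionOn' with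
  | one => rfl
  | of_mul a w ih =>
    rw [map_mul, ih, letters, FreeMonoid.lift_eval_of]
    rfl

theorem sylvCon_le_ker_letters : sylvCon ≤ Con.ker letters := by
  refine Con.conGen_le.2 ?_
  rintro _ _ ⟨x, y, z, u, hxy, hyz⟩
  simp only [Con.ker_rel, map_mul, mul_comm (letters (.of z))]

theorem finite_same_letters (w : Word) : {v : Word | letters v = letters w}.Finite := by
  refine Set.Finite.subset (s := FreeMonoid.toList ⁻¹' {l | l ∈ w.toList.permutations}) ?_ ?_
  · exact Set.Finite.preimage FreeMonoid.toList.injective.injOn (List.finite_toSet _)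
  · intro v hv
    simp only [Set.mem_ofPred_eq, letters_apply] at hv
    simpa using hv

instance : FiniteFactorization Word where
  finite_factors w := by
    refine Set.Finite.subset (s := (fun k : ℕ =>
      (FreeMonoid.ofList (w.toList.take k), FreeMonoid.ofList (w.toList.drop k))) ''
        Set.Iic w.length) ((Set.finite_Iic _).image _) ?_
    rintro ⟨a, b⟩ rfl
    refine ⟨a.length, by simp, ?_⟩
    simp [FreeMonoid.length]

theorem finite_sylv_class (c : Sylv) : (sylvCon.mk' ⁻¹' {c}).Finite := by
  induction c using Con.induction_on with
  | H w =>
    refine (finite_same_letters w).subset fun v hv => ?_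
    exact sylvCon_le_ker_letters ((Con.eq sylvCon).1 hv)

instance : FiniteFactorization Sylv where
  finite_factors c := by
    have h : (⋃ w ∈ sylvCon.mk' ⁻¹' {c}, {p : Word × Word | p.1 * p.2 = w}).Finite :=
      (finite_sylv_class c).biUnion fun w _ => FiniteFactorization.finite_factors w
    refine (h.image (Prod.map sylvCon.mk' sylvCon.mk')).subset ?_
    rintro ⟨a, b⟩ hab
    induction a using Con.induction_on with
    | H a =>
      induction b using Con.induction_on with
      | H b =>
        refine ⟨(a, b), ?_, rfl⟩
        simp only [Set.mem_iUnion]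
        exact ⟨a * b, hab, rfl⟩

/-- The canonical projection `π` from the algebra of the free monoid to that of `Sylv(A)`. -/
def sylvProj : Series Word →ₐ[ℂ] Series Sylv :=
  Series.pushforward sylvCon.mk' finite_sylv_class

/-! ### Standardization and `FQSym` -/

/-- The standardization of a word `v 0, v 1, …`, as a permutation: the letters are numbered
in increasing order, equal letters being numbered from left to right. -/
def std {α : Type*} [LinearOrder α] {n : ℕ} (v : Fin n → α) : Equiv.Perm (Fin n) :=
  (Tuple.sort v)⁻¹

section std
variable {α β : Type*} [LinearOrder α] [LinearOrder β] {n m : ℕ}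

theorem std_lt_iff (v : Fin n → α) {i j : Fin n} (h : i < j) :
    std v i < std v j ↔ v i ≤ v j := by
  obtain ⟨a, rfl⟩ := (Tuple.sort v).surjective i
  obtain ⟨b, rfl⟩ := (Tuple.sort v).surjective j
  obtain ⟨h1, h2⟩ := Tuple.eq_sort_iff.1 (rfl : Tuple.sort v = Tuple.sort v)
  change (Tuple.sort v).symm _ < (Tuple.sort v).symm _ ↔ _
  rw [Equiv.symm_apply_apply, Equiv.symm_apply_apply]
  constructor
  · intro hab; exact h1 hab.le
  · intro hab
    by_contra hba
    have hba := not_lt.1 hba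
    rcases hba.eq_or_lt with e | e
    · subst e; exact lt_irrefl _ h
    · exact absurd (h2 b a e (le_antisymm (h1 hba) hab)) h.not_gt

theorem std_eq_iff (v : Fin n → α) (w : Fin n → β) :
    std v = std w ↔ ∀ i j, i < j → (v i ≤ v j ↔ w i ≤ w j) := by
  constructor
  · intro h i j hij
    rw [← std_lt_iff v hij, ← std_lt_iff w hij, h]
  · intro h
    rw [std, std, inv_inj, Tuple.eq_sort_iff]
    obtain ⟨h1, h2⟩ := Tuple.eq_sort_iff.1 (rfl : Tuple.sort v = Tuple.sort v)
    have key : ∀ a b, a < b → w (Tuple.sort v a) ≤ w (Tuple.sort v b) ∧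
        (w (Tuple.sort v a) = w (Tuple.sort v b) → Tuple.sort v a < Tuple.sort v b) := by
      intro a b hab
      have hne : Tuple.sort v a ≠ Tuple.sort v b := fun e => hab.ne ((Tuple.sort v).injective e)
      rcases lt_or_gt_of_ne hne with hl | hl
      · exact ⟨(h _ _ hl).1 (h1 hab.le), fun _ => hl⟩
      · have : ¬ w (Tuple.sort v b) ≤ w (Tuple.sort v a) := fun hc => by
          have := (h _ _ hl).2 hc
          exact absurd (h2 a b hab (le_antisymm (h1 hab.le) this)) hl.not_gt
        exact ⟨(not_le.1 this).le, fun e => absurd e.ge this⟩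
    refine ⟨fun a b hab => ?_, fun a b hab => (key a b hab).2⟩
    rcases hab.eq_or_lt with rfl | hab
    · exact le_rfl
    · exact (key a b hab).1

/-- Standardizing a subword commutes with standardization. -/
theorem std_comp (v : Fin n → α) {e : Fin m → Fin n} (he : StrictMono e) :
    std (std v ∘ e) = std (v ∘ e) := by
  rw [std_eq_iff]
  intro i j hij
  rw [Function.comp_apply, Function.comp_apply, Function.comp_apply, Function.comp_apply,
    ← std_lt_iff v (he hij)]
  refine ⟨fun h => lt_of_le_of_ne h fun hh => hij.ne (he.injective ((std v).injective hh)), le_of_lt⟩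

end std

/-- The word `v 0, v 1, …, v (n - 1)`. -/
def wordOf {n : ℕ} (v : Fin n → ℕ) : Word := FreeMonoid.ofList (List.ofFn v)

/-- The series `F_σ`, the sum of the words with standardization `σ⁻¹`. -/
def F {n : ℕ} (σ : Equiv.Perm (Fin n)) : Series Word :=
  Series.ofSet {w | ∃ v : Fin n → ℕ, std v = σ⁻¹ ∧ w = wordOf v}

/-- The series `G_σ = F_{σ⁻¹}`. -/
def G {n : ℕ} (σ : Equiv.Perm (Fin n)) : Series Word := F σ⁻¹

section product

theorem wordOf_length {n : ℕ} (v : Fin n → ℕ) : (wordOf v).length = n := by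
  simp [wordOf, FreeMonoid.length]

theorem wordOf_injective {n : ℕ} : Function.Injective (wordOf (n := n)) := fun v w h =>
  List.ofFn_injective (FreeMonoid.ofList.injective h)

theorem wordOf_append {a b : ℕ} (u : Fin a → ℕ) (v : Fin b → ℕ) :
    wordOf (Fin.append u v) = wordOf u * wordOf v := by
  simp [wordOf, List.ofFn_fin_append]

theorem sum_F_apply {n : ℕ} (S : Finset (Equiv.Perm (Fin n))) (w : Word) :
    (∑ γ ∈ S, F γ) w = Series.ofSet {w | ∃ v : Fin n → ℕ, (std v)⁻¹ ∈ S ∧ w = wordOf v} w := by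
  classical
  simp only [Series.sum_apply, F, Series.ofSet_apply, Set.mem_ofPred_eq]
  by_cases h : ∃ v : Fin n → ℕ, w = wordOf v
  · obtain ⟨v, rfl⟩ := h
    have h1 : ∀ σ : Equiv.Perm (Fin n), (∃ v' : Fin n → ℕ, std v' = σ⁻¹ ∧ wordOf v = wordOf v') ↔
        (std v)⁻¹ = σ := fun σ => by
      constructor
      · rintro ⟨v', h, h'⟩
        rw [wordOf_injective h', h, inv_inv]
      · rintro rfl
        exact ⟨v, (inv_inv _).symm, rfl⟩
    have h2 : (∃ v' : Fin n → ℕ, (std v')⁻¹ ∈ S ∧ wordOf v = wordOf v') ↔ (std v)⁻¹ ∈ S := by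
      constructor
      · rintro ⟨v', h, h'⟩
        rwa [wordOf_injective h']
      · exact fun h => ⟨v, h, rfl⟩
    simp only [h1, h2, Finset.sum_ite_eq]
  · rw [if_neg (fun ⟨v, _, hv⟩ => h ⟨v, hv⟩)]
    exact Finset.sum_eq_zero fun σ _ => if_neg fun ⟨v, _, hv⟩ => h ⟨v, hv⟩

theorem sum_F {n : ℕ} (S : Finset (Equiv.Perm (Fin n))) :
    ∑ γ ∈ S, F γ = Series.ofSet {w | ∃ v : Fin n → ℕ, (std v)⁻¹ ∈ S ∧ w = wordOf v} :=
  Series.ext (sum_F_apply S)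

theorem ofSet_mul {X Y : Set Word} {a : ℕ} (hX : ∀ w ∈ X, w.length = a) :
    Series.ofSet X * Series.ofSet Y = Series.ofSet {w | ∃ x ∈ X, ∃ y ∈ Y, w = x * y} := by
  classical
  ext w
  simp only [Series.mul_apply, Series.ofSet_apply, Set.mem_ofPred_eq, mul_ite, mul_one, mul_zero,
    ← ite_and]
  by_cases h : ∃ x ∈ X, ∃ y ∈ Y, w = x * y
  · rw [if_pos h]
    obtain ⟨x, hx, y, hy, rfl⟩ := h
    rw [Finset.sum_eq_single (x, y)]
    · simp [hx, hy]
    · rintro ⟨x', y'⟩ h hne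
      refine if_neg fun hh => hne ?_
      have h : x' * y' = x * y := Series.mem_factors.1 h
      have hl : x'.toList.length = x.toList.length := (hX _ hh.2).trans (hX _ hx).symm
      have e : x'.toList ++ y'.toList = x.toList ++ y.toList := by
        rw [← FreeMonoid.toList_mul, h, FreeMonoid.toList_mul]
      have := List.append_inj e hl
      exact Prod.ext (FreeMonoid.toList.injective this.1) (FreeMonoid.toList.injective this.2)
    · intro h; exact (h (Series.mem_factors.2 rfl)).elim
  · rw [if_neg h]
    refine Finset.sum_eq_zero ?_
    rintro ⟨x, y⟩ hxy
    exact if_neg fun hh => h ⟨x, hh.2, y, hh.1, (Series.mem_factors.1 hxy).symm⟩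

/-- The standardization of the prefix of length `a`, on inverses. -/
def resL {a b : ℕ} (γ : Equiv.Perm (Fin (a + b))) : Equiv.Perm (Fin a) :=
  (std (⇑γ⁻¹ ∘ Fin.castAdd b))⁻¹

/-- The standardization of the suffix of length `b`, on inverses. -/
def resR {a b : ℕ} (γ : Equiv.Perm (Fin (a + b))) : Equiv.Perm (Fin b) :=
  (std (⇑γ⁻¹ ∘ Fin.natAdd a))⁻¹

theorem sum_F_mul_sum_F {a b : ℕ} (S : Finset (Equiv.Perm (Fin a)))
    (T : Finset (Equiv.Perm (Fin b))) :
    (∑ α ∈ S, F α) * (∑ β ∈ T, F β) =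
      ∑ γ : Equiv.Perm (Fin (a + b)) with resL γ ∈ S ∧ resR γ ∈ T, F γ := by
  rw [sum_F, sum_F, sum_F, ofSet_mul (a := a) (by rintro _ ⟨v, _, rfl⟩; exact wordOf_length v)]
  congr 1
  have hL : ∀ v : Fin (a + b) → ℕ, resL (std v)⁻¹ = (std (v ∘ Fin.castAdd b))⁻¹ := fun v => by
    rw [resL, inv_inv, std_comp v (Fin.strictMono_castAdd b)]
  have hR : ∀ v : Fin (a + b) → ℕ, resR (std v)⁻¹ = (std (v ∘ Fin.natAdd a))⁻¹ := fun v => by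
    rw [resR, inv_inv, std_comp v (Fin.strictMono_natAdd a)]
  ext w
  simp only [Set.mem_ofPred_eq, Finset.mem_filter, Finset.mem_univ, true_and, hL, hR]
  constructor
  · rintro ⟨_, ⟨u, hu, rfl⟩, _, ⟨v, hv, rfl⟩, rfl⟩
    refine ⟨Fin.append u v, ⟨?_, ?_⟩, (wordOf_append u v).symm⟩
    · rwa [show Fin.append u v ∘ Fin.castAdd b = u from funext fun i => Fin.append_left u v i]
    · rwa [show Fin.append u v ∘ Fin.natAdd a = v from funext fun i => Fin.append_right u v i]
  · rintro ⟨v, ⟨h1, h2⟩, rfl⟩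
    refine ⟨_, ⟨_, h1, rfl⟩, _, ⟨_, h2, rfl⟩, ?_⟩
    rw [← wordOf_append]
    congr 1
    exact (Fin.append_castAdd_natAdd (f := v)).symm

theorem F_one : F (1 : Equiv.Perm (Fin 0)) = 1 := by
  rw [F, Series.one_def]
  congr 1
  ext w
  simp only [Set.mem_ofPred_eq, Set.mem_singleton_iff]
  constructor
  · rintro ⟨v, _, rfl⟩; simp [wordOf]
  · rintro rfl; exact ⟨Fin.elim0, Subsingleton.elim _ _, by simp [wordOf]⟩

end product

/-- The algebra `FQSym`, spanned by the `F_σ`. -/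
def FQSym : Subalgebra ℂ (Series Word) :=
  (Submodule.span ℂ (Set.range fun σ : Σ n, Equiv.Perm (Fin n) => F σ.2)).toSubalgebra
    (Submodule.subset_span ⟨⟨0, 1⟩, F_one⟩)
    (fun x y hx hy => by
      have := Submodule.mul_mem_mul hx hy
      rw [Submodule.span_mul_span] at this
      refine Submodule.span_le.2 ?_ this
      rintro _ ⟨_, ⟨⟨a, α⟩, rfl⟩, _, ⟨⟨b, β⟩, rfl⟩, rfl⟩
      have h := sum_F_mul_sum_F {α} {β}
      rw [Finset.sum_singleton, Finset.sum_singleton] at h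
      change F α * F β ∈ Submodule.span ℂ _
      rw [h]
      exact Submodule.sum_mem _ fun γ _ => Submodule.subset_span ⟨⟨a + b, γ⟩, rfl⟩)

theorem F_mem {n : ℕ} (σ : Equiv.Perm (Fin n)) : F σ ∈ FQSym :=
  Submodule.subset_span ⟨⟨n, σ⟩, rfl⟩

/-- The standardization of the prefix of length `k` of the word `σ`. -/
def prefixStd {n : ℕ} (σ : Equiv.Perm (Fin n)) (k : Fin (n + 1)) : Equiv.Perm (Fin k) :=
  std fun i : Fin k => σ ⟨i, by omega⟩

/-- The standardization of the word `σ` deprived of its prefix of length `k`. -/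
def suffixStd {n : ℕ} (σ : Equiv.Perm (Fin n)) (k : Fin (n + 1)) : Equiv.Perm (Fin (n - k)) :=
  std fun i : Fin (n - k) => σ ⟨k + i, by omega⟩

/-- The element `F_σ` of `FQSym`. -/
def FElt {n : ℕ} (σ : Equiv.Perm (Fin n)) : FQSym := ⟨F σ, F_mem σ⟩

/-- The coproduct of `FQSym` is the standard one:
`Δ F_σ = ∑ F_{std u} ⊗ F_{std v}`, the sum over the factorizations of `σ`, as a word, into `u v`.
As the `F_σ` span `FQSym`, this determines the coalgebra structure. -/
def IsFQSymCoproduct (_ : Coalgebra ℂ FQSym) : Prop :=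
  ∀ (n : ℕ) (σ : Equiv.Perm (Fin n)),
    CoalgebraStruct.comul (R := ℂ) (FElt σ) =
      ∑ k : Fin (n + 1), FElt (prefixStd σ k) ⊗ₜ[ℂ] FElt (suffixStd σ k)

/-! ### Binary trees -/

section trees
variable {α β : Type*} [LinearOrder α] [LinearOrder β]

/-- The decreasing tree of a word with distinct letters: the root is the greatest letter `m`, and
if the word is `u m v`, the left and right subtrees are the decreasing trees of `u` and `v`. -/
def decTree (w : List α) : BinaryTree α :=
  match h : w.max? with
  | none => .nil
  | some m => .node m (decTree (w.takeWhile (· ≠ m))) (decTree (w.dropWhile (· ≠ m)).tail)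
termination_by w.length
decreasing_by
  all_goals
    obtain ⟨s, t, hw, hm⟩ := List.eq_append_cons_of_mem (List.max?_mem h)
    have hs : ∀ x ∈ s, decide (x ≠ m) = true := fun x hx => by
      simpa using fun e : x = m => hm (e ▸ hx)
    rw [hw]
    first
    | rw [List.takeWhile_append_of_pos hs]; simp
    | rw [List.dropWhile_append_of_pos hs]; simp; omega

/-- The shape of a labelled binary tree. -/
def shape {α : Type*} (T : BinaryTree α) : BinaryTree Unit := T.map fun _ => ()

/-- The sequence of labels of a binary tree in postfix order (left subtree, right subtree,
root). -/
def postfixWord {α : Type*} : BinaryTree α → List α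
  | .nil => []
  | .node a l r => postfixWord l ++ postfixWord r ++ [a]

/-- The tree `𝒬(w) = 𝒯((std w)⁻¹)` of a word, with labels `0, …, n - 1`. -/
def Qsymbol {n : ℕ} (w : Fin n → α) : BinaryTree (Fin n) := decTree (List.ofFn ⇑(std w)⁻¹)

/-- The tree `𝒫(w)`: each label `i` of `𝒬(w)` is replaced with the `i`-th letter of `w`. -/
def Psymbol {n : ℕ} (w : Fin n → α) : BinaryTree α := (Qsymbol w).map w

/-- The `𝒫`-symbol of a permutation, identified with its shape. -/
def permTree {n : ℕ} (σ : Equiv.Perm (Fin n)) : BinaryTree Unit := shape (Psymbol σ)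

theorem decTree_nil : decTree ([] : List α) = .nil := by
  rw [decTree.eq_def]; rfl

theorem decTree_append (s t : List α) (m : α) (hm : m ∉ s) (hs : ∀ x ∈ s, x ≤ m)
    (ht : ∀ x ∈ t, x ≤ m) : decTree (s ++ m :: t) = .node m (decTree s) (decTree t) := by
  have h : (s ++ m :: t).max? = some m := by
    rw [List.max?_eq_some_iff]
    refine ⟨by simp, fun b hb => ?_⟩
    simp only [List.mem_append, List.mem_cons] at hb
    rcases hb with hb | rfl | hb
    exacts [hs _ hb, le_rfl, ht _ hb]
  have hs' : ∀ x ∈ s, decide (x ≠ m) = true := fun x hx => by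
    simpa using fun e : x = m => hm (e ▸ hx)
  rw [decTree.eq_def]
  split
  · simp_all
  · next m' h' =>
    obtain rfl : m = m' := Option.some.inj (h.symm.trans h')
    rw [List.takeWhile_append_of_pos hs', List.dropWhile_append_of_pos hs']
    simp

theorem exists_decomp (l : List α) (hl : l ≠ []) : ∃ s t m, l = s ++ m :: t ∧ m ∉ s ∧
    (∀ x ∈ s, x ≤ m) ∧ (∀ x ∈ t, x ≤ m) := by
  obtain ⟨m, hm⟩ : ∃ m, l.max? = some m := by
    cases h : l.max? with
    | none => exact absurd (List.max?_eq_none_iff.1 h) hl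
    | some m => exact ⟨m, rfl⟩
  obtain ⟨h1, h2⟩ := List.max?_eq_some_iff.1 hm
  obtain ⟨s, t, rfl, hs⟩ := List.eq_append_cons_of_mem h1
  exact ⟨s, t, m, rfl, hs, fun x hx => h2 x (by simp [hx]), fun x hx => h2 x (by simp [hx])⟩

theorem decTree_map {e : α → β} (he : StrictMono e) (l : List α) :
    decTree (l.map e) = (decTree l).map e := by
  induction hn : l.length using Nat.strong_induction_on generalizing l with
  | _ n ih =>
    rcases eq_or_ne l [] with rfl | hl
    · simp [decTree_nil, BinaryTree.map]
    · obtain ⟨s, t, m, rfl, hm, hs, ht⟩ := exists_decomp l hl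
      simp only [List.length_append, List.length_cons] at hn
      rw [decTree_append s t m hm hs ht, List.map_append, List.map_cons, decTree_append,
        ih _ (by omega) s rfl, ih _ (by omega) t rfl, BinaryTree.map]
      · intro hx
        obtain ⟨x, hx, e'⟩ := List.mem_map.1 hx
        exact hm (he.injective e' ▸ hx)
      · simpa using fun x hx => he.monotone (hs x hx)
      · simpa using fun x hx => he.monotone (ht x hx)

theorem shape_map {α β : Type*} (e : α → β) (T : BinaryTree α) : shape (T.map e) = shape T :=
  (BinaryTree.comp_map e (fun _ => ()) T).symm

theorem numNodes_shape {α : Type*} (T : BinaryTree α) : (shape T).numNodes = T.numNodes := by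
  induction T with
  | nil => rfl
  | node a l r hl hr =>
    simp only [shape, BinaryTree.map, BinaryTree.numNodes] at *
    rw [hl, hr]

theorem numNodes_decTree (l : List α) : (decTree l).numNodes = l.length := by
  induction hn : l.length using Nat.strong_induction_on generalizing l with
  | _ n ih =>
    rcases eq_or_ne l [] with rfl | hl
    · simpa [decTree_nil] using hn
    · obtain ⟨s, t, m, rfl, hm, hs, ht⟩ := exists_decomp l hl
      simp only [List.length_append, List.length_cons] at hn
      rw [decTree_append s t m hm hs ht, BinaryTree.numNodes, ih _ (by omega) s rfl,
        ih _ (by omega) t rfl]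
      omega

theorem shape_decTree_length {l : List α} {l' : List β}
    (h : shape (decTree l) = shape (decTree l')) : l.length = l'.length := by
  rw [← numNodes_decTree l, ← numNodes_shape, h, numNodes_shape, numNodes_decTree]

theorem shape_decTree_append (l₁ l₂ : List α) (k₁ k₂ : List β) (hlen : l₁.length = k₁.length)
    (h : shape (decTree (l₁ ++ l₂)) = shape (decTree (k₁ ++ k₂))) :
    shape (decTree l₁) = shape (decTree k₁) ∧ shape (decTree l₂) = shape (decTree k₂) := by
  induction hn : (l₁ ++ l₂).length using Nat.strong_induction_on generalizing l₁ l₂ k₁ k₂ with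
  | _ n ih =>
    have hlen' := shape_decTree_length h
    rcases eq_or_ne (l₁ ++ l₂) [] with hl | hl
    · rw [hl] at hlen'
      obtain ⟨rfl, rfl⟩ := List.append_eq_nil_iff.1 hl
      obtain ⟨rfl, rfl⟩ := List.append_eq_nil_iff.1 (List.length_eq_zero_iff.1 hlen'.symm)
      simp [decTree_nil, shape, BinaryTree.map]
    have hk : k₁ ++ k₂ ≠ [] := fun e => hl (List.length_eq_zero_iff.1 (by rw [hlen', e]; rfl))
    obtain ⟨s, t, m, e, hm, hs, ht⟩ := exists_decomp _ hl
    obtain ⟨s', t', m', e', hm', hs', ht'⟩ := exists_decomp _ hk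
    rw [e, e', decTree_append s t m hm hs ht, decTree_append s' t' m' hm' hs' ht'] at h
    simp only [shape, BinaryTree.map, BinaryTree.node.injEq, true_and] at h
    obtain ⟨h1, h2⟩ := h
    have hs_len : s.length = s'.length := shape_decTree_length h1
    have hlt : s.length + t.length + 1 = n := by
      rw [← hn, e]; simp [add_assoc]
    rcases Nat.lt_or_ge s.length l₁.length with hc | hc
    · obtain ⟨b, rfl, rfl⟩ : ∃ b, l₁ = s ++ m :: b ∧ t = b ++ l₂ := by
        rcases List.append_eq_append_iff.1 e with ⟨a, rfl, h⟩ | ⟨a, rfl, h⟩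
        · simp at hc
        · cases a with
          | nil => simp at hc
          | cons x a => simp at h; exact ⟨a, by rw [h.1], h.2⟩
      obtain ⟨b', rfl, rfl⟩ : ∃ b, k₁ = s' ++ m' :: b ∧ t' = b ++ k₂ := by
        rcases List.append_eq_append_iff.1 e' with ⟨a, rfl, h⟩ | ⟨a, rfl, h⟩
        · simp at hc hlen hs_len; omega
        · cases a with
          | nil => simp at hc hlen hs_len; omega
          | cons x a => simp at h; exact ⟨a, by rw [h.1], h.2⟩
      have := ih _ (by omega) b l₂ b' k₂ (by simp at hlen; omega) h2 rfl
      refine ⟨?_, this.2⟩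
      rw [decTree_append s b m hm hs fun x hx => ht x (by simp [hx]),
        decTree_append s' b' m' hm' hs' fun x hx => ht' x (by simp [hx])]
      simp only [shape, BinaryTree.map, BinaryTree.node.injEq, true_and]
      exact ⟨h1, this.1⟩
    · obtain ⟨b, rfl, rfl⟩ : ∃ b, s = l₁ ++ b ∧ l₂ = b ++ m :: t := by
        rcases List.append_eq_append_iff.1 e with ⟨a, rfl, h⟩ | ⟨a, rfl, h⟩
        · exact ⟨a, rfl, h⟩
        · cases a with
          | nil => exact ⟨[], by simp, by simpa using h.symm⟩
          | cons x a => simp at hc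
      obtain ⟨b', rfl, rfl⟩ : ∃ b, s' = k₁ ++ b ∧ k₂ = b ++ m' :: t' := by
        rcases List.append_eq_append_iff.1 e' with ⟨a, rfl, h⟩ | ⟨a, rfl, h⟩
        · exact ⟨a, rfl, h⟩
        · cases a with
          | nil => exact ⟨[], by simp, by simpa using h.symm⟩
          | cons x a => simp at hc hlen hs_len; omega
      have := ih _ (by omega) l₁ b k₁ b' hlen h1 rfl
      refine ⟨this.1, ?_⟩
      rw [decTree_append b t m (fun hx => hm (by simp [hx])) (fun x hx => hs x (by simp [hx])) ht,
        decTree_append b' t' m' (fun hx => hm' (by simp [hx]))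
          (fun x hx => hs' x (by simp [hx])) ht']
      simp only [shape, BinaryTree.map, BinaryTree.node.injEq, true_and]
      exact ⟨this.2, h2⟩

theorem permTree_eq {n : ℕ} (σ : Equiv.Perm (Fin n)) :
    permTree σ = shape (decTree (List.ofFn ⇑σ⁻¹)) := by
  rw [permTree, Psymbol, shape_map, Qsymbol, show std ⇑σ = σ by rw [std, Tuple.sort_perm, inv_inv]]

theorem numNodes_permTree {n : ℕ} (σ : Equiv.Perm (Fin n)) : (permTree σ).numNodes = n := by
  rw [permTree_eq, numNodes_shape, numNodes_decTree, List.length_ofFn]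

theorem permTree_std_inv {n : ℕ} (v : Fin n → α) (hv : Function.Injective v) :
    permTree (std v)⁻¹ = shape (decTree (List.ofFn v)) := by
  rw [permTree_eq, inv_inv]
  have he : StrictMono (v ∘ Tuple.sort v) :=
    (Tuple.monotone_sort v).strictMono_of_injective (hv.comp (Tuple.sort v).injective)
  have : List.ofFn v = (List.ofFn (std v)).map (v ∘ Tuple.sort v) := by
    rw [List.map_ofFn]
    congr 1
    funext i
    exact congrArg v ((Tuple.sort v).apply_symm_apply i).symm
  rw [this, decTree_map he, shape_map]

theorem permTree_res {a b : ℕ} (γ γ' : Equiv.Perm (Fin (a + b))) (h : permTree γ = permTree γ') :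
    permTree (resL γ) = permTree (resL γ') ∧ permTree (resR γ) = permTree (resR γ') := by
  have key : ∀ γ : Equiv.Perm (Fin (a + b)), List.ofFn ⇑γ⁻¹ =
      List.ofFn (⇑γ⁻¹ ∘ Fin.castAdd b) ++ List.ofFn (⇑γ⁻¹ ∘ Fin.natAdd a) := fun γ => by
    rw [← List.ofFn_fin_append]
    congr 1
    exact (Fin.append_castAdd_natAdd (f := ⇑γ⁻¹)).symm
  rw [permTree_eq, permTree_eq, key, key] at h
  have := shape_decTree_append _ _ _ _ (by simp) h
  have hL := fun γ : Equiv.Perm (Fin (a + b)) => permTree_std_inv (⇑γ⁻¹ ∘ Fin.castAdd b)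
    ((γ⁻¹).injective.comp (Fin.strictMono_castAdd b).injective)
  have hR := fun γ : Equiv.Perm (Fin (a + b)) => permTree_std_inv (⇑γ⁻¹ ∘ Fin.natAdd a)
    ((γ⁻¹).injective.comp (Fin.strictMono_natAdd a).injective)
  rw [resL, resL, resR, resR, hL, hL, hR, hR]
  exact this

end trees

/-! ### The algebra `PBT` -/

/-- The series `P_T`, the sum of the `F_σ` over the permutations `σ` with `𝒫(σ) = T`. -/
def P (T : BinaryTree Unit) : Series Word :=
  ∑ σ : Equiv.Perm (Fin T.numNodes) with permTree σ = T, F σ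

theorem sum_F_mem_span_P {n : ℕ} (S : Finset (Equiv.Perm (Fin n)))
    (hS : ∀ γ γ', permTree γ = permTree γ' → γ ∈ S → γ' ∈ S) :
    ∑ γ ∈ S, F γ ∈ Submodule.span ℂ (Set.range P) := by
  classical
  rw [← Finset.sum_fiberwise_of_maps_to (t := S.image permTree) (g := permTree)
    (fun i hi => Finset.mem_image_of_mem _ hi)]
  refine Submodule.sum_mem _ fun T hT => ?_
  obtain ⟨γ, hγ, hγT⟩ := Finset.mem_image.1 hT
  have hn : T.numNodes = n := by rw [← hγT, numNodes_permTree]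
  subst hn
  refine Submodule.subset_span ⟨T, Finset.sum_congr ?_ fun _ _ => rfl⟩
  ext σ
  simp only [Finset.mem_filter, Finset.mem_univ, true_and]
  exact ⟨fun h => ⟨hS γ σ (hγT.trans h.symm) hγ, h⟩, fun h => h.2⟩

theorem P_nil : P .nil = 1 := by
  rw [← F_one]
  change ∑ σ : Equiv.Perm (Fin 0) with permTree σ = .nil, F σ = F 1
  rw [Finset.sum_eq_single (1 : Equiv.Perm (Fin 0))]
  · exact fun σ _ h => absurd (Subsingleton.elim (α := Equiv.Perm (Fin 0)) σ 1) h
  · intro h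
    refine absurd (Finset.mem_filter.2 ⟨Finset.mem_univ _, ?_⟩) h
    simp [permTree_eq, decTree_nil, shape, BinaryTree.map]

/-- The algebra `PBT` of planar binary trees, spanned by the `P_T`. -/
def PBT : Subalgebra ℂ (Series Word) :=
  (Submodule.span ℂ (Set.range P)).toSubalgebra
    (Submodule.subset_span ⟨.nil, P_nil⟩)
    (fun x y hx hy => by
      have := Submodule.mul_mem_mul hx hy
      rw [Submodule.span_mul_span] at this
      refine Submodule.span_le.2 ?_ this
      rintro _ ⟨_, ⟨T₁, rfl⟩, _, ⟨T₂, rfl⟩, rfl⟩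
      change P T₁ * P T₂ ∈ Submodule.span ℂ _
      rw [P, P, sum_F_mul_sum_F]
      refine sum_F_mem_span_P _ fun γ γ' h hγ => ?_
      have := permTree_res γ γ' h
      simp only [Finset.mem_filter, Finset.mem_univ, true_and] at hγ ⊢
      rwa [← this.1, ← this.2])

theorem PBT_le_FQSym : PBT ≤ FQSym := by
  refine Submodule.span_le.2 ?_
  rintro _ ⟨T, rfl⟩
  exact Submodule.sum_mem _ fun σ _ => F_mem σ

/-! ### The permutation `w_T`, and the series `Q_T` -/

/-- Labels the vertices of a tree by `k, k + 1, …` in infix order. -/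
def infixLabel : ℕ → BinaryTree Unit → BinaryTree ℕ
  | _, .nil => .nil
  | k, .node _ l r =>
    .node (k + l.numNodes) (infixLabel k l) (infixLabel (k + l.numNodes + 1) r)

/-- The word `w_T` on the letters `0, …, n - 1`: the postfix reading of the binary search tree
of shape `T` labelled in infix order. -/
def treeWord (T : BinaryTree Unit) : List ℕ := postfixWord (infixLabel 0 T)

theorem postfixWord_infixLabel_perm (T : BinaryTree Unit) (k : ℕ) :
    (postfixWord (infixLabel k T)).Perm (List.range' k T.numNodes) := by
  induction T generalizing k with
  | nil => simp [infixLabel, postfixWord]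
  | node a l r hl hr =>
    have h := List.range'_append_1 (s := k) (m := l.numNodes) (n := r.numNodes + 1)
    rw [infixLabel, postfixWord, BinaryTree.numNodes, add_assoc l.numNodes, ← h, List.range'_succ,
      List.append_assoc]
    refine (hl k).append (List.perm_append_singleton _ _ |>.trans ((hr _).cons _))

theorem treeWord_length (T : BinaryTree Unit) : (treeWord T).length = T.numNodes := by
  rw [treeWord, (postfixWord_infixLabel_perm T 0).length_eq, List.length_range']

theorem treeWord_lt (T : BinaryTree Unit) (a : ℕ) (h : a ∈ treeWord T) : a < T.numNodes := by
  rw [treeWord, (postfixWord_infixLabel_perm T 0).mem_iff, List.mem_range'_1] at h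
  omega

theorem treeWord_nodup (T : BinaryTree Unit) : (treeWord T).Nodup :=
  (postfixWord_infixLabel_perm T 0).nodup_iff.2 List.nodup_range'

/-- The permutation `w_T`, with `i ↦` the `i`-th letter of the word `w_T`. -/
def treePerm (T : BinaryTree Unit) : Equiv.Perm (Fin T.numNodes) :=
  Equiv.ofBijective
    (fun i => ⟨(treeWord T)[i]'(by rw [treeWord_length]; exact i.2),
      treeWord_lt T _ (List.getElem_mem _)⟩)
    (Finite.injective_iff_bijective.1 fun i j h => by
      have := (treeWord_nodup T).getElem_inj_iff.1 (Fin.mk.inj h)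
      exact Fin.ext this)

/-- The image of `FQSym` under the canonical projection `π`. -/
def sylvImage : Subalgebra ℂ (Series Sylv) := FQSym.map sylvProj

theorem sylvProj_mem {f : Series Word} (hf : f ∈ FQSym) : sylvProj f ∈ sylvImage :=
  ⟨f, hf, rfl⟩

/-- The series `Q_T = π(G_{w_T})`. -/
def Q (T : BinaryTree Unit) : Series Sylv := sylvProj (G (treePerm T))

/-! ### Gradings and the graded dual -/

/-- The series supported on words of length `n`. -/
def degreePart (n : ℕ) : Submodule ℂ (Series Word) where
  carrier := {f | ∀ w : Word, w.length ≠ n → f w = 0}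
  add_mem' := fun {f g} hf hg w hw => by simp [hf w hw, hg w hw]
  zero_mem' := fun w _ => rfl
  smul_mem' := fun c f hf w hw => by simp [hf w hw]

/-- The component of degree `n` of `PBT`. -/
def PBTDeg (n : ℕ) : Submodule ℂ PBT := (degreePart n).comap PBT.val.toLinearMap

/-- The component of degree `n` of the image of `FQSym` under `π`. -/
def sylvImageDeg (n : ℕ) : Submodule ℂ sylvImage :=
  ((FQSym.toSubmodule ⊓ degreePart n).map sylvProj.toLinearMap).comap sylvImage.val.toLinearMap

/-- The component of degree `n` of the graded dual of `PBT`: the linear forms on `PBT` that vanish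
on the components of degree different from `n`. -/
def dualDeg (n : ℕ) : Submodule ℂ (WithConv (PBT →ₗ[ℂ] ℂ)) where
  carrier := {φ | ∀ m, m ≠ n → ∀ x ∈ PBTDeg m, φ x = 0}
  add_mem' := fun {φ ψ} hφ hψ m hm x hx => by
    change φ x + ψ x = 0
    rw [hφ m hm x hx, hψ m hm x hx, add_zero]
  zero_mem' := fun _ _ _ _ => rfl
  smul_mem' := fun c φ hφ m hm x hx => by
    change c * φ x = 0
    rw [hφ m hm x hx, mul_zero]

/-- The graded dual of `PBT`, the direct sum of the duals of its homogeneous components, as a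
space of linear forms. -/
def gradedDual : Submodule ℂ (WithConv (PBT →ₗ[ℂ] ℂ)) := ⨆ n, dualDeg n

/-- The inclusion of an algebra of linear forms in the full dual. -/
def toForm [Coalgebra ℂ PBT] (D : Subalgebra ℂ (WithConv (PBT →ₗ[ℂ] ℂ))) :
    D →ₗ[ℂ] Module.Dual ℂ PBT :=
  (WithConv.linearEquiv ℂ (PBT →ₗ[ℂ] ℂ)).toLinearMap ∘ₗ D.val.toLinearMap

/-- `D` is the graded dual Hopf algebra `PBT*`: its elements are the linear forms vanishing on
almost all the homogeneous components, its product is the convolution product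
`(φ ψ)(x) = ∑ φ(x₁) ψ(x₂)`, with unit `ε`, and its coproduct and counit are given by
`(Δ φ)(x ⊗ y) = φ(x y)` and `ε(φ) = φ(1)`. -/
structure IsGradedDualHopf [Coalgebra ℂ PBT] (D : Subalgebra ℂ (WithConv (PBT →ₗ[ℂ] ℂ)))
    [Coalgebra ℂ D] : Prop where
  isHopf : IsHopf D
  toSubmodule_eq : Subalgebra.toSubmodule D = gradedDual
  comul_apply : ∀ (φ : D) (x y : PBT),
    TensorProduct.dualDistrib ℂ PBT PBT
      (TensorProduct.map (toForm D) (toForm D) (CoalgebraStruct.comul (R := ℂ) φ))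
        (x ⊗ₜ[ℂ] y) = toForm D φ (x * y)
  counit_apply : ∀ φ : D, CoalgebraStruct.counit (R := ℂ) φ = toForm D φ 1

end Sylvester

end

open Sylvester

noncomputable section

namespace Sylvester

/-! The proof rests on the symmetric bilinear form `form` on `FQSym` for which the `G_σ` are dual to
the `F_σ`. Since `⟨F_σ, f⟩` is the coefficient of the word `σ` in `f`, the deconcatenation coproduct
is adjoint to the product (`tensorForm_comulF`), so coassociativity and counit laws are dual to
associativity and unit laws. The coproduct is multiplicative because it has a second description: it
splits each word into its letters below a threshold `N` and the others, and this splitting is a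
morphism of monoids (`tensorForm_evalWord_comulF`).

The combinatorial heart is `sylvProj_G_apply`: `π(G_σ)` is the sum of the sylvester classes whose
binary search tree is `𝒫(σ)`. Indeed the tree is invariant under the congruence
(`bst_eq_of_sylvCon`), a class contains at most one word of given standardization because its words
are rearrangements of each other, and each class with the right tree does contain one: every word is
congruent to the postfix reading of its tree (`sylvCon_canon`), and congruences lift along
standardization (`exists_lift_of_sylvCon`).

Hence the coefficient of a class `c` in `π(f)` is `⟨f, P_T⟩`, where `T` is the tree of `c`, and the
kernel of `π` on `FQSym` is the orthogonal of `PBT` (`sylvProj_eq_iff`). As this kernel is an ideal,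
`PBT` is a subcoalgebra; as `PBT` is a subalgebra, the kernel is a coideal. So `f ↦ ⟨f, ·⟩` and `π`
are two quotients of the bialgebra `FQSym` by the same kernel: the first is the graded dual of
`PBT`, the second is `π(FQSym)`. The classes of the `G_{w_T}` are dual to the `P_T` because `𝒫(w_T)
= T`. Antipodes exist since all these bialgebras are graded and connected. -/

/-! ### Linear algebra -/

section LinearAlgebra
variable {k V W : Type*} [Field k] [AddCommGroup V] [Module k V] [AddCommGroup W] [Module k W]

/-- The linear form `φ ⊗ ψ` on a tensor product. -/
def tensorForm (φ : V →ₗ[k] k) (ψ : W →ₗ[k] k) : V ⊗[k] W →ₗ[k] k :=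
  LinearMap.mul' k k ∘ₗ TensorProduct.map φ ψ

@[simp] theorem tensorForm_tmul (φ : V →ₗ[k] k) (ψ : W →ₗ[k] k) (v : V) (w : W) :
    tensorForm φ ψ (v ⊗ₜ w) = φ v * ψ w := rfl

theorem tensorForm_map {V' W' : Type*} [AddCommGroup V'] [Module k V'] [AddCommGroup W']
    [Module k W'] (φ : V →ₗ[k] k) (ψ : W →ₗ[k] k) (f : V' →ₗ[k] V) (g : W' →ₗ[k] W)
    (t : V' ⊗[k] W') :
    tensorForm φ ψ (TensorProduct.map f g t) = tensorForm (φ ∘ₗ f) (ψ ∘ₗ g) t := by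
  rw [tensorForm, tensorForm, TensorProduct.map_comp]; rfl

/-- A family of linear forms separates points. -/
def Separates {ι : Type*} (φ : ι → V →ₗ[k] k) : Prop := ∀ v, (∀ i, φ i v = 0) → v = 0

/-- Expand a tensor as `∑ v_j ⊗ b_j` along a basis of the right factor. Applying `φ i` on the left
gives `∑ φ i (v_j) b_j`, which all the `ψ` kill; so every `φ i (v_j)` vanishes, and then every
`v_j`. Identities between tensors are checked below by means of this. -/
theorem Separates.tensorForm {ι κ : Type*} {φ : ι → V →ₗ[k] k} {ψ : κ → W →ₗ[k] k}
    (hφ : Separates φ) (hψ : Separates ψ) :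
    Separates fun p : ι × κ => tensorForm (φ p.1) (ψ p.2) := by
  classical
  intro t ht
  let b := Module.Basis.ofVectorSpace k W
  let e := TensorProduct.equivFinsuppOfBasisRight (M := V) b
  have key : ∀ (i : ι) (t : V ⊗[k] W),
      (TensorProduct.lid k W) ((φ i).rTensor W t) = (e t).sum fun j v => φ i v • b j := by
    intro i t
    induction t with
    | zero => simp
    | add x y hx hy =>
      rw [map_add, map_add, map_add, hx, hy, Finsupp.sum_add_index'] <;> simp [add_smul]
    | tmul v w =>
      rw [TensorProduct.equivFinsuppOfBasisRight_apply_tmul]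
      simp only [LinearMap.rTensor_tmul, TensorProduct.lid_tmul]
      conv_lhs => rw [← b.linearCombination_repr w, Finsupp.linearCombination_apply]
      rw [Finsupp.sum_mapRange_index (by simp), Finsupp.smul_sum]
      simp [Finsupp.sum, smul_smul, mul_comm]
  have h0 : ∀ i, (TensorProduct.lid k W) ((φ i).rTensor W t) = 0 := fun i => by
    refine hψ _ fun j => ?_
    have h1 : ∀ t : V ⊗[k] W, ψ j ((TensorProduct.lid k W) ((φ i).rTensor W t)) =
        Sylvester.tensorForm (φ i) (ψ j) t := fun t => by
      induction t with
      | zero => simp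
      | add x y hx hy => simp only [map_add, hx, hy]
      | tmul v w => simp
    rw [h1, ht (i, j)]
  refine (map_eq_zero_iff e e.injective).1 (Finsupp.ext fun j => hφ _ fun i => ?_)
  have h2 := h0 i
  rw [key] at h2
  have h3 := congrArg (fun w => b.repr w j) h2
  by_cases hj : e t j = 0
  · simp [hj]
  · simpa [Finsupp.sum, Finsupp.single_apply, Finsupp.finsetSum_apply, hj] using h3

theorem Separates.eq {ι : Type*} {φ : ι → V →ₗ[k] k} (hφ : Separates φ) {v w : V}
    (h : ∀ i, φ i v = φ i w) : v = w :=
  sub_eq_zero.1 (hφ _ fun i => by rw [map_sub, h i, sub_self])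

theorem linearIndependent_of_forms {ι : Type*} [DecidableEq ι] (v : ι → V) (φ : ι → V →ₗ[k] k)
    (h : ∀ i j, φ i (v j) = if i = j then 1 else 0) : LinearIndependent k v := by
  rw [linearIndependent_iff]
  intro l hl
  ext i
  have := congrArg (φ i) hl
  rw [Finsupp.linearCombination_apply, Finsupp.sum, map_sum] at this
  simpa [h] using this

end LinearAlgebra

/-! ### Quotients and subobjects of coalgebras -/

section Coalgebra
variable {k H S : Type*} [Field k] [AddCommGroup H] [Module k H] [Coalgebra k H]
  [AddCommGroup S] [Module k S]

open TensorProduct CoalgebraStruct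

/-- The coalgebra structure on the image of a linear map whose kernel is a coideal. -/
abbrev coalgebraOfSurjective (q : H →ₗ[k] S) (hq : Function.Surjective q)
    (hΔ : ∀ x, q x = 0 → map q q (comul (R := k) x) = 0)
    (hε : ∀ x, q x = 0 → counit (R := k) x = 0) : Coalgebra k S :=
  -- A linear section `s` of `q` defines the structure; the choice is immaterial, because `s (q x) -
  -- x` lies in the kernel of `q`. The axioms are then verified after composition with the
  -- surjection `q`.
  let s := (LinearMap.exists_rightInverse_of_surjective q (LinearMap.range_eq_top.2 hq)).choose
  have hs : q ∘ₗ s = LinearMap.id :=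
    (LinearMap.exists_rightInverse_of_surjective q (LinearMap.range_eq_top.2 hq)).choose_spec
  let Δ : S →ₗ[k] S ⊗[k] S := map q q ∘ₗ comul ∘ₗ s
  let ε : S →ₗ[k] k := counit ∘ₗ s
  have hsq : ∀ x, q (s (q x) - x) = 0 := fun x => by
    rw [map_sub, sub_eq_zero]; exact LinearMap.congr_fun hs (q x)
  have hΔq : Δ ∘ₗ q = map q q ∘ₗ comul := by
    ext x
    have := hΔ _ (hsq x)
    rwa [map_sub, map_sub, sub_eq_zero] at this
  have hεq : ε ∘ₗ q = counit := by
    ext x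
    have := hε _ (hsq x)
    rwa [map_sub, sub_eq_zero] at this
  { comul := Δ
    counit := ε
    coassoc := by
      rw [← LinearMap.cancel_right hq]
      have h1 : (Δ.rTensor S ∘ₗ Δ) ∘ₗ q = map (map q q) q ∘ₗ (comul (R := k)).rTensor H ∘ₗ comul := by
        rw [LinearMap.comp_assoc, hΔq, ← LinearMap.comp_assoc, LinearMap.rTensor,
          ← map_comp, hΔq, LinearMap.rTensor, ← LinearMap.comp_assoc, ← map_comp]
        rfl
      have h2 : (Δ.lTensor S ∘ₗ Δ) ∘ₗ q = map q (map q q) ∘ₗ (comul (R := k)).lTensor H ∘ₗ comul := by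
        rw [LinearMap.comp_assoc, hΔq, ← LinearMap.comp_assoc, LinearMap.lTensor,
          ← map_comp, hΔq, LinearMap.lTensor, ← LinearMap.comp_assoc, ← map_comp]
        rfl
      rw [h2, ← Coalgebra.coassoc, LinearMap.comp_assoc, h1, ← LinearMap.comp_assoc,
        ← LinearMap.comp_assoc, ← LinearMap.comp_assoc, map_map_comp_assoc_eq]
      rfl
    rTensor_counit_comp_comul := by
      rw [← LinearMap.cancel_right hq]
      rw [LinearMap.comp_assoc, hΔq, ← LinearMap.comp_assoc, LinearMap.rTensor,
        ← map_comp, hεq]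
      have := congrArg (fun f => q.lTensor k ∘ₗ f) (Coalgebra.rTensor_counit_comp_comul (R := k) (A := H))
      simp only [← LinearMap.comp_assoc, LinearMap.lTensor_comp_rTensor] at this
      rw [LinearMap.id_comp, this]
      ext x; simp
    lTensor_counit_comp_comul := by
      rw [← LinearMap.cancel_right hq]
      rw [LinearMap.comp_assoc, hΔq, ← LinearMap.comp_assoc, LinearMap.lTensor,
        ← map_comp, hεq]
      have := congrArg (fun f => q.rTensor k ∘ₗ f) (Coalgebra.lTensor_counit_comp_comul (R := k) (A := H))
      simp only [← LinearMap.comp_assoc, LinearMap.rTensor_comp_lTensor] at this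
      rw [LinearMap.id_comp, this]
      ext x; simp }

theorem coalgebraOfSurjective_comul (q : H →ₗ[k] S) (hq : Function.Surjective q)
    (hΔ : ∀ x, q x = 0 → map q q (comul (R := k) x) = 0)
    (hε : ∀ x, q x = 0 → counit (R := k) x = 0) (x : H) :
    (coalgebraOfSurjective q hq hΔ hε).comul (q x) = map q q (comul (R := k) x) := by
  have hs := (LinearMap.exists_rightInverse_of_surjective q
    (LinearMap.range_eq_top.2 hq)).choose_spec
  have := hΔ _ ((map_sub q _ x).trans (sub_eq_zero.2 (LinearMap.congr_fun hs (q x))))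
  rwa [map_sub, map_sub, sub_eq_zero] at this

theorem coalgebraOfSurjective_counit (q : H →ₗ[k] S) (hq : Function.Surjective q)
    (hΔ : ∀ x, q x = 0 → map q q (comul (R := k) x) = 0)
    (hε : ∀ x, q x = 0 → counit (R := k) x = 0) (x : H) :
    (coalgebraOfSurjective q hq hΔ hε).counit (q x) = counit (R := k) x := by
  have hs := (LinearMap.exists_rightInverse_of_surjective q
    (LinearMap.range_eq_top.2 hq)).choose_spec
  have := hε _ ((map_sub q _ x).trans (sub_eq_zero.2 (LinearMap.congr_fun hs (q x))))
  rwa [map_sub, sub_eq_zero] at this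

section retract
variable (i : S →ₗ[k] H) (r : H →ₗ[k] S) (Δ : S →ₗ[k] S ⊗[k] S)

theorem map_rTensor_comul (hΔi : map i i ∘ₗ Δ = comul ∘ₗ i) :
    map (map i i) i ∘ₗ (Δ.rTensor S ∘ₗ Δ) = (comul (R := k)).rTensor H ∘ₗ comul ∘ₗ i := by
  rw [← hΔi, ← LinearMap.comp_assoc, ← LinearMap.comp_assoc, LinearMap.rTensor, ← map_comp,
    hΔi, LinearMap.rTensor, ← map_comp]
  rfl

theorem map_lTensor_comul (hΔi : map i i ∘ₗ Δ = comul ∘ₗ i) :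
    map i (map i i) ∘ₗ (Δ.lTensor S ∘ₗ Δ) = (comul (R := k)).lTensor H ∘ₗ comul ∘ₗ i := by
  rw [← hΔi, ← LinearMap.comp_assoc, ← LinearMap.comp_assoc, LinearMap.lTensor, ← map_comp,
    hΔi, LinearMap.lTensor, ← map_comp]
  rfl

/-- The coalgebra structure on a retract `S` of `H` which is a subcoalgebra. -/
abbrev coalgebraOfRetract (hr : ∀ x, r (i x) = x) (hΔi : map i i ∘ₗ Δ = comul ∘ₗ i) :
    Coalgebra k S where
  comul := Δ
  counit := counit ∘ₗ i
  coassoc := by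
    -- The retraction `r` need not respect coproducts: it serves only to show that the tensor powers
    -- of `i` are injective, so that coassociativity can be tested in `H`.
    have hinj : Function.Injective (map i (map i i)) := by
      refine Function.LeftInverse.injective (g := map r (map r r)) fun x => ?_
      rw [← LinearMap.comp_apply, ← map_comp, ← map_comp,
        show r ∘ₗ i = LinearMap.id from LinearMap.ext hr, map_id, map_id]; rfl
    rw [← LinearMap.cancel_left hinj, map_lTensor_comul i Δ hΔi, ← LinearMap.comp_assoc i,
      ← Coalgebra.coassoc, LinearMap.comp_assoc,
      LinearMap.comp_assoc, ← map_rTensor_comul i Δ hΔi, ← LinearMap.comp_assoc,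
      ← LinearMap.comp_assoc _ (map (map i i) i), map_map_comp_assoc_eq]
  rTensor_counit_comp_comul := by
    -- Inserting `r ∘ i = id` on the factor that survives reduces the counit law to that of `H`.
    have h1 : (counit ∘ₗ i).rTensor S = r.lTensor k ∘ₗ (counit (R := k)).rTensor H ∘ₗ map i i := by
      ext x y; simp [hr]
    rw [h1, LinearMap.comp_assoc, LinearMap.comp_assoc, hΔi,
      ← LinearMap.comp_assoc i, Coalgebra.rTensor_counit_comp_comul]
    ext x; simp [hr]
  lTensor_counit_comp_comul := by
    have h1 : (counit ∘ₗ i).lTensor S = r.rTensor k ∘ₗ (counit (R := k)).lTensor H ∘ₗ map i i := by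
      ext x y; simp [hr]
    rw [h1, LinearMap.comp_assoc, LinearMap.comp_assoc, hΔi,
      ← LinearMap.comp_assoc i, Coalgebra.lTensor_counit_comp_comul]
    ext x; simp [hr]

end retract

end Coalgebra

/-! ### Connected gradings and antipodes -/

section Antipode
open TensorProduct CoalgebraStruct

/-- The degree `n` part of the tensor square of a family of submodules. -/
def tensorDeg {k A : Type*} [CommSemiring k] [AddCommMonoid A] [Module k A]
    (V : ℕ → Submodule k A) (n : ℕ) : Submodule k (A ⊗[k] A) :=
  ⨆ p ∈ Finset.HasAntidiagonal.antidiagonal n, LinearMap.range (mapIncl (V p.1) (V p.2))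

theorem tensorDeg_le {k A : Type*} [CommSemiring k] [AddCommMonoid A] [Module k A]
    {V : ℕ → Submodule k A} {n : ℕ} {W : Submodule k (A ⊗[k] A)}
    (h : ∀ i j, i + j = n → ∀ a ∈ V i, ∀ b ∈ V j, a ⊗ₜ[k] b ∈ W) : tensorDeg V n ≤ W := by
  refine iSup₂_le fun p hp => ?_
  rintro _ ⟨t, rfl⟩
  induction t with
  | zero => simp
  | add x y hx hy => rw [map_add]; exact add_mem hx hy
  | tmul a b => exact h _ _ (Finset.HasAntidiagonal.mem_antidiagonal.1 hp) _ a.2 _ b.2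

theorem tmul_mem_tensorDeg {k A : Type*} [CommSemiring k] [AddCommMonoid A] [Module k A]
    {V : ℕ → Submodule k A} {n i j : ℕ} (hn : i + j = n) {a b : A} (ha : a ∈ V i) (hb : b ∈ V j) :
    a ⊗ₜ[k] b ∈ tensorDeg V n :=
  Submodule.mem_iSup_of_mem (i, j) (Submodule.mem_iSup_of_mem (Finset.HasAntidiagonal.mem_antidiagonal.2 hn)
    ⟨(⟨a, ha⟩ : V i) ⊗ₜ (⟨b, hb⟩ : V j), rfl⟩)

/-- The submodules `V n` exhaust `A`, the coproduct is compatible with them, and `V 0` consists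
of scalars. -/
structure IsConnectedGrading {k A : Type*} [CommSemiring k] [Semiring A] [Algebra k A]
    [CoalgebraStruct k A] (V : ℕ → Submodule k A) : Prop where
  iSup_eq_top : ⨆ n, V n = ⊤
  zero_le : V 0 ≤ Submodule.span k {1}
  comul_mem : ∀ n, ∀ a ∈ V n, comul (R := k) a ∈ tensorDeg V n

variable {k A : Type*} [Field k] [Ring A] [Algebra k A] [Coalgebra k A]

/-- An antipode is a convolution inverse of the identity `E = 1 - J`. Since `J` vanishes on `V 0`,
its power `J ^ m` vanishes on `V n` for `n < m`, so that the geometric series `∑ J ^ m` is locally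
finite and inverts `E`. The sum of the `V n` need not be direct. -/
theorem IsConnectedGrading.exists_antipode {V : ℕ → Submodule k A} (hV : IsConnectedGrading V)
    (h1 : counit (R := k) (1 : A) = 1) : ∃ S : A →ₗ[k] A,
    LinearMap.mul' k A ∘ₗ S.rTensor A ∘ₗ comul = Algebra.linearMap k A ∘ₗ counit ∧
    LinearMap.mul' k A ∘ₗ S.lTensor A ∘ₗ comul = Algebra.linearMap k A ∘ₗ counit := by
  let E : WithConv (A →ₗ[k] A) := WithConv.toConv LinearMap.id
  let J : WithConv (A →ₗ[k] A) := 1 - E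
  have hJ1 : ∀ a ∈ V 0, J a = 0 := by
    intro a ha
    obtain ⟨c, rfl⟩ := Submodule.mem_span_singleton.1 (hV.zero_le ha)
    change algebraMap k A (counit (R := k) (c • (1 : A))) - c • 1 = 0
    rw [map_smul, h1, smul_eq_mul, mul_one, Algebra.algebraMap_eq_smul_one, sub_self]
  have hJ : ∀ m n, n < m → ∀ a ∈ V n, (J ^ m) a = 0 := by
    intro m
    induction m with
    | zero => intro n hn; omega
    | succ m ih =>
      intro n hn a ha
      rw [pow_succ', LinearMap.convMul_apply]
      have hle : tensorDeg V n ≤ LinearMap.ker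
          (LinearMap.mul' k A ∘ₗ TensorProduct.map J.ofConv (J ^ m).ofConv) := by
        refine tensorDeg_le fun i j hij a ha b hb => ?_
        change J a * (J ^ m) b = 0
        -- Either the left factor has degree `0` and is killed by `J`, or the right one has degree
        -- `j < n ≤ m` and is killed by `J ^ m`.
        rcases Nat.eq_zero_or_pos i with rfl | hi
        · rw [hJ1 a ha, zero_mul]
        · rw [ih j (by omega) b hb, mul_zero]
      exact hle (hV.comul_mem n a ha)
  have hfin : ∀ a : A, (Function.support fun m => (J ^ m) a).Finite := by
    intro a
    have ha : a ∈ ⨆ n, V n := hV.iSup_eq_top ▸ Submodule.mem_top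
    induction ha using Submodule.iSup_induction' with
    | mem n a ha =>
      refine (Set.finite_Iic n).subset fun m hm => ?_
      by_contra h
      exact hm (hJ m n (not_le.1 h) a ha)
    | zero => simp
    | add x y _ _ hx hy =>
      refine (hx.union hy).subset fun m hm => ?_
      by_contra h
      simp only [Set.mem_union, Function.mem_support, not_or, not_not] at h
      refine hm ?_
      change (J ^ m) (x + y) = 0
      rw [map_add, h.1, h.2, add_zero]
  let S : A →ₗ[k] A :=
    { toFun := fun a => ∑ᶠ m, (J ^ m) a
      map_add' := fun a b => by
        simp only [map_add]; exact finsum_add_distrib (hfin a) (hfin b)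
      map_smul' := fun c a => by
        simp only [map_smul, RingHom.id_apply]; exact (smul_finsum' c (hfin a)).symm }
  -- The truncation at `n + 1` computes `S` on all tensor factors of an element of degree `n` at
  -- once, which leaves a finite telescoping sum.
  have hS : ∀ n N, n < N → ∀ a ∈ V n, S a = (∑ m ∈ Finset.range N, J ^ m) a := by
    intro n N hN a ha
    change ∑ᶠ m, (J ^ m) a = _
    rw [finsum_eq_sum_of_support_subset (s := Finset.range N)]
    · change _ = ((WithConv.linearEquiv k (A →ₗ[k] A)) (∑ m ∈ Finset.range N, J ^ m)) a
      rw [map_sum, LinearMap.sum_apply]; rfl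
    · intro m hm
      simp only [Finset.coe_range, Set.mem_Iio]
      by_contra h
      exact hm (hJ m n (by omega) a ha)
  have hE : E = 1 - J := (sub_sub_cancel _ _).symm
  refine ⟨S, ?_, ?_⟩
  · refine LinearMap.ext fun a => ?_
    have ha : a ∈ ⨆ n, V n := hV.iSup_eq_top ▸ Submodule.mem_top
    induction ha using Submodule.iSup_induction' with
    | zero => simp
    | add x y _ _ hx hy => rw [map_add, map_add, hx, hy]
    | mem n a ha =>
      have hle : tensorDeg V n ≤ LinearMap.eqLocus (S.rTensor A)
          (TensorProduct.map (∑ m ∈ Finset.range (n + 1), J ^ m).ofConv E.ofConv) := by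
        refine tensorDeg_le fun i j hij a ha b hb => ?_
        change S a ⊗ₜ b = _
        rw [hS i (n + 1) (by omega) a ha]; rfl
      have h2 := hle (hV.comul_mem n a ha)
      change LinearMap.mul' k A (S.rTensor A (comul a)) = (1 : WithConv (A →ₗ[k] A)) a
      rw [show S.rTensor A (comul a) = _ from h2]
      change ((∑ m ∈ Finset.range (n + 1), J ^ m) * E) a = _
      rw [hE, geom_sum_mul_neg]
      change (1 : WithConv (A →ₗ[k] A)) a - (J ^ (n + 1)) a = _
      rw [hJ (n + 1) n (by omega) a ha, sub_zero]
  · refine LinearMap.ext fun a => ?_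
    have ha : a ∈ ⨆ n, V n := hV.iSup_eq_top ▸ Submodule.mem_top
    induction ha using Submodule.iSup_induction' with
    | zero => simp
    | add x y _ _ hx hy => rw [map_add, map_add, hx, hy]
    | mem n a ha =>
      have hle : tensorDeg V n ≤ LinearMap.eqLocus (S.lTensor A)
          (TensorProduct.map E.ofConv (∑ m ∈ Finset.range (n + 1), J ^ m).ofConv) := by
        refine tensorDeg_le fun i j hij a ha b hb => ?_
        change a ⊗ₜ S b = _
        rw [hS j (n + 1) (by omega) b hb]; rfl
      have h2 := hle (hV.comul_mem n a ha)
      change LinearMap.mul' k A (S.lTensor A (comul a)) = (1 : WithConv (A →ₗ[k] A)) a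
      rw [show S.lTensor A (comul a) = _ from h2]
      change (E * (∑ m ∈ Finset.range (n + 1), J ^ m)) a = _
      rw [hE, mul_neg_geom_sum]
      change (1 : WithConv (A →ₗ[k] A)) a - (J ^ (n + 1)) a = _
      rw [hJ (n + 1) n (by omega) a ha, sub_zero]

end Antipode

/-! ### Transfer of Hopf algebra structures -/

section transfer
open TensorProduct CoalgebraStruct

theorem map_algHom_mul {k A B : Type*} [Field k] [Ring A] [Algebra k A] [Ring B] [Algebra k B]
    (q : A →ₐ[k] B) (s t : A ⊗[k] A) : map q.toLinearMap q.toLinearMap (s * t) =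
      map q.toLinearMap q.toLinearMap s * map q.toLinearMap q.toLinearMap t :=
  map_mul (Algebra.TensorProduct.map q q) s t

variable {A B : Type*} [Ring A] [Algebra ℂ A] [Coalgebra ℂ A] [Ring B] [Algebra ℂ B]
  [Coalgebra ℂ B] 

theorem IsConnectedGrading.map {V : ℕ → Submodule ℂ A} (hV : IsConnectedGrading V)
    (q : A →ₐ[ℂ] B) (hq : Function.Surjective q)
    (hΔ : ∀ a, comul (R := ℂ) (q a) = TensorProduct.map q.toLinearMap q.toLinearMap
      (comul (R := ℂ) a)) :
    IsConnectedGrading fun n => (V n).map q.toLinearMap where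
  iSup_eq_top := by
    rw [← Submodule.map_iSup, hV.iSup_eq_top, Submodule.map_top, LinearMap.range_eq_top]
    exact hq
  zero_le := by
    rintro _ ⟨a, ha, rfl⟩
    obtain ⟨c, rfl⟩ := Submodule.mem_span_singleton.1 (hV.zero_le ha)
    refine Submodule.mem_span_singleton.2 ⟨c, ?_⟩
    rw [map_smul, AlgHom.toLinearMap_apply, map_one]
  comul_mem := by
    rintro n _ ⟨a, ha, rfl⟩
    change comul (R := ℂ) (q a) ∈ _
    rw [hΔ]
    have hle : tensorDeg V n ≤ (tensorDeg (fun n => (V n).map q.toLinearMap) n).comap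
        (TensorProduct.map q.toLinearMap q.toLinearMap) := by
      refine tensorDeg_le fun i j hij a ha b hb => ?_
      rw [Submodule.mem_comap, TensorProduct.map_tmul]
      exact tmul_mem_tensorDeg hij (Submodule.mem_map_of_mem ha) (Submodule.mem_map_of_mem hb)
    exact hle (hV.comul_mem n a ha)

/-- The antipode is not transported along `q`, which would require it to preserve the kernel: it is
rebuilt from the image of the grading. -/
theorem IsHopf.of_surjective (hA : IsHopf A) {V : ℕ → Submodule ℂ A} (hV : IsConnectedGrading V)
    (q : A →ₐ[ℂ] B) (hq : Function.Surjective q)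
    (hε : ∀ a, counit (R := ℂ) (q a) = counit (R := ℂ) a)
    (hΔ : ∀ a, comul (R := ℂ) (q a) = TensorProduct.map q.toLinearMap q.toLinearMap
      (comul (R := ℂ) a)) : IsHopf B := by
  have h1 : counit (R := ℂ) (1 : B) = 1 := by rw [← map_one q, hε, hA.counit_one]
  refine ⟨h1, ?_, ?_, ?_, (hV.map q hq hΔ).exists_antipode h1⟩
  · intro a b
    obtain ⟨a, rfl⟩ := hq a
    obtain ⟨b, rfl⟩ := hq b
    rw [← map_mul, hε, hε, hε, hA.counit_mul]
  · rw [← map_one q, hΔ, hA.comul_one]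
    exact map_one (Algebra.TensorProduct.map q q)
  · intro a b
    obtain ⟨a, rfl⟩ := hq a
    obtain ⟨b, rfl⟩ := hq b
    rw [← map_mul, hΔ, hΔ, hΔ, hA.comul_mul, map_algHom_mul]

/-- Multiplicativity of the coproduct of `B` is tested in `A ⊗ A`. The antipode again comes from the
grading, with no need to know that the one of `A` stabilizes `B`. -/
theorem IsHopf.of_injective (hA : IsHopf A) {V : ℕ → Submodule ℂ B} (hV : IsConnectedGrading V)
    (q : B →ₐ[ℂ] A) (hq : Function.Injective (TensorProduct.map q.toLinearMap q.toLinearMap))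
    (hε : ∀ a, counit (R := ℂ) (q a) = counit (R := ℂ) a)
    (hΔ : ∀ a, comul (R := ℂ) (q a) = TensorProduct.map q.toLinearMap q.toLinearMap
      (comul (R := ℂ) a)) : IsHopf B := by
  have h1 : counit (R := ℂ) (1 : B) = 1 := by rw [← hε, map_one q, hA.counit_one]
  refine ⟨h1, ?_, ?_, ?_, hV.exists_antipode h1⟩
  · intro a b
    rw [← hε, ← hε, ← hε, map_mul, hA.counit_mul]
  · apply hq
    rw [← hΔ, map_one, hA.comul_one]
    exact (map_one (Algebra.TensorProduct.map q q)).symm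
  · intro a b
    apply hq
    rw [← hΔ, map_mul, hA.comul_mul, map_algHom_mul, hΔ, hΔ]

end transfer

/-! ### Words with the same standardization -/

/-- Two words have the same standardization. -/
def SameStd (l l' : List ℕ) : Prop :=
  ∃ L : List (ℕ × ℕ), L.map Prod.fst = l ∧ L.map Prod.snd = l' ∧
    L.Pairwise fun a b => a.1 ≤ b.1 ↔ a.2 ≤ b.2

theorem sameStd_ofFn {n : ℕ} (v w : Fin n → ℕ) :
    SameStd (List.ofFn v) (List.ofFn w) ↔ std v = std w := by
  rw [std_eq_iff]
  constructor
  · rintro ⟨L, h1, h2, h⟩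
    have hL : L = List.ofFn fun i => (v i, w i) := by
      rw [List.zip_of_prod h1 h2]
      exact List.ext_getElem (by simp) (by simp)
    rw [hL, List.pairwise_ofFn] at h
    exact h
  · intro h
    exact ⟨List.ofFn fun i => (v i, w i), by simp [List.map_ofFn, Function.comp_def],
      by simp [List.map_ofFn, Function.comp_def], List.pairwise_ofFn.2 h⟩

/-- The standardization of a word, with its length. -/
def stdSigma (l : List ℕ) : Σ n, Equiv.Perm (Fin n) := ⟨l.length, std l.get⟩

theorem stdSigma_ofFn {n : ℕ} (v : Fin n → ℕ) : stdSigma (List.ofFn v) = ⟨n, std v⟩ := by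
  have key : ∀ (l : List ℕ) (n : ℕ) (h : l.length = n) (v : Fin n → ℕ),
      (∀ i, v i = l.get (i.cast h.symm)) → stdSigma l = ⟨n, std v⟩ := by
    rintro l _ rfl v hv
    rw [show v = l.get from funext hv, stdSigma]
  exact key _ n (by simp) v fun i => by simp

theorem exists_eq_ofFn (l : List ℕ) {n : ℕ} (h : l.length = n) :
    ∃ v : Fin n → ℕ, l = List.ofFn v := by
  subst h
  exact ⟨_, (List.ofFn_get l).symm⟩

/-- Lists of pairs let two words be cut, filtered and permuted simultaneously; `stdSigma` makes
permutations of different sizes comparable without casts. -/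
theorem sameStd_iff {l l' : List ℕ} : SameStd l l' ↔ stdSigma l = stdSigma l' := by
  have key : l'.length = l.length → (SameStd l l' ↔ stdSigma l = stdSigma l') := fun hl => by
    obtain ⟨v, hv⟩ := exists_eq_ofFn l rfl
    obtain ⟨w, hw⟩ := exists_eq_ofFn l' hl
    generalize l.length = n at *
    subst hv hw
    rw [sameStd_ofFn, stdSigma_ofFn, stdSigma_ofFn, Sigma.mk.injEq, heq_eq_eq]
    exact (and_iff_right rfl).symm
  refine ⟨fun h => (key ?_).1 h, fun h => (key ?_).2 h⟩
  · obtain ⟨L, rfl, rfl, _⟩ := h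
    simp
  · exact (congrArg Sigma.fst h).symm

theorem SameStd.append {a a' b b' : List ℕ} (ha : SameStd a a') (hb : SameStd b b')
    (h : ∀ x ∈ a, ∀ y ∈ b, ∀ x' ∈ a', ∀ y' ∈ b', (x ≤ y ↔ x' ≤ y')) :
    SameStd (a ++ b) (a' ++ b') := by
  obtain ⟨L, rfl, rfl, hL⟩ := ha
  obtain ⟨M, rfl, rfl, hM⟩ := hb
  refine ⟨L ++ M, by simp, by simp, List.pairwise_append.2 ⟨hL, hM, fun x hx y hy => ?_⟩⟩
  exact h _ (List.mem_map_of_mem hx) _ (List.mem_map_of_mem hy) _ (List.mem_map_of_mem hx) _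
    (List.mem_map_of_mem hy)

/-- The two words have the same sorting permutation, and become the same word once sorted. This
gives the uniqueness of a word of given standardization in a sylvester class, and in a fibre of
`splitHom`. -/
theorem SameStd.eq_of_perm {l l' : List ℕ} (h : SameStd l l') (hp : l.Perm l') : l = l' := by
  obtain ⟨v, hv⟩ := exists_eq_ofFn l rfl
  obtain ⟨w, hw⟩ := exists_eq_ofFn l' hp.length_eq.symm
  generalize l.length = n at *
  subst hv hw
  rw [sameStd_ofFn, std, std, inv_inj] at h
  have hs : ∀ v : Fin n → ℕ, (List.ofFn (v ∘ Tuple.sort v)).Pairwise (· ≤ ·) := fun v =>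
    List.pairwise_ofFn.2 fun i j hij => Tuple.monotone_sort v hij.le
  have := List.Perm.eq_of_pairwise' (hs v) (hs w)
    (((Tuple.sort v).ofFn_comp_perm v).trans (hp.trans ((Tuple.sort w).ofFn_comp_perm w).symm))
  have := List.ofFn_injective this
  rw [← h] at this
  exact congrArg _ ((Tuple.sort v).surjective.injective_comp_right this)

/-- The word of a permutation, on the letters `0, …, n - 1`. -/
def permWord {n : ℕ} (σ : Equiv.Perm (Fin n)) : List ℕ := List.ofFn fun i => (σ i : ℕ)

theorem std_val {n : ℕ} (σ : Equiv.Perm (Fin n)) : std (fun i => (σ i : ℕ)) = σ := by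
  have : std (fun i => (σ i : ℕ)) = std ⇑σ := (std_eq_iff _ _).2 fun i j _ => Iff.rfl
  rw [this, std, Tuple.sort_perm, inv_inv]

theorem stdSigma_permWord {n : ℕ} (σ : Equiv.Perm (Fin n)) : stdSigma (permWord σ) = ⟨n, σ⟩ := by
  rw [permWord, stdSigma_ofFn, std_val]

open scoped Classical in
theorem F_apply {n : ℕ} (σ : Equiv.Perm (Fin n)) (w : Word) :
    F σ w = if stdSigma w.toList = ⟨n, σ⁻¹⟩ then 1 else 0 := by
  rw [F, Series.ofSet_apply]
  refine if_congr ?_ rfl rfl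
  constructor
  · rintro ⟨v, hv, rfl⟩
    change stdSigma (List.ofFn v) = _
    rw [stdSigma_ofFn, hv]
  · intro h
    obtain ⟨v, hv⟩ := exists_eq_ofFn w.toList (congrArg Sigma.fst h)
    rw [hv, stdSigma_ofFn, Sigma.mk.injEq, heq_eq_eq] at h
    exact ⟨v, h.2, FreeMonoid.toList.injective hv⟩

/-! ### The binary search tree of a word -/

/-- The binary search tree of the mirror image of a word. -/
def revBst : List ℕ → BinaryTree Unit
  | [] => .nil
  | x :: l => .node () (revBst (l.filter (· ≤ x))) (revBst (l.filter (x < ·)))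
termination_by l => l.length
decreasing_by
  all_goals
    simp only [List.length_unattach, List.length_cons]
    exact Nat.lt_succ_of_le ((List.length_filter_le _ _).trans_eq List.length_attach)

/-- The shape of the binary search tree of a word, whose letters are inserted from right to
left. -/
def bst (l : List ℕ) : BinaryTree Unit := revBst l.reverse

theorem bst_nil : bst [] = .nil := by simp [bst, revBst]

theorem bst_append_singleton (l : List ℕ) (x : ℕ) :
    bst (l ++ [x]) = .node () (bst (l.filter (· ≤ x))) (bst (l.filter (x < ·))) := by
  simp [bst, revBst, List.filter_reverse]

theorem bst_induction {motive : List ℕ → Prop} (nil : motive [])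
    (append : ∀ l x, motive (l.filter (· ≤ x)) → motive (l.filter (x < ·)) → motive (l ++ [x]))
    (l : List ℕ) : motive l := by
  induction hn : l.length using Nat.strong_induction_on generalizing l with
  | _ n ih =>
    rcases List.eq_nil_or_concat' l with rfl | ⟨l, x, rfl⟩
    · exact nil
    · have h := fun p => List.length_filter_le p l
      rw [List.length_append, List.length_singleton] at hn
      exact append l x (ih _ (by have := h (· ≤ x); omega) _ rfl)
        (ih _ (by have := h (x < ·); omega) _ rfl)

theorem numNodes_bst (l : List ℕ) : (bst l).numNodes = l.length := by
  induction l using bst_induction with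
  | nil => rw [bst_nil]; rfl
  | append l x h1 h2 =>
    rw [bst_append_singleton, BinaryTree.numNodes, h1, h2, List.length_append,
      List.length_singleton, ← List.length_append]
    have := (List.filter_append_perm (· ≤ x) l).length_eq
    simp only [← not_le, decide_not]
    rw [this]

/-- The decreasing tree of the positions of the letters of a word, listed in the order of the
letters, has the shape of the binary search tree of the word. -/
theorem shape_decTree_positions (Lp Ll : List (ℕ × ℕ)) (hp : Ll.Perm Lp)
    (h1 : Lp.Pairwise fun a b => a.2 < b.2)
    (h2 : Ll.Pairwise fun a b => a.1 < b.1 ∨ a.1 = b.1 ∧ a.2 < b.2) :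
    shape (decTree (Ll.map Prod.snd)) = bst (Lp.map Prod.fst) := by
  induction hn : Lp.length using Nat.strong_induction_on generalizing Lp Ll with
  | _ n ih =>
    rcases List.eq_nil_or_concat' Lp with rfl | ⟨Lp, ⟨x, p⟩, rfl⟩
    · rw [List.perm_nil.1 hp]
      simp [decTree_nil, bst_nil, shape, BinaryTree.map]
    -- The last letter `x` has the greatest position, hence is the root of the decreasing tree. It
    -- cuts the sorted list into `A`, with letters `≤ x`, and `B`, with letters `> x`: a letter
    -- equal to `x` in `B` would stand to the right of the last position. These are the two sides of
    -- the root of the binary search tree.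
    · obtain ⟨A, B, rfl⟩ := List.append_of_mem (hp.mem_iff.2 (by simp) : (x, p) ∈ Ll)
      have hp' : (A ++ B).Perm Lp :=
        (List.perm_cons _).1 (List.perm_middle.symm.trans (hp.trans (List.perm_append_singleton _ _)))
      rw [List.pairwise_append] at h1 h2
      obtain ⟨h2A, h2B, h2AB⟩ := h2
      rw [List.pairwise_cons] at h2B
      have hlt : ∀ a ∈ A ++ B, a.2 < p := fun a ha => h1.2.2 a (hp'.mem_iff.1 ha) (x, p) (by simp)
      have hA : ∀ a ∈ A, a.1 ≤ x := fun a ha => by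
        rcases h2AB a ha (x, p) (by simp) with h | h
        · exact h.le
        · exact h.1.le
      have hB : ∀ b ∈ B, x < b.1 := fun b hb => by
        rcases h2B.1 b hb with h | h
        · exact h
        · exact absurd h.2 (hlt b (by simp [hb])).not_gt
      have hAp : A.Perm (Lp.filter (·.1 ≤ x)) := by
        have := hp'.filter (·.1 ≤ x)
        rwa [List.filter_append, List.filter_eq_self.2 (by simpa using fun a b h => hA (a, b) h),
          List.filter_eq_nil_iff.2 (by simpa using fun a b h => hB (a, b) h),
          List.append_nil] at this
      have hBp : B.Perm (Lp.filter (x < ·.1)) := by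
        have := hp'.filter (x < ·.1)
        rwa [List.filter_append, List.filter_eq_nil_iff.2 (by simpa using fun a b h => hA (a, b) h),
          List.filter_eq_self.2 (by simpa using fun a b h => hB (a, b) h),
          List.nil_append] at this
      simp only [List.length_append, List.length_singleton] at hn
      rw [List.map_append, List.map_cons, decTree_append, List.map_append, List.map_singleton,
        bst_append_singleton, List.filter_map, List.filter_map]
      · simp only [shape, BinaryTree.map]
        congr 1
        · exact ih _ (by have := List.length_filter_le ((· ≤ x) ∘ Prod.fst) Lp; simp only [Function.comp_def] at *; omega) _ A hAp
            (h1.1.sublist List.filter_sublist) h2A rfl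
        · exact ih _ (by have := List.length_filter_le ((x < ·) ∘ Prod.fst) Lp; simp only [Function.comp_def] at *; omega) _ B hBp
            (h1.1.sublist List.filter_sublist) h2B.2 rfl
      · intro h
        obtain ⟨a, ha, e⟩ := List.mem_map.1 h
        exact (hlt a (by simp [ha])).ne e
      · intro y hy
        obtain ⟨a, ha, rfl⟩ := List.mem_map.1 hy
        exact (hlt a (by simp [ha])).le
      · intro y hy
        obtain ⟨a, ha, rfl⟩ := List.mem_map.1 hy
        exact (hlt a (by simp [ha])).le

/-- The inverse of `std v` is the sorting permutation, whose word lists the positions of `v` in the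
order of their letters, with ties broken from left to right. -/
theorem permTree_std {n : ℕ} (v : Fin n → ℕ) : permTree (std v) = bst (List.ofFn v) := by
  have hsort := Tuple.eq_sort_iff.1 (rfl : Tuple.sort v = Tuple.sort v)
  have h := shape_decTree_positions (List.ofFn fun i => (v i, (i : ℕ)))
    (List.ofFn ((fun i => (v i, (i : ℕ))) ∘ Tuple.sort v)) (Equiv.Perm.ofFn_comp_perm _ _)
    (List.pairwise_ofFn.2 fun i j hij => hij)
    (List.pairwise_ofFn.2 fun i j hij => by
      rcases (hsort.1 hij.le).lt_or_eq with h | h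
      · exact Or.inl h
      · exact Or.inr ⟨h, hsort.2 i j hij h⟩)
  rw [List.map_ofFn, List.map_ofFn] at h
  rw [permTree_eq, std, inv_inv]
  refine Eq.trans ?_ h
  have : List.ofFn (Prod.snd ∘ (fun i => (v i, (i : ℕ))) ∘ Tuple.sort v) =
      (List.ofFn (Tuple.sort v)).map Fin.val := by
    rw [List.map_ofFn]; rfl
  rw [this, decTree_map Fin.val_strictMono, shape_map]

theorem bst_of_stdSigma {l : List ℕ} {n : ℕ} {σ : Equiv.Perm (Fin n)}
    (h : stdSigma l = ⟨n, σ⟩) : bst l = permTree σ := by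
  obtain ⟨v, rfl⟩ := exists_eq_ofFn l (congrArg Sigma.fst h)
  rw [stdSigma_ofFn, Sigma.mk.injEq, heq_eq_eq] at h
  rw [← h.2, permTree_std]

/-! ### The sylvester congruence -/

/-- The relations "`R` in all contexts `p _ t`" form a congruence even when `R` is a mere
equivalence relation, so it suffices to treat one rewriting step inside a word. -/
theorem sylvCon_induction {R : Word → Word → Prop} (hR : Equivalence R)
    (h : ∀ (p t u : Word) (x y z : ℕ), x ≤ y → y < z →
      R (p * (.of z * .of x * u * .of y) * t) (p * (.of x * .of z * u * .of y) * t))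
    {a b : Word} (hab : sylvCon a b) : R a b := by
  let c : Con Word :=
    { r := fun a b => ∀ p t, R (p * a * t) (p * b * t)
      iseqv := ⟨fun a p t => hR.refl _, fun h p t => hR.symm (h p t),
        fun h h' p t => hR.trans (h p t) (h' p t)⟩
      mul' := fun {w x y z} h h' p t => by
        have h1 := h p (y * t)
        have h2 := h' (p * x) t
        simp only [mul_assoc] at h1 h2 ⊢
        exact hR.trans h1 h2 }
  have hc : sylvCon ≤ c := Con.conGen_le.2 (by
    rintro _ _ ⟨x, y, z, u, hxy, hyz⟩ p t
    exact h p t u x y z hxy hyz)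
  simpa using hc hab 1 1

/-- Compare with the root, the last letter. If it is `y`, then `x ≤ y < z` go to opposite sides and
their order is irrelevant. If it is a letter `r` of `t`, a side that contains both `x` and `z` also
contains `y`, which lies between them, and the induction applies there; a side that misses one of
them sees no difference. -/
theorem bst_step (p u t : List ℕ) (x y z : ℕ) (hxy : x ≤ y) (hyz : y < z) :
    bst (p ++ z :: x :: (u ++ y :: t)) = bst (p ++ x :: z :: (u ++ y :: t)) := by
  induction hn : p.length + u.length + t.length using Nat.strong_induction_on
    generalizing p u t with
  | _ n ih =>
    rcases List.eq_nil_or_concat' t with rfl | ⟨t, r, rfl⟩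
    · have h := fun w : List ℕ => bst_append_singleton (p ++ w) y
      have h1 := h (z :: x :: u)
      have h2 := h (x :: z :: u)
      simp only [List.append_assoc, List.cons_append] at h1 h2
      rw [h1, h2]
      simp [hxy, hyz, hxy.not_gt, hyz.not_ge]
    · have h := fun w : List ℕ => bst_append_singleton (p ++ w) r
      have h1 := h (z :: x :: (u ++ y :: t))
      have h2 := h (x :: z :: (u ++ y :: t))
      simp only [List.append_assoc, List.cons_append] at h1 h2
      rw [h1, h2]
      have hl := fun q : ℕ → Bool => And.intro (List.length_filter_le q p)
        (And.intro (List.length_filter_le q u) (List.length_filter_le q t))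
      simp only [List.length_append, List.length_singleton] at hn
      congr 1
      · have hl := hl (· ≤ r)
        by_cases hz : z ≤ r
        · have := ih _ (by omega) (p.filter (· ≤ r)) (u.filter (· ≤ r)) (t.filter (· ≤ r)) rfl
          simpa [List.filter_cons, hz, hyz.le.trans hz, (hxy.trans hyz.le).trans hz] using this
        · simp [List.filter_cons, hz]
      · have hl := hl (r < ·)
        by_cases hx : r < x
        · have := ih _ (by omega) (p.filter (r < ·)) (u.filter (r < ·)) (t.filter (r < ·)) rfl
          simpa [List.filter_cons, hx, hx.trans_le hxy, (hx.trans_le hxy).trans hyz] using this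
        · simp [List.filter_cons, hx]

theorem bst_eq_of_sylvCon {a b : Word} (h : sylvCon a b) : bst a.toList = bst b.toList := by
  refine sylvCon_induction (R := fun a b => bst a.toList = bst b.toList)
    ⟨fun _ => rfl, Eq.symm, Eq.trans⟩ (fun p t u x y z hxy hyz => ?_) h
  simpa [FreeMonoid.toList_mul] using bst_step p.toList u.toList t.toList x y z hxy hyz

theorem pairwise_swap {α : Type*} {r : α → α → Prop} {p t : List α} {a b : α}
    (h : (p ++ a :: b :: t).Pairwise r) (hr : r b a) : (p ++ b :: a :: t).Pairwise r := by
  simp only [List.pairwise_append, List.pairwise_cons, List.mem_cons, forall_eq_or_imp] at h ⊢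
  obtain ⟨h1, ⟨⟨-, h2⟩, h3, h4⟩, h5⟩ := h
  exact ⟨h1, ⟨⟨hr, h3⟩, h2, h4⟩, fun c hc => ⟨(h5 c hc).2.1, (h5 c hc).1, (h5 c hc).2.2⟩⟩

/-- Every word sylvester congruent to `s` lifts, along standardization, to a word congruent to
a given word with the standardization of `s`. -/
theorem exists_lift_of_sylvCon {a b : Word} (h : sylvCon a b) (w : Word)
    (hw : SameStd w.toList a.toList) : ∃ w', sylvCon w w' ∧ SameStd w'.toList b.toList := by
  let Lift : Word → Word → Prop := fun a b => ∀ w : Word, SameStd w.toList a.toList →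
    ∃ w', sylvCon w w' ∧ SameStd w'.toList b.toList
  have hrefl : ∀ a, Lift a a := fun a w hw => ⟨w, sylvCon.refl w, hw⟩
  have htrans : ∀ {a b c}, Lift a b → Lift b c → Lift a c := fun h h' w hw => by
    obtain ⟨w', h1, h2⟩ := h w hw
    obtain ⟨w'', h3, h4⟩ := h' w' h2
    exact ⟨w'', sylvCon.trans h1 h3, h4⟩
  have hstep : ∀ (p t u : Word) (x y z : ℕ), x ≤ y → y < z →
      sylvCon (p * (.of z * .of x * u * .of y) * t) (p * (.of x * .of z * u * .of y) * t) :=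
    fun p t u x y z hxy hyz => sylvCon.mul
      (sylvCon.mul (sylvCon.refl _) (ConGen.Rel.of _ _ (.mk x y z u hxy hyz))) (sylvCon.refl _)
  -- `Lift` is not visibly symmetric, so both directions are carried through the induction.
  refine (sylvCon_induction (R := fun a b => Lift a b ∧ Lift b a)
    ⟨fun a => ⟨hrefl a, hrefl a⟩, fun h => ⟨h.2, h.1⟩,
      fun h h' => ⟨htrans h.1 h'.1, htrans h'.2 h.2⟩⟩ (fun p t u x y z hxy hyz => ⟨?_, ?_⟩) h).1 w hw
  · rintro w ⟨L, hw, hL, h⟩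
    simp only [FreeMonoid.toList_mul, FreeMonoid.toList_of, List.append_assoc,
      List.cons_append, List.nil_append, List.map_eq_append_iff, List.map_eq_cons_iff] at hL
    obtain ⟨Lp, _, rfl, hp, ⟨z', z⟩, _, rfl, rfl, ⟨x', x⟩, _, rfl, rfl, Lu, _, rfl, hu,
      ⟨y', y⟩, Lt, rfl, rfl, ht⟩ := hL
    have h' := (List.pairwise_append.1 h).2.1
    rw [List.pairwise_cons, List.pairwise_cons] at h'
    -- Standardization remembers how `x` and `z` compare with the later letter `y`, so the relation
    -- applies to `w` at the same positions.
    have hxy' : x' ≤ y' := (h'.2.1 (y', y) (by simp)).2 hxy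
    have hyz' : y' < z' := not_le.1 fun hc => hyz.not_ge ((h'.1 (y', y) (by simp)).1 hc)
    refine ⟨.ofList (Lp.map Prod.fst) * (.of x' * .of z' * .ofList (Lu.map Prod.fst) * .of y') *
      .ofList (Lt.map Prod.fst), ?_, Lp ++ (x', x) :: (z', z) :: (Lu ++ (y', y) :: Lt), ?_, ?_, ?_⟩
    · have := hstep (.ofList (Lp.map Prod.fst)) (.ofList (Lt.map Prod.fst))
        (.ofList (Lu.map Prod.fst)) x' y' z' hxy' hyz'
      convert this using 1
      apply FreeMonoid.toList.injective
      rw [← hw]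
      simp [FreeMonoid.toList_mul]
    · simp [FreeMonoid.toList_mul]
    · simp [FreeMonoid.toList_mul, hp, hu, ht]
    · exact pairwise_swap h ⟨fun _ => (hxy.trans_lt hyz).le, fun _ => (hxy'.trans_lt hyz').le⟩
  · rintro w ⟨L, hw, hL, h⟩
    simp only [FreeMonoid.toList_mul, FreeMonoid.toList_of, List.append_assoc,
      List.cons_append, List.nil_append, List.map_eq_append_iff, List.map_eq_cons_iff] at hL
    obtain ⟨Lp, _, rfl, hp, ⟨x', x⟩, _, rfl, rfl, ⟨z', z⟩, _, rfl, rfl, Lu, _, rfl, hu,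
      ⟨y', y⟩, Lt, rfl, rfl, ht⟩ := hL
    have h' := (List.pairwise_append.1 h).2.1
    rw [List.pairwise_cons, List.pairwise_cons] at h'
    have hxy' : x' ≤ y' := (h'.1 (y', y) (by simp)).2 hxy
    have hyz' : y' < z' := not_le.1 fun hc => hyz.not_ge ((h'.2.1 (y', y) (by simp)).1 hc)
    refine ⟨.ofList (Lp.map Prod.fst) * (.of z' * .of x' * .ofList (Lu.map Prod.fst) * .of y') *
      .ofList (Lt.map Prod.fst), ?_, Lp ++ (z', z) :: (x', x) :: (Lu ++ (y', y) :: Lt), ?_, ?_, ?_⟩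
    · have := sylvCon.symm (hstep (.ofList (Lp.map Prod.fst)) (.ofList (Lt.map Prod.fst))
        (.ofList (Lu.map Prod.fst)) x' y' z' hxy' hyz')
      convert this using 1
      apply FreeMonoid.toList.injective
      rw [← hw]
      simp [FreeMonoid.toList_mul]
    · simp [FreeMonoid.toList_mul]
    · simp [FreeMonoid.toList_mul, hp, hu, ht]
    · exact pairwise_swap h ⟨fun hc => absurd hc (hxy'.trans_lt hyz').not_ge,
        fun hc => absurd hc (hxy.trans_lt hyz).not_ge⟩

/-! ### Canonical words -/

/-- The postfix reading of the binary search tree of the mirror image of a word. -/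
def revCanon : List ℕ → List ℕ
  | [] => []
  | x :: l => revCanon (l.filter (· ≤ x)) ++ (revCanon (l.filter (x < ·)) ++ [x])
termination_by l => l.length
decreasing_by
  all_goals
    simp only [List.length_unattach, List.length_cons]
    exact Nat.lt_succ_of_le ((List.length_filter_le _ _).trans_eq List.length_attach)

/-- The postfix reading of the binary search tree of a word. -/
def canon (l : List ℕ) : List ℕ := revCanon l.reverse

theorem canon_nil : canon [] = [] := by simp [canon, revCanon]

theorem canon_append_singleton (l : List ℕ) (x : ℕ) : canon (l ++ [x]) =
    canon (l.filter (· ≤ x)) ++ (canon (l.filter (x < ·)) ++ [x]) := by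
  simp [canon, revCanon, List.filter_reverse]

theorem mem_canon {l : List ℕ} {a : ℕ} : a ∈ canon l ↔ a ∈ l := by
  induction l using bst_induction with
  | nil => rw [canon_nil]
  | append l x h1 h2 =>
    rw [canon_append_singleton]
    simp only [List.mem_append, h1, h2, List.mem_filter, decide_eq_true_eq, List.mem_singleton]
    have := le_or_gt a x
    tauto

/-- At each vertex the canonical word consists of the letters `≤ x`, then the letters `> x`, then
`x`. All comparisons between different blocks are thus forced by the shape, and those inside a block
are known by induction. -/
theorem sameStd_canon {l l' : List ℕ} (h : bst l = bst l') : SameStd (canon l) (canon l') := by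
  induction l using bst_induction generalizing l' with
  | nil =>
    have h1 := numNodes_bst l'
    rw [← h, bst_nil] at h1
    rw [List.length_eq_zero_iff.1 h1.symm]
    exact ⟨[], by simp [canon_nil]⟩
  | append l x h1 h2 =>
    rcases List.eq_nil_or_concat' l' with rfl | ⟨l', x', rfl⟩
    · rw [bst_append_singleton, bst_nil] at h
      exact absurd h (by simp)
    · rw [bst_append_singleton, bst_append_singleton, BinaryTree.node.injEq] at h
      rw [canon_append_singleton, canon_append_singleton]
      refine (h1 h.2.1).append ((h2 h.2.2).append ⟨[(x, x')], by simp⟩ ?_) ?_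
      · simp only [mem_canon, List.mem_filter, List.mem_singleton, decide_eq_true_eq]
        rintro a ha _ rfl a' ha' _ rfl
        exact iff_of_false ha.2.not_ge ha'.2.not_ge
      · simp only [mem_canon, List.mem_filter, List.mem_singleton, decide_eq_true_eq,
          List.mem_append]
        intro a ha b hb a' ha' b' hb'
        refine iff_of_true ?_ ?_
        · rcases hb with hb | rfl
          exacts [ha.2.trans hb.2.le, ha.2]
        · rcases hb' with hb | rfl
          exacts [ha'.2.trans hb.2.le, ha'.2]

/-- The final `x` plays the role of `y` in the relations: it allows the larger letter `a` to jump to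
the right over each letter `≤ x`. -/
theorem sylvCon_move (x a : ℕ) (hax : x < a) (l : List ℕ) (hl : ∀ b ∈ l, b ≤ x) (m : Word) :
    sylvCon (.of a * .ofList l * m * .of x) (.ofList l * .of a * m * .of x) := by
  induction l with
  | nil => exact sylvCon.refl _
  | cons b l ih =>
    have h1 : sylvCon _ _ := ConGen.Rel.of _ _ (SylvRel.mk b x a (.ofList l * m)
      (hl b (by simp)) hax)
    have h2 := sylvCon.mul (sylvCon.refl (.of b)) (ih fun c hc => hl c (by simp [hc]))
    rw [FreeMonoid.ofList_cons]
    simp only [mul_assoc] at h1 h2 ⊢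
    exact sylvCon.trans h1 h2

theorem sylvCon_filter (x : ℕ) (l : List ℕ) :
    sylvCon (.ofList l * .of x)
      (.ofList (l.filter (· ≤ x)) * .ofList (l.filter (x < ·)) * .of x) := by
  induction l with
  | nil => exact sylvCon.refl _
  | cons a l ih =>
    have h := sylvCon.mul (sylvCon.refl (.of a)) ih
    rcases le_or_gt a x with hax | hax
    · rw [List.filter_cons_of_pos (by simpa using hax),
        List.filter_cons_of_neg (by simpa using hax), FreeMonoid.ofList_cons,
        FreeMonoid.ofList_cons]
      simpa only [mul_assoc] using h
    · rw [List.filter_cons_of_neg (by simpa using hax),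
        List.filter_cons_of_pos (by simpa using hax), FreeMonoid.ofList_cons,
        FreeMonoid.ofList_cons]
      have h2 := sylvCon_move x a hax (l.filter (· ≤ x))
        (fun b hb => by simpa using (List.mem_filter.1 hb).2) (.ofList (l.filter (x < ·)))
      simp only [mul_assoc] at h h2 ⊢
      exact sylvCon.trans h h2

/-- The letters before the last one `x` are partitioned by `sylvCon_filter`, without changing the
order within either part; each part is then made canonical by induction. -/
theorem sylvCon_canon (l : List ℕ) : sylvCon (.ofList l) (.ofList (canon l)) := by
  induction l using bst_induction with
  | nil => rw [canon_nil]; exact sylvCon.refl _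
  | append l x h1 h2 =>
    rw [canon_append_singleton, FreeMonoid.ofList_append, FreeMonoid.ofList_append,
      FreeMonoid.ofList_append]
    have h3 := sylvCon_filter x l
    rw [mul_assoc] at h3
    exact sylvCon.trans h3 (sylvCon.mul h1 (sylvCon.mul h2 (sylvCon.refl _)))

/-! ### The projection of the series `G_σ` -/

/-- The shape of the binary search tree of a class of the sylvester monoid. -/
def sylvTree (c : Sylv) : BinaryTree Unit :=
  Con.liftOn c (fun w => bst w.toList) fun _ _ h => bst_eq_of_sylvCon h

theorem sylvProj_apply (f : Series Word) (c : Sylv) :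
    sylvProj f c = ∑ w ∈ (finite_sylv_class c).toFinset, f w := rfl

theorem perm_of_sylvCon {a b : Word} (h : sylvCon a b) : a.toList.Perm b.toList := by
  have h1 : letters a = letters b := sylvCon_le_ker_letters h
  rw [letters_apply, letters_apply] at h1
  exact Multiset.coe_eq_coe.1 (Multiplicative.ofAdd.injective h1)

/-- The canonical words of `w` and of `σ` have the same standardization, since the trees agree. The
congruence that leads from the canonical word of `σ` back to `σ` therefore lifts to one starting at
the canonical word of `w`. -/
theorem exists_sylvCon_stdSigma {n : ℕ} (σ : Equiv.Perm (Fin n)) (w : Word)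
    (h : bst w.toList = permTree σ) : ∃ w', sylvCon w w' ∧ stdSigma w'.toList = ⟨n, σ⟩ := by
  rw [← bst_of_stdSigma (stdSigma_permWord σ)] at h
  obtain ⟨w', h1, h2⟩ := exists_lift_of_sylvCon (sylvCon.symm (sylvCon_canon (permWord σ)))
    (.ofList (canon w.toList)) (sameStd_canon h)
  exact ⟨w', sylvCon.trans (sylvCon_canon w.toList) h1,
    (sameStd_iff.1 h2).trans (stdSigma_permWord σ)⟩

-- The coefficient counts the words of the class `c` with standardization `σ`. There is none if the
-- trees differ, as the tree is an invariant, and otherwise exactly one. In particular `π(G_σ)`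
-- depends only on `𝒫(σ)`.
open scoped Classical in
theorem sylvProj_G_apply {n : ℕ} (σ : Equiv.Perm (Fin n)) (c : Sylv) :
    sylvProj (G σ) c = if sylvTree c = permTree σ then 1 else 0 := by
  have hG : ∀ w, G σ w = if stdSigma w.toList = ⟨n, σ⟩ then 1 else 0 := fun w => by
    rw [G, F_apply, inv_inv]
  rw [sylvProj_apply]
  simp only [hG]
  induction c using Con.induction_on with
  | H w =>
    have hmem : ∀ w', w' ∈ (finite_sylv_class (w : Sylv)).toFinset ↔ sylvCon w w' := fun w' => by
      rw [Set.Finite.mem_toFinset]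
      exact (Con.eq sylvCon).trans ⟨fun h => sylvCon.symm h, fun h => sylvCon.symm h⟩
    split_ifs with h
    · obtain ⟨w', h1, h2⟩ := exists_sylvCon_stdSigma σ w h
      rw [Finset.sum_eq_single w', if_pos h2]
      · intro v hv hne
        refine if_neg fun hv' => hne ?_
        exact FreeMonoid.toList.injective ((sameStd_iff.2 (hv'.trans h2.symm)).eq_of_perm
          (perm_of_sylvCon (sylvCon.trans (sylvCon.symm ((hmem v).1 hv)) h1)))
      · exact fun h' => absurd ((hmem w').2 h1) h'
    · refine Finset.sum_eq_zero fun v hv => if_neg fun hv' => h ?_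
      exact (bst_eq_of_sylvCon ((hmem v).1 hv)).trans (bst_of_stdSigma hv')

/-! ### The permutation of a tree -/

theorem permWord_treePerm (T : BinaryTree Unit) : permWord (treePerm T) = treeWord T :=
  List.ext_getElem (by simp [permWord, treeWord_length]) fun i h1 h2 => by
    simp [permWord, treePerm]

/-- Infix labels increase from the left subtree to the root to the right subtree, and postfix
reading puts the root last: inserting the letters from right to left rebuilds the tree. Hence `T ↦
w_T` is a section of `𝒫`. -/
theorem bst_infixLabel (T : BinaryTree Unit) (k : ℕ) : bst (postfixWord (infixLabel k T)) = T := by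
  induction T generalizing k with
  | nil => rw [infixLabel, postfixWord, bst_nil]
  | node a l r hl hr =>
    have hL : ∀ x ∈ postfixWord (infixLabel k l), x < k + l.numNodes := fun x hx => by
      rw [(postfixWord_infixLabel_perm l k).mem_iff, List.mem_range'_1] at hx
      exact hx.2
    have hR : ∀ x ∈ postfixWord (infixLabel (k + l.numNodes + 1) r), k + l.numNodes < x :=
      fun x hx => by
        rw [(postfixWord_infixLabel_perm r _).mem_iff, List.mem_range'_1] at hx
        exact hx.1
    rw [infixLabel, postfixWord, bst_append_singleton, List.filter_append, List.filter_append,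
      List.filter_eq_self.2 (by simpa using fun x hx => (hL x hx).le),
      List.filter_eq_nil_iff.2 (by simpa using hR),
      List.filter_eq_nil_iff.2 (by simpa using fun x hx => (hL x hx).le),
      List.filter_eq_self.2 (by simpa using hR), List.append_nil, List.nil_append, hl, hr]

theorem permTree_treePerm (T : BinaryTree Unit) : permTree (treePerm T) = T := by
  rw [← bst_of_stdSigma (stdSigma_permWord (treePerm T)), permWord_treePerm]
  exact bst_infixLabel T 0

theorem sylvTree_treeWord (T : BinaryTree Unit) :
    sylvTree (sylvCon.mk' (.ofList (treeWord T))) = T := bst_infixLabel T 0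

/-! ### The coalgebra `FQSym` -/

section words
variable {n : ℕ}

theorem Series.mul_apply_ofList (f g : Series Word) (l : List ℕ) :
    (f * g) (FreeMonoid.ofList l) = ∑ k : Fin (l.length + 1),
      f (FreeMonoid.ofList (l.take k)) * g (FreeMonoid.ofList (l.drop k)) := by
  rw [Series.mul_apply]
  -- `Fin.ofNat` reduces modulo `l.length + 1`, which is harmless: a prefix has length at most
  -- `l.length`.
  refine Finset.sum_bij' (i := fun p _ => Fin.ofNat (l.length + 1) p.1.length)
    (j := fun k _ => (FreeMonoid.ofList (l.take k), FreeMonoid.ofList (l.drop k)))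
    (fun _ _ => Finset.mem_univ _) (fun k _ => ?_) ?_ (fun k _ => ?_) ?_
  · rw [Series.mem_factors, ← FreeMonoid.ofList_append, List.take_append_drop]
  · rintro ⟨a, b⟩ hp
    have hl : l = a.toList ++ b.toList := by
      rw [← FreeMonoid.toList_mul, Series.mem_factors.1 hp]; rfl
    have hk : ((Fin.ofNat (l.length + 1) a.length : Fin (l.length + 1)) : ℕ) = a.toList.length :=
      Nat.mod_eq_of_lt (by rw [hl, List.length_append]; exact Nat.lt_succ_of_le (Nat.le_add_right _ _))
    simp only [hk]
    rw [hl, List.take_left, List.drop_left]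
    rfl
  · refine Fin.ext ?_
    change (l.take k).length % (l.length + 1) = k
    rw [List.length_take, Nat.min_eq_left (by omega), Nat.mod_eq_of_lt k.2]
  · rintro ⟨a, b⟩ hp
    have hl : l = a.toList ++ b.toList := by
      rw [← FreeMonoid.toList_mul, Series.mem_factors.1 hp]; rfl
    have hk : ((Fin.ofNat (l.length + 1) a.length : Fin (l.length + 1)) : ℕ) = a.toList.length :=
      Nat.mod_eq_of_lt (by rw [hl, List.length_append]; exact Nat.lt_succ_of_le (Nat.le_add_right _ _))
    simp only [hk]
    rw [hl, List.take_left, List.drop_left]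
    rfl

theorem length_permWord (σ : Equiv.Perm (Fin n)) : (permWord σ).length = n := by simp [permWord]

theorem stdSigma_take_permWord (σ : Equiv.Perm (Fin n)) (k : Fin (n + 1)) :
    stdSigma ((permWord σ).take k) = ⟨k, prefixStd σ k⟩ := by
  have : (permWord σ).take k = List.ofFn fun i : Fin k => (σ ⟨i, by omega⟩ : ℕ) :=
    List.ext_getElem (by simp [permWord]; omega) fun i h1 h2 => by simp [permWord]
  rw [this, stdSigma_ofFn, prefixStd]
  congr 1
  exact (std_eq_iff _ _).2 fun i j _ => Iff.rfl

theorem stdSigma_drop_permWord (σ : Equiv.Perm (Fin n)) (k : Fin (n + 1)) :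
    stdSigma ((permWord σ).drop k) = ⟨n - k, suffixStd σ k⟩ := by
  have : (permWord σ).drop k = List.ofFn fun i : Fin (n - k) => (σ ⟨k + i, by omega⟩ : ℕ) :=
    List.ext_getElem (by simp [permWord]) fun i h1 h2 => by simp [permWord]
  rw [this, stdSigma_ofFn, suffixStd]
  congr 1
  exact (std_eq_iff _ _).2 fun i j _ => Iff.rfl

theorem FQSym_apply_congr {f : Series Word} (hf : f ∈ FQSym) {u v : Word}
    (h : stdSigma u.toList = stdSigma v.toList) : f u = f v := by
  induction hf using Submodule.span_induction with
  | mem x hx =>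
    obtain ⟨⟨n, σ⟩, rfl⟩ := hx
    classical
    simp only [F_apply, h]
  | zero => rfl
  | add x y _ _ hx hy => rw [Series.add_apply, Series.add_apply, hx, hy]
  | smul c x _ hx => rw [Series.smul_apply, Series.smul_apply, hx]

/-! ### Coefficient forms and the basis of `FQSym` -/

/-- The coefficient of a word, as a linear form on `FQSym`. -/
def evalWord (w : Word) : FQSym →ₗ[ℂ] ℂ where
  toFun f := (f : Series Word) w
  map_add' _ _ := rfl
  map_smul' _ _ := rfl

theorem evalWord_apply (w : Word) (f : FQSym) : evalWord w f = (f : Series Word) w := rfl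

theorem separates_evalWord : Separates evalWord := fun _ h => Subtype.ext (Series.ext h)

/-- The coefficient of the word of a permutation, as a linear form on `FQSym`. -/
def evalPerm (s : Σ n, Equiv.Perm (Fin n)) : FQSym →ₗ[ℂ] ℂ :=
  evalWord (FreeMonoid.ofList (permWord s.2))

theorem evalWord_eq_evalPerm (w : Word) : evalWord w = evalPerm (stdSigma w.toList) :=
  LinearMap.ext fun f => FQSym_apply_congr f.2 (stdSigma_permWord _).symm

theorem separates_evalPerm : Separates evalPerm := fun _ h =>
  separates_evalWord _ fun w => by rw [evalWord_eq_evalPerm, h]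

theorem evalPerm_FElt (s : Σ n, Equiv.Perm (Fin n)) (σ : Equiv.Perm (Fin n)) :
    evalPerm s (FElt σ) = if s = ⟨n, σ⁻¹⟩ then 1 else 0 := by
  refine (F_apply σ _).trans (if_congr ?_ rfl rfl)
  rw [FreeMonoid.toList_ofList, stdSigma_permWord]

/-- The inverse of a permutation of unspecified size. -/
def sigmaInv (s : Σ n, Equiv.Perm (Fin n)) : Σ n, Equiv.Perm (Fin n) := ⟨s.1, s.2⁻¹⟩

theorem sigmaInv_sigmaInv (s : Σ n, Equiv.Perm (Fin n)) : sigmaInv (sigmaInv s) = s := by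
  rw [sigmaInv, sigmaInv, inv_inv]

theorem eq_sigmaInv_iff {s t : Σ n, Equiv.Perm (Fin n)} : s = sigmaInv t ↔ t = sigmaInv s := by
  constructor <;> (rintro rfl; rw [sigmaInv_sigmaInv])

/-- The basis of the `F_σ`. -/
def basisF : Module.Basis (Σ n, Equiv.Perm (Fin n)) ℂ FQSym :=
  Module.Basis.mk (v := fun s => FElt s.2)
    (linearIndependent_of_forms _ (fun s => evalPerm (sigmaInv s)) fun s t => by
      rw [evalPerm_FElt]
      exact if_congr (Function.Involutive.injective sigmaInv_sigmaInv).eq_iff rfl rfl)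
    (by
      rintro ⟨f, hf⟩ -
      induction hf using Submodule.span_induction with
      | mem x hx =>
        obtain ⟨s, rfl⟩ := hx
        exact Submodule.subset_span ⟨s, rfl⟩
      | zero => exact Submodule.zero_mem _
      | add x y hx hy h1 h2 => exact Submodule.add_mem _ h1 h2
      | smul c x hx h1 => exact Submodule.smul_mem _ c h1)

theorem basisF_apply (s : Σ n, Equiv.Perm (Fin n)) : basisF s = FElt s.2 := by
  rw [basisF, Module.Basis.mk_apply]

theorem FQSym_induction {p : FQSym → Prop} (h0 : p 0) (hadd : ∀ x y, p x → p y → p (x + y))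
    (hsmul : ∀ (c : ℂ) x, p x → p (c • x)) (hF : ∀ n (σ : Equiv.Perm (Fin n)), p (FElt σ))
    (x : FQSym) : p x := by
  have hx : x ∈ Submodule.span ℂ (Set.range basisF) := by rw [basisF.span_eq]; trivial
  induction hx using Submodule.span_induction with
  | mem x hx =>
    obtain ⟨s, rfl⟩ := hx
    rw [basisF_apply]
    exact hF _ _
  | zero => exact h0
  | add x y _ _ h1 h2 => exact hadd x y h1 h2
  | smul c x _ h1 => exact hsmul c x h1

theorem FQSym_hom_ext {M : Type*} [AddCommGroup M] [Module ℂ M] {f g : FQSym →ₗ[ℂ] M}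
    (h : ∀ n (σ : Equiv.Perm (Fin n)), f (FElt σ) = g (FElt σ)) : f = g :=
  basisF.ext fun s => by rw [basisF_apply]; exact h _ _

/-! ### Self-duality of `FQSym` -/

/-- The symmetric bilinear form on `FQSym` with `⟨F_σ, F_τ⟩ = 1` if `τ = σ⁻¹`, else `0`. -/
def form : FQSym →ₗ[ℂ] FQSym →ₗ[ℂ] ℂ := basisF.constr ℂ evalPerm

theorem form_FElt (σ : Equiv.Perm (Fin n)) : form (FElt σ) = evalPerm ⟨n, σ⟩ := by
  rw [← basisF_apply ⟨n, σ⟩, form, Module.Basis.constr_basis]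

theorem form_comm (f g : FQSym) : form f g = form g f := by
  have : form = form.flip := by
    refine FQSym_hom_ext fun n σ => FQSym_hom_ext fun m τ => ?_
    rw [LinearMap.flip_apply, form_FElt, form_FElt, evalPerm_FElt, evalPerm_FElt]
    exact if_congr (eq_sigmaInv_iff (s := ⟨n, σ⟩) (t := ⟨m, τ⟩)) rfl rfl
  exact LinearMap.congr_fun₂ this f g

theorem separates_form : Separates form := fun v h => separates_evalPerm v fun s => by
  have := h (FElt s.2)
  rwa [form_FElt] at this

/-- The coproduct of `FQSym`. -/
def comulF : FQSym →ₗ[ℂ] FQSym ⊗[ℂ] FQSym := basisF.constr ℂ fun s =>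
  ∑ k : Fin (s.1 + 1), FElt (prefixStd s.2 k) ⊗ₜ[ℂ] FElt (suffixStd s.2 k)

theorem comulF_FElt (σ : Equiv.Perm (Fin n)) : comulF (FElt σ) =
    ∑ k : Fin (n + 1), FElt (prefixStd σ k) ⊗ₜ[ℂ] FElt (suffixStd σ k) := by
  rw [← basisF_apply ⟨n, σ⟩, comulF, Module.Basis.constr_basis]

/-- Pairing with `F_σ` takes the coefficient of the word `σ`; in a product this is a sum over the
cuts of `σ`, and the coefficients of the two pieces depend only on their standardizations. -/
theorem tensorForm_comulF (f g : FQSym) :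
    tensorForm (form f) (form g) ∘ₗ comulF = form (f * g) := by
  refine FQSym_hom_ext fun n σ => ?_
  rw [LinearMap.comp_apply, form_comm, form_FElt, comulF_FElt, map_sum]
  change _ = ((f : Series Word) * (g : Series Word)) (FreeMonoid.ofList (permWord σ))
  rw [Series.mul_apply_ofList]
  refine Fintype.sum_equiv (finCongr (by rw [length_permWord])) _ _ fun k => ?_
  rw [tensorForm_tmul, form_comm, form_comm g, form_FElt, form_FElt]
  congr 1
  · exact FQSym_apply_congr f.2
      ((stdSigma_permWord _).trans (stdSigma_take_permWord σ k).symm)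
  · exact FQSym_apply_congr g.2
      ((stdSigma_permWord _).trans (stdSigma_drop_permWord σ k).symm)

/-- The counit of `FQSym`, the coefficient of the empty word. -/
def counitF : FQSym →ₗ[ℂ] ℂ := evalWord 1

theorem FElt_one : FElt (1 : Equiv.Perm (Fin 0)) = 1 := Subtype.ext F_one

theorem form_one : form 1 = counitF := by
  rw [← FElt_one, form_FElt, evalPerm, counitF]
  rfl

/-- By adjunction with respect to the nondegenerate form, coassociativity is dual to `mul_assoc` and
the counit laws to `one_mul` and `mul_one`. -/
instance coalgebraF : Coalgebra ℂ FQSym where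
  comul := comulF
  counit := counitF
  coassoc := by
    refine LinearMap.ext fun x => ?_
    refine (separates_form.tensorForm (separates_form.tensorForm separates_form)).eq
      fun ⟨f, g, h⟩ => ?_
    have h1 : tensorForm (form f) (tensorForm (form g) (form h)) ∘ₗ
        (TensorProduct.assoc ℂ FQSym FQSym FQSym).toLinearMap =
        tensorForm (tensorForm (form f) (form g)) (form h) := by
      ext x y z; simp [mul_assoc]
    have h2 := fun t => LinearMap.congr_fun h1 t
    simp only [LinearMap.comp_apply, LinearEquiv.coe_coe] at h2 ⊢
    rw [h2, LinearMap.rTensor, LinearMap.lTensor, tensorForm_map, tensorForm_map,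
      tensorForm_comulF, tensorForm_comulF, LinearMap.comp_id, LinearMap.comp_id]
    change (tensorForm (form (f * g)) (form h) ∘ₗ comulF) x =
      (tensorForm (form f) (form (g * h)) ∘ₗ comulF) x
    rw [tensorForm_comulF, tensorForm_comulF, mul_assoc]
  rTensor_counit_comp_comul := by
    refine LinearMap.ext fun x => (TensorProduct.lid ℂ FQSym).injective
      (separates_form.eq fun f => ?_)
    have h1 : form f ∘ₗ (TensorProduct.lid ℂ FQSym).toLinearMap ∘ₗ counitF.rTensor FQSym =
        tensorForm (form 1) (form f) := by
      rw [form_one]; ext x y; simp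
    refine (LinearMap.congr_fun h1 (comulF x)).trans ?_
    rw [← LinearMap.comp_apply, tensorForm_comulF, one_mul]
    simp
  lTensor_counit_comp_comul := by
    refine LinearMap.ext fun x => (TensorProduct.rid ℂ FQSym).injective
      (separates_form.eq fun f => ?_)
    have h1 : form f ∘ₗ (TensorProduct.rid ℂ FQSym).toLinearMap ∘ₗ counitF.lTensor FQSym =
        tensorForm (form f) (form 1) := by
      rw [form_one]; ext x y; simp [mul_comm]
    refine (LinearMap.congr_fun h1 (comulF x)).trans ?_
    rw [← LinearMap.comp_apply, tensorForm_comulF, mul_one]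
    simp

/-- The component of degree `n` of `FQSym`. -/
def degF (n : ℕ) : Submodule ℂ FQSym :=
  Submodule.span ℂ (Set.range fun σ : Equiv.Perm (Fin n) => FElt σ)

theorem FElt_mem_degF (σ : Equiv.Perm (Fin n)) : FElt σ ∈ degF n := Submodule.subset_span ⟨σ, rfl⟩

theorem isConnectedGrading_degF : IsConnectedGrading degF where
  iSup_eq_top := by
    refine eq_top_iff.2 fun x _ => ?_
    refine FQSym_induction (Submodule.zero_mem _) (fun _ _ => Submodule.add_mem _)
      (fun c _ => Submodule.smul_mem _ c) (fun n σ => ?_) x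
    exact Submodule.mem_iSup_of_mem n (FElt_mem_degF σ)
  zero_le := by
    refine Submodule.span_le.2 ?_
    rintro _ ⟨σ, rfl⟩
    rw [Subsingleton.elim σ 1]
    refine Submodule.subset_span ?_
    rw [Set.mem_singleton_iff, ← FElt_one]
  comul_mem n a ha := by
    have : degF n ≤ (tensorDeg degF n).comap comulF := by
      refine Submodule.span_le.2 ?_
      rintro _ ⟨σ, rfl⟩
      change comulF (FElt σ) ∈ tensorDeg degF n
      rw [comulF_FElt]
      exact Submodule.sum_mem _ fun k _ => tmul_mem_tensorDeg (by omega) (FElt_mem_degF _)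
        (FElt_mem_degF _)
    exact this ha

end words

/-! ### Splitting words along the order of the alphabet -/

section lists
variable {α β : Type*}

/-- The lists `L₁` and `L₂` are interleaved in the order in which `s` alternates between letters
satisfying `p` and the others. -/
theorem exists_merge (f : α → β) (p : β → Bool) (s : List β) (L₁ L₂ : List α)
    (h₁ : L₁.map f = s.filter p) (h₂ : L₂.map f = s.filter fun b => !p b) :
    ∃ L : List α, L.map f = s ∧ (L.filter fun a => p (f a)) = L₁ ∧
      (L.filter fun a => !p (f a)) = L₂ := by
  induction s generalizing L₁ L₂ with
  | nil => exact ⟨[], by simp_all⟩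
  | cons b s ih =>
    by_cases hb : p b
    · rw [List.filter_cons_of_pos hb] at h₁
      rw [List.filter_cons_of_neg (by simpa using hb)] at h₂
      obtain ⟨a, L₁, rfl, rfl, h₁'⟩ := List.map_eq_cons_iff.1 h₁
      obtain ⟨L, h1, h2, h3⟩ := ih L₁ L₂ h₁' h₂
      exact ⟨a :: L, by rw [List.map_cons, h1], by simp [hb, h2], by simp [hb, h3]⟩
    · rw [List.filter_cons_of_neg hb] at h₁
      rw [List.filter_cons_of_pos (by simpa using hb)] at h₂
      obtain ⟨a, L₂, rfl, rfl, h₂'⟩ := List.map_eq_cons_iff.1 h₂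
      obtain ⟨L, h1, h2, h3⟩ := ih L₁ L₂ h₁ h₂'
      exact ⟨a :: L, by rw [List.map_cons, h1], by simp [hb, h2], by simp [hb, h3]⟩

theorem pairwise_of_filter {r : α → α → Prop} (p : α → Bool) (L : List α)
    (h₁ : (L.filter p).Pairwise r) (h₂ : (L.filter fun a => !p a).Pairwise r)
    (h : ∀ a ∈ L, p a → ∀ b ∈ L, ¬ p b → r a b ∧ r b a) : L.Pairwise r := by
  induction L with
  | nil => exact .nil
  | cons a L ih =>
    have h' := fun b hb hpb c hc hpc => h b (List.mem_cons_of_mem a hb) hpb c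
      (List.mem_cons_of_mem a hc) hpc
    by_cases ha : p a
    · rw [List.filter_cons_of_pos ha, List.pairwise_cons] at h₁
      rw [List.filter_cons_of_neg (by simpa using ha)] at h₂
      refine List.pairwise_cons.2 ⟨fun b hb => ?_, ih h₁.2 h₂ h'⟩
      by_cases hpb : p b
      · exact h₁.1 b (List.mem_filter.2 ⟨hb, hpb⟩)
      · exact (h a (by simp) ha b (by simp [hb]) hpb).1
    · rw [List.filter_cons_of_neg ha] at h₁
      rw [List.filter_cons_of_pos (by simpa using ha), List.pairwise_cons] at h₂
      refine List.pairwise_cons.2 ⟨fun b hb => ?_, ih h₁ h₂.2 h'⟩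
      by_cases hpb : p b
      · exact (h b (by simp [hb]) hpb a (by simp) ha).2
      · exact h₂.1 b (List.mem_filter.2 ⟨hb, by simpa using hpb⟩)

end lists

/-- If the second components run through `0, …, n - 1`, and have the same standardization as the
first ones, then the first components less than `N` correspond to the smallest second
components. -/
theorem lt_iff_of_sameStd {L : List (ℕ × ℕ)} {n : ℕ} (N : ℕ)
    (hL : L.Pairwise fun a b => a.1 ≤ b.1 ↔ a.2 ≤ b.2) (hd : (L.map Prod.snd).Nodup)
    (hn : ∀ b, b ∈ L.map Prod.snd ↔ b < n) {a : ℕ × ℕ} (ha : a ∈ L) :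
    a.1 < N ↔ a.2 < (L.filter (·.1 < N)).length := by
  -- The hypothesis compares pairs in list order only, and is not symmetric when letters are equal;
  -- this weaker consequence is symmetric.
  have hle : ∀ a ∈ L, ∀ b ∈ L, (a.1 < b.1 → a.2 ≤ b.2) ∧ (b.1 < a.1 → b.2 ≤ a.2) := by
    intro a ha b hb
    have hs : Std.Symm fun a b : ℕ × ℕ => (a.1 < b.1 → a.2 ≤ b.2) ∧ (b.1 < a.1 → b.2 ≤ a.2) :=
      ⟨fun _ _ h => ⟨h.2, h.1⟩⟩
    refine List.Pairwise.forall_of_forall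
      (R := fun a b : ℕ × ℕ => (a.1 < b.1 → a.2 ≤ b.2) ∧ (b.1 < a.1 → b.2 ≤ a.2))
      (fun x _ => ⟨fun _ => le_rfl, fun _ => le_rfl⟩)
      (hL.imp fun {a b} h => ⟨fun hab => h.1 hab.le, fun hab => ?_⟩) ha hb
    exact (not_le.1 fun hc => hab.not_ge (h.2 hc)).le
  have hlt : ∀ a ∈ L, ∀ b ∈ L, a.1 < N → N ≤ b.1 → a.2 < b.2 := by
    intro a ha b hb h1 h2
    refine lt_of_le_of_ne ((hle a ha b hb).1 (h1.trans_le h2)) fun h => ?_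
    rw [List.inj_on_of_nodup_map hd ha hb h] at h1
    exact h1.not_ge h2
  -- By `hlt`, `S` is an initial segment of `{0, …, n - 1}`, hence equal to `{0, …, S.card - 1}`.
  -- Both directions follow by comparing cardinalities.
  let S := ((L.filter (·.1 < N)).map Prod.snd).toFinset
  have hS : S.card = (L.filter (·.1 < N)).length := by
    rw [List.toFinset_card_of_nodup (hd.sublist (List.filter_sublist.map _)), List.length_map]
  have hmem : ∀ c, c ∈ S ↔ ∃ b ∈ L, b.1 < N ∧ b.2 = c := by
    intro c
    simp [S, and_assoc]
  rw [← hS]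
  constructor
  · intro h
    rw [← Nat.succ_le_iff, ← Finset.card_range (a.2).succ]
    refine Finset.card_le_card fun c hc => ?_
    rw [Finset.mem_range, Nat.lt_succ_iff] at hc
    obtain ⟨b, hb, rfl⟩ := List.mem_map.1
      ((hn c).2 (hc.trans_lt ((hn a.2).1 (List.mem_map_of_mem ha))))
    refine (hmem _).2 ⟨b, hb, ?_, rfl⟩
    by_contra hbN
    exact hc.not_gt (hlt a ha b hb h (not_lt.1 hbN))
  · intro h
    by_contra haN
    refine h.not_ge ?_
    rw [← Finset.card_range a.2]
    refine Finset.card_le_card fun c hc => ?_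
    obtain ⟨b, hb, hbN, rfl⟩ := (hmem c).1 hc
    exact Finset.mem_range.2 (hlt b hb a ha hbN (not_lt.1 haN))

/-! ### Inverses of standardized prefixes and suffixes -/

section permWord
variable {n : ℕ}

theorem nodup_permWord (σ : Equiv.Perm (Fin n)) : (permWord σ).Nodup :=
  List.nodup_ofFn.2 (Fin.val_injective.comp σ.injective)

theorem mem_permWord (σ : Equiv.Perm (Fin n)) (a : ℕ) : a ∈ permWord σ ↔ a < n := by
  rw [permWord, List.mem_ofFn]
  constructor
  · rintro ⟨i, rfl⟩; exact (σ i).2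
  · intro h; exact ⟨σ.symm ⟨a, h⟩, by simp⟩

theorem std_lt_std_iff {m : ℕ} {α : Type*} [LinearOrder α] {v : Fin m → α}
    (hv : Function.Injective v) {i j : Fin m} : std v i < std v j ↔ v i < v j := by
  have hmono : StrictMono (v ∘ Tuple.sort v) :=
    (Tuple.monotone_sort v).strictMono_of_injective (hv.comp (Tuple.sort v).injective)
  obtain ⟨i, rfl⟩ := (Tuple.sort v).surjective i
  obtain ⟨j, rfl⟩ := (Tuple.sort v).surjective j
  change (Tuple.sort v).symm _ < (Tuple.sort v).symm _ ↔ _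
  rw [Equiv.symm_apply_apply, Equiv.symm_apply_apply]
  exact hmono.lt_iff_lt.symm

/-- `σ i < σ j`, for natural numbers `i` and `j`. -/
def PosLT (σ : Equiv.Perm (Fin n)) (a b : ℕ) : Prop :=
  ∃ (ha : a < n) (hb : b < n), σ ⟨a, ha⟩ < σ ⟨b, hb⟩

theorem pairwise_permWord_inv (σ : Equiv.Perm (Fin n)) : (permWord σ⁻¹).Pairwise (PosLT σ) :=
  List.pairwise_ofFn.2 fun i j hij => ⟨(σ⁻¹ i).2, (σ⁻¹ j).2, by simpa using hij⟩

theorem eq_of_pairwise_posLT (σ : Equiv.Perm (Fin n)) {l l' : List ℕ} (h : l.Pairwise (PosLT σ))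
    (h' : l'.Pairwise (PosLT σ)) (hd : l.Nodup) (hd' : l'.Nodup) (hm : ∀ a, a ∈ l ↔ a ∈ l') :
    l = l' :=
  List.Perm.eq_of_pairwise (fun a b _ _ h1 h2 => by
    obtain ⟨_, _, h1⟩ := h1
    obtain ⟨_, _, h2⟩ := h2
    exact absurd h2 h1.not_gt) h h' ((List.perm_ext_iff_of_nodup hd hd').2 hm)

/-- The word `σ⁻¹` lists the positions of `σ` by increasing value, and standardizing a prefix keeps
the relative order of its values. Cutting `σ` at `k` thus amounts to splitting the alphabet of `σ⁻¹`
at `k`. -/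
theorem permWord_prefixStd_inv (σ : Equiv.Perm (Fin n)) (k : Fin (n + 1)) :
    permWord (prefixStd σ k)⁻¹ = (permWord σ⁻¹).filter (· < (k : ℕ)) := by
  refine eq_of_pairwise_posLT σ (List.pairwise_ofFn.2 fun i j hij => ?_)
    ((pairwise_permWord_inv σ).sublist List.filter_sublist) (nodup_permWord _)
    ((nodup_permWord _).filter _) fun a => ?_
  · refine ⟨by omega, by omega, ?_⟩
    have hinj : Function.Injective fun i : Fin k => σ ⟨i, by omega⟩ := fun i j h => by
      simpa [Fin.ext_iff] using h
    have := (std_lt_std_iff hinj (i := (prefixStd σ k)⁻¹ i) (j := (prefixStd σ k)⁻¹ j)).1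
    exact this (by
      change prefixStd σ k ((prefixStd σ k).symm i) < prefixStd σ k ((prefixStd σ k).symm j)
      rwa [Equiv.apply_symm_apply, Equiv.apply_symm_apply])
  · rw [List.mem_filter, mem_permWord, mem_permWord, decide_eq_true_eq]
    omega

theorem permWord_suffixStd_inv (σ : Equiv.Perm (Fin n)) (k : Fin (n + 1)) :
    (permWord (suffixStd σ k)⁻¹).map (fun a => (k : ℕ) + a) =
      (permWord σ⁻¹).filter fun a => !decide (a < (k : ℕ)) := by
  have hinj : Function.Injective fun a => (k : ℕ) + a := fun a b h => Nat.add_left_cancel h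
  refine eq_of_pairwise_posLT σ ?_ ((pairwise_permWord_inv σ).sublist List.filter_sublist)
    ((nodup_permWord _).map hinj) ((nodup_permWord _).filter _) fun a => ?_
  · rw [permWord, List.map_ofFn]
    refine List.pairwise_ofFn.2 fun i j hij => ?_
    refine ⟨by simp only [Function.comp_apply]; omega, by simp only [Function.comp_apply]; omega, ?_⟩
    have hinj : Function.Injective fun i : Fin (n - k) => σ ⟨k + i, by omega⟩ := fun i j h => by
      simpa [Fin.ext_iff] using h
    have := (std_lt_std_iff hinj (i := (suffixStd σ k)⁻¹ i) (j := (suffixStd σ k)⁻¹ j)).1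
    exact this (by
      change suffixStd σ k ((suffixStd σ k).symm i) < suffixStd σ k ((suffixStd σ k).symm j)
      rwa [Equiv.apply_symm_apply, Equiv.apply_symm_apply])
  · rw [List.mem_filter, mem_permWord, List.mem_map]
    simp only [mem_permWord, Bool.not_eq_true', decide_eq_false_iff_not]
    constructor
    · rintro ⟨b, hb, rfl⟩; omega
    · intro h; exact ⟨a - k, by omega, by omega⟩

end permWord

/-! ### The morphism that splits words at a threshold letter -/

instance : FiniteFactorization (Word × Word) where
  finite_factors m := by
    refine Set.Finite.subset (s := (fun p : (Word × Word) × (Word × Word) =>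
      ((p.1.1, p.2.1), (p.1.2, p.2.2))) '' ({p | p.1 * p.2 = m.1} ×ˢ {p | p.1 * p.2 = m.2}))
      (((FiniteFactorization.finite_factors m.1).prod
        (FiniteFactorization.finite_factors m.2)).image _) ?_
    rintro ⟨⟨a, b⟩, ⟨c, d⟩⟩ rfl
    exact ⟨((a, c), (b, d)), ⟨rfl, rfl⟩, rfl⟩

/-- The subword on the letters less than `N`, and the subword on the other letters, from which
`N` is subtracted. -/
def splitHom (N : ℕ) : Word →* Word × Word :=
  FreeMonoid.lift fun a => if a < N then (.of a, 1) else (1, .of (a - N))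

theorem splitHom_apply (N : ℕ) (l : List ℕ) : splitHom N (.ofList l) =
    (.ofList (l.filter (· < N)), .ofList ((l.filter fun a => !decide (a < N)).map (· - N))) := by
  induction l with
  | nil => rfl
  | cons a l ih =>
    rw [FreeMonoid.ofList_cons, map_mul, ih, splitHom, FreeMonoid.lift_eval_of]
    by_cases h : a < N
    · simp [h, FreeMonoid.ofList_cons]
    · simp [h, FreeMonoid.ofList_cons]

theorem perm_of_splitHom (N : ℕ) {w u v : Word} (h : splitHom N w = (u, v)) :
    w.toList.Perm (u.toList ++ v.toList.map (· + N)) := by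
  have h1 := splitHom_apply N w.toList
  rw [FreeMonoid.ofList_toList, h, Prod.mk.injEq] at h1
  rw [h1.1, h1.2, FreeMonoid.toList_ofList, FreeMonoid.toList_ofList, List.map_map]
  have h2 : ((w.toList.filter fun a => !decide (a < N)).map ((· + N) ∘ (· - N))) =
      w.toList.filter fun a => !decide (a < N) := by
    refine (List.map_congr_left fun a ha => ?_).trans (List.map_id _)
    have := (List.mem_filter.1 ha).2
    simp only [Bool.not_eq_true', decide_eq_false_iff_not, not_lt] at this
    exact Nat.sub_add_cancel this
  rw [h2]
  exact (List.filter_append_perm _ _).symm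

theorem finite_splitHom (N : ℕ) (p : Word × Word) : (splitHom N ⁻¹' {p}).Finite := by
  refine (finite_same_letters (.ofList (p.1.toList ++ p.2.toList.map (· + N)))).subset
    fun w hw => ?_
  rw [Set.mem_ofPred_eq, letters_apply, letters_apply]
  exact congrArg _ (Multiset.coe_eq_coe.2 (perm_of_splitHom N hw))

/-- Here `k` is the number of letters of `w` below `N`. By `lt_iff_of_sameStd` they stand where the
word `σ⁻¹` has its letters below `k`, so the two subwords standardize as the corresponding subwords
of `σ⁻¹`. -/
theorem stdSigma_of_splitHom {n : ℕ} (σ : Equiv.Perm (Fin n)) {N : ℕ} {u v w : Word}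
    (hw : splitHom N w = (u, v)) (h : stdSigma w.toList = ⟨n, σ⁻¹⟩) :
    ∃ k : Fin (n + 1), stdSigma u.toList = ⟨k, (prefixStd σ k)⁻¹⟩ ∧
      stdSigma v.toList = ⟨n - k, (suffixStd σ k)⁻¹⟩ := by
  obtain ⟨L, hL1, hL2, hL⟩ := sameStd_iff.2 (h.trans (stdSigma_permWord _).symm)
  have h1 := splitHom_apply N w.toList
  rw [FreeMonoid.ofList_toList, hw, Prod.mk.injEq, ← hL1] at h1
  obtain ⟨rfl, rfl⟩ := h1
  have hk : (L.filter (·.1 < N)).length ≤ n := by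
    have := List.length_filter_le (·.1 < N) L
    rwa [← List.length_map (f := Prod.snd) (as := L), hL2, length_permWord] at this
  have hiff : ∀ a ∈ L, a.1 < N ↔ a.2 < (L.filter (·.1 < N)).length := fun a ha =>
    lt_iff_of_sameStd N hL (hL2 ▸ nodup_permWord _) (fun b => by rw [hL2, mem_permWord]) ha
  obtain ⟨k, hk⟩ : ∃ k : Fin (n + 1), (k : ℕ) = (L.filter (·.1 < N)).length :=
    ⟨⟨_, Nat.lt_succ_of_le hk⟩, rfl⟩
  rw [← hk] at hiff
  refine ⟨k, ?_, ?_⟩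
  · rw [FreeMonoid.toList_ofList, ← stdSigma_permWord, ← sameStd_iff, permWord_prefixStd_inv,
      ← hL2, List.filter_map, List.filter_map]
    refine ⟨L.filter (·.1 < N), rfl, ?_, hL.sublist List.filter_sublist⟩
    congr 1
    exact List.filter_congr fun a ha => by simp [hiff a ha]
  · have hsuf : permWord (suffixStd σ k)⁻¹ =
        ((permWord σ⁻¹).filter fun a => !decide (a < (k : ℕ))).map (· - (k : ℕ)) := by
      rw [← permWord_suffixStd_inv, List.map_map]
      refine ((List.map_congr_left fun a _ => ?_).trans (List.map_id _)).symm
      exact Nat.add_sub_cancel_left _ _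
    rw [FreeMonoid.toList_ofList, ← stdSigma_permWord, ← sameStd_iff, hsuf, ← hL2,
      List.filter_map, List.filter_map, List.map_map, List.map_map]
    refine ⟨(L.filter fun a => !decide (a.1 < N)).map fun a => (a.1 - N, a.2 - (k : ℕ)), ?_, ?_, ?_⟩
    · rw [List.map_map]; rfl
    · rw [List.map_map]
      congr 1
      exact List.filter_congr fun a ha => by simp [← hiff a ha]
    · refine List.pairwise_map.2 ((hL.sublist List.filter_sublist).imp_of_mem ?_)
      intro a b ha hb hab
      obtain ⟨ha, haN⟩ := List.mem_filter.1 ha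
      obtain ⟨hb, hbN⟩ := List.mem_filter.1 hb
      have h1 := hiff a ha
      have h2 := hiff b hb
      simp only [Bool.not_eq_true', decide_eq_false_iff_not] at haN hbN
      simp only
      omega

/-- The word `w` interleaves `u` with `v` shifted by `N`, following the places of the letters below
`k` in `σ⁻¹`. The bound on the letters of `u` ensures that splitting at `N` recovers `u` and `v`. -/
theorem exists_splitHom {n : ℕ} (σ : Equiv.Perm (Fin n)) {N : ℕ} {u v : Word}
    (hu : ∀ a ∈ u.toList, a < N) (k : Fin (n + 1))
    (h1 : stdSigma u.toList = ⟨k, (prefixStd σ k)⁻¹⟩)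
    (h2 : stdSigma v.toList = ⟨n - k, (suffixStd σ k)⁻¹⟩) :
    ∃ w, splitHom N w = (u, v) ∧ stdSigma w.toList = ⟨n, σ⁻¹⟩ := by
  rw [← stdSigma_permWord, ← sameStd_iff, permWord_prefixStd_inv] at h1
  rw [← stdSigma_permWord, ← sameStd_iff] at h2
  obtain ⟨L₁, hu', hL₁, hp₁⟩ := h1
  obtain ⟨L₂, hv', hL₂, hp₂⟩ := h2
  obtain ⟨L, hL, hf₁, hf₂⟩ := exists_merge Prod.snd (fun a => decide (a < (k : ℕ))) (permWord σ⁻¹)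
    L₁ (L₂.map fun a => (a.1 + N, (k : ℕ) + a.2)) hL₁ (by
      rw [← permWord_suffixStd_inv, ← hL₂, List.map_map, List.map_map]; rfl)
  have hN : ∀ a ∈ L, a.1 < N ↔ a.2 < (k : ℕ) := by
    intro a ha
    by_cases hk : a.2 < (k : ℕ)
    · refine iff_of_true (hu _ ?_) hk
      rw [← hu', ← hf₁]
      exact List.mem_map_of_mem (List.mem_filter.2 ⟨ha, by simpa using hk⟩)
    · refine iff_of_false ?_ hk
      have : a ∈ L₂.map fun a => (a.1 + N, (k : ℕ) + a.2) := by
        rw [← hf₂]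
        exact List.mem_filter.2 ⟨ha, by simpa using hk⟩
      obtain ⟨b, _, rfl⟩ := List.mem_map.1 this
      simp
  have hfst : (L.filter fun a => decide (a.1 < N)) = L₁ := by
    rw [← hf₁]
    exact List.filter_congr fun a ha => by simp [hN a ha]
  have hsnd : (L.filter fun a => !decide (a.1 < N)) =
      L₂.map fun a => (a.1 + N, (k : ℕ) + a.2) := by
    rw [← hf₂]
    exact List.filter_congr fun a ha => by simp [hN a ha]
  refine ⟨.ofList (L.map Prod.fst), ?_, ?_⟩
  · rw [splitHom_apply, List.filter_map, List.filter_map]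
    change (FreeMonoid.ofList ((L.filter fun a => decide (a.1 < N)).map Prod.fst),
      FreeMonoid.ofList (((L.filter fun a => !decide (a.1 < N)).map Prod.fst).map (· - N))) = _
    rw [hfst, hsnd, hu', List.map_map, List.map_map, ← FreeMonoid.ofList_toList v, ← hv']
    refine Prod.ext rfl (congrArg FreeMonoid.ofList (List.map_congr_left fun a _ => ?_))
    exact Nat.add_sub_cancel _ _
  · rw [FreeMonoid.toList_ofList, ← stdSigma_permWord, ← sameStd_iff]
    refine ⟨L, rfl, hL, pairwise_of_filter (fun a => decide (a.2 < (k : ℕ))) L ?_ ?_ ?_⟩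
    · rw [hf₁]; exact hp₁
    · rw [hf₂, List.pairwise_map]
      exact hp₂.imp fun {a b} h => by simpa using h
    · intro a ha hpa b hb hpb
      have h1 := hN a ha
      have h2 := hN b hb
      simp only [decide_eq_true_eq] at hpa hpb
      constructor <;> omega

/-! ### `FQSym` is a Hopf algebra -/

/-- The coproduct of `FQSym` is obtained by splitting words along the order of the alphabet. -/
theorem tensorForm_evalWord_comulF {N : ℕ} {u : Word} (hu : ∀ a ∈ u.toList, a < N) (v : Word)
    (f : FQSym) : tensorForm (evalWord u) (evalWord v) (comulF f) =
      Series.pushforward (splitHom N) (finite_splitHom N) f (u, v) := by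
  let ψ : FQSym →ₗ[ℂ] ℂ :=
    { toFun := fun f => Series.pushforward (splitHom N) (finite_splitHom N) f (u, v)
      map_add' := fun f g => by
        rw [Subalgebra.coe_add, map_add]; rfl
      map_smul' := fun c f => by
        rw [Subalgebra.coe_smul, map_smul]; rfl }
  have : tensorForm (evalWord u) (evalWord v) ∘ₗ comulF = ψ := by
    refine FQSym_hom_ext fun n σ => ?_
    classical
    rw [LinearMap.comp_apply, comulF_FElt, map_sum]
    change ∑ k : Fin (n + 1), F (prefixStd σ k) u * F (suffixStd σ k) v =
      ∑ w ∈ (finite_splitHom N (u, v)).toFinset, F σ w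
    simp only [F_apply]
    -- Both sums have at most one nonzero term: the length of `u` determines `k`, while the
    -- standardization and the letters determine `w`.
    by_cases h : ∃ w, splitHom N w = (u, v) ∧ stdSigma w.toList = ⟨n, σ⁻¹⟩
    · obtain ⟨w, hw, hs⟩ := h
      obtain ⟨k, h1, h2⟩ := stdSigma_of_splitHom σ hw hs
      rw [Finset.sum_eq_single k, Finset.sum_eq_single w, if_pos h1, if_pos h2, if_pos hs, mul_one]
      · intro w' hw' hne
        refine if_neg fun hs' => hne ?_
        have hw' : splitHom N w' = (u, v) := by simpa using hw'
        exact FreeMonoid.toList.injective ((sameStd_iff.2 (hs'.trans hs.symm)).eq_of_perm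
          ((perm_of_splitHom N hw').trans (perm_of_splitHom N hw).symm))
      · intro h'
        exact absurd (by simpa using hw) h'
      · intro k' _ hne
        rw [if_neg, zero_mul]
        intro h'
        exact hne (Fin.ext (congrArg Sigma.fst (h'.symm.trans h1)))
      · exact fun h => absurd (Finset.mem_univ _) h
    · rw [Finset.sum_eq_zero, Finset.sum_eq_zero]
      · intro w hw
        exact if_neg fun hs => h ⟨w, by simpa using hw, hs⟩
      · intro k _
        by_cases h1 : stdSigma u.toList = ⟨k, (prefixStd σ k)⁻¹⟩
        · rw [if_neg fun h2 => h (exists_splitHom σ hu k h1 h2), mul_zero]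
        · rw [if_neg h1, zero_mul]
  exact LinearMap.congr_fun this f

theorem tensorForm_evalWord_mul (u v : Word) (s t : FQSym ⊗[ℂ] FQSym) :
    tensorForm (evalWord u) (evalWord v) (s * t) = ∑ p ∈ Series.factors (u, v),
      tensorForm (evalWord p.1.1) (evalWord p.1.2) s *
        tensorForm (evalWord p.2.1) (evalWord p.2.2) t := by
  induction s with
  | zero => simp
  | add x y hx hy => rw [add_mul, map_add, hx, hy, ← Finset.sum_add_distrib]; simp [add_mul]
  | tmul a b =>
    induction t with
    | zero => simp
    | add x y hx hy => rw [mul_add, map_add, hx, hy, ← Finset.sum_add_distrib]; simp [mul_add]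
    | tmul c d =>
      rw [Algebra.TensorProduct.tmul_mul_tmul, tensorForm_tmul]
      change ((a : Series Word) * (c : Series Word)) u * ((b : Series Word) * (d : Series Word)) v = _
      rw [Series.mul_apply, Series.mul_apply, Finset.sum_mul_sum, ← Finset.sum_product']
      refine Finset.sum_bij' (i := fun x _ => ((x.1.1, x.2.1), (x.1.2, x.2.2)))
        (j := fun x _ => ((x.1.1, x.2.1), (x.1.2, x.2.2))) ?_ ?_ (fun _ _ => rfl) (fun _ _ => rfl) ?_
      · rintro ⟨⟨a, b⟩, ⟨c, d⟩⟩ h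
        simpa [Prod.ext_iff] using h
      · rintro ⟨⟨a, b⟩, ⟨c, d⟩⟩ h
        simpa [Prod.ext_iff] using h
      · rintro ⟨⟨x, y⟩, ⟨z, w⟩⟩ _
        simp only [tensorForm_tmul, evalWord_apply]
        ring

theorem exists_gt_letters (u : Word) : ∃ N, ∀ a ∈ u.toList, a < N :=
  ⟨u.toList.sum + 1, fun _ ha => Nat.lt_succ_of_le (List.le_sum_of_mem ha)⟩

/-- Once `N` exceeds the letters of `u`, the coefficient of `u ⊗ v` is read on the pushforward along
a morphism of monoids, which is multiplicative. The same `N` serves for all the factors of `u`. -/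
theorem comulF_mul (f g : FQSym) : comulF (f * g) = comulF f * comulF g := by
  refine (separates_evalWord.tensorForm separates_evalWord).eq fun ⟨u, v⟩ => ?_
  obtain ⟨N, hN⟩ := exists_gt_letters u
  rw [tensorForm_evalWord_mul, tensorForm_evalWord_comulF hN, Subalgebra.coe_mul, map_mul,
    Series.mul_apply]
  refine Finset.sum_congr rfl ?_
  rintro ⟨⟨a, b⟩, ⟨c, d⟩⟩ h
  have hac : a * c = u := congrArg Prod.fst (Series.mem_factors.1 h)
  rw [← hac, FreeMonoid.toList_mul] at hN
  rw [tensorForm_evalWord_comulF (fun x hx => hN x (by simp [hx])),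
    tensorForm_evalWord_comulF (fun x hx => hN x (by simp [hx]))]

theorem comulF_one : comulF 1 = 1 := by
  refine (separates_evalWord.tensorForm separates_evalWord).eq fun ⟨u, v⟩ => ?_
  obtain ⟨N, hN⟩ := exists_gt_letters u
  rw [tensorForm_evalWord_comulF hN, Subalgebra.coe_one, map_one,
    Algebra.TensorProduct.one_def, tensorForm_tmul]
  change _ = (1 : Series Word) u * (1 : Series Word) v
  classical
  simp only [Series.one_def, Series.ofSet_apply, Set.mem_singleton_iff, Prod.ext_iff, Prod.fst_one,
    Prod.snd_one]
  by_cases h1 : u = 1 <;> by_cases h2 : v = 1 <;> simp [h1, h2]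

theorem isHopf_FQSym : IsHopf FQSym := by
  have h1 : CoalgebraStruct.counit (R := ℂ) (1 : FQSym) = 1 := by
    change (1 : Series Word) 1 = 1
    classical
    rw [Series.one_def, Series.ofSet_apply, if_pos (Set.mem_singleton _)]
  refine ⟨h1, fun f g => ?_, comulF_one, comulF_mul, isConnectedGrading_degF.exists_antipode h1⟩
  refine (Series.mul_apply_ofList _ _ []).trans ?_
  rw [List.length_nil, Fin.sum_univ_one]
  rfl

/-! ### `PBT` is a Hopf subalgebra of `FQSym` -/

/-- The element `G_σ` of `FQSym`. -/
def GElt {n : ℕ} (σ : Equiv.Perm (Fin n)) : FQSym := FElt σ⁻¹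

theorem FElt_eq_GElt {n : ℕ} (σ : Equiv.Perm (Fin n)) : FElt σ = GElt σ⁻¹ := by
  rw [GElt, inv_inv]

theorem separates_form_GElt :
    Separates fun s : Σ n, Equiv.Perm (Fin n) => form (GElt s.2) := fun v h =>
  separates_evalPerm v fun s => by
    have : form (GElt s.2⁻¹) v = 0 := h ⟨s.1, s.2⁻¹⟩
    rwa [← FElt_eq_GElt, form_FElt] at this

/-- The element `P_T` of `PBT`. -/
def PElt (T : BinaryTree Unit) : PBT := ⟨P T, Submodule.subset_span ⟨T, rfl⟩⟩

/-- The inclusion of `PBT` in `FQSym`. -/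
def inclPBT : PBT →ₐ[ℂ] FQSym := Subalgebra.inclusion PBT_le_FQSym

theorem inclPBT_PElt (T : BinaryTree Unit) : inclPBT (PElt T) =
    ∑ σ : Equiv.Perm (Fin T.numNodes) with permTree σ = T, FElt σ := by
  refine Subtype.ext ?_
  rw [AddSubmonoidClass.coe_finsetSum]
  rfl

theorem sigma_eq_of_inv_eq {s t : Σ n, Equiv.Perm (Fin n)}
    (h : (⟨s.1, s.2⁻¹⟩ : Σ n, Equiv.Perm (Fin n)) = ⟨t.1, t.2⁻¹⟩) : s = t :=
  (Function.Involutive.injective sigmaInv_sigmaInv) h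

/-- `P_T` is the sum of the `F_τ` with tree `T`, and `⟨G_σ, F_τ⟩` is `1` or `0` according as `σ = τ`
or not. In particular the `G_{w_T}` are dual to the `P_T`. -/
theorem form_GElt_PElt {n : ℕ} (σ : Equiv.Perm (Fin n)) (T : BinaryTree Unit) :
    form (GElt σ) (inclPBT (PElt T)) = if permTree σ = T then 1 else 0 := by
  rw [inclPBT_PElt, map_sum, GElt, form_FElt]
  simp only [evalPerm_FElt]
  split_ifs with h
  · obtain rfl : n = T.numNodes := by rw [← h, numNodes_permTree]
    rw [Finset.sum_eq_single σ, if_pos rfl]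
    · intro τ _ hne
      refine if_neg fun h => hne ?_
      have := sigma_eq_of_inv_eq (s := ⟨_, σ⟩) (t := ⟨_, τ⟩) h
      rw [Sigma.mk.injEq, heq_eq_eq] at this
      exact this.2.symm
    · exact fun h' => (h' (by simpa using h)).elim
  · refine Finset.sum_eq_zero fun τ hτ => if_neg fun h' => h ?_
    have h1 := sigma_eq_of_inv_eq (s := ⟨_, σ⟩) (t := ⟨_, τ⟩) h'
    rw [← (Finset.mem_filter.1 hτ).2]
    exact congrArg (fun s : Σ n, Equiv.Perm (Fin n) => permTree s.2) h1

theorem PBT_hom_ext {M : Type*} [AddCommGroup M] [Module ℂ M] {f g : PBT →ₗ[ℂ] M}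
    (h : ∀ T, f (PElt T) = g (PElt T)) : f = g := by
  refine LinearMap.ext fun ⟨x, hx⟩ => ?_
  induction hx using Submodule.span_induction with
  | mem x hx => obtain ⟨T, rfl⟩ := hx; exact h T
  | zero => exact (map_zero f).trans (map_zero g).symm
  | add x y hx hy h1 h2 =>
    exact (map_add f ⟨x, hx⟩ ⟨y, hy⟩).trans ((congrArg₂ _ h1 h2).trans (map_add g ⟨x, hx⟩ ⟨y, hy⟩).symm)
  | smul c x hx h1 =>
    exact (map_smul f c ⟨x, hx⟩).trans ((congrArg _ h1).trans (map_smul g c ⟨x, hx⟩).symm)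

/-- The basis of the `P_T`. -/
def basisP : Module.Basis (BinaryTree Unit) ℂ PBT :=
  Module.Basis.mk (v := PElt)
    (linearIndependent_of_forms _ (fun T => form (GElt (treePerm T)) ∘ₗ inclPBT.toLinearMap)
      fun T T' => by
        refine (form_GElt_PElt (treePerm T) T').trans (if_congr ?_ rfl rfl)
        rw [permTree_treePerm])
    (by
      rintro ⟨f, hf⟩ -
      induction hf using Submodule.span_induction with
      | mem x hx =>
        obtain ⟨T, rfl⟩ := hx
        exact Submodule.subset_span ⟨T, rfl⟩
      | zero => exact Submodule.zero_mem _
      | add x y hx hy h1 h2 => exact Submodule.add_mem _ h1 h2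
      | smul c x hx h1 => exact Submodule.smul_mem _ c h1)

theorem basisP_apply (T : BinaryTree Unit) : basisP T = PElt T := by
  rw [basisP, Module.Basis.mk_apply]

/-- Both sides are linear in `f`, and on `G_σ` both test whether `𝒫(σ)` is the tree of `c`. This is
the bridge between the sylvester quotient and the form. -/
theorem sylvProj_eq_form (f : FQSym) (c : Sylv) :
    sylvProj f c = form f (inclPBT (PElt (sylvTree c))) := by
  let ψ : FQSym →ₗ[ℂ] ℂ :=
    { toFun := fun f => sylvProj f c
      map_add' := fun f g => by rw [Subalgebra.coe_add, map_add]; rfl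
      map_smul' := fun a f => by rw [Subalgebra.coe_smul, map_smul]; rfl }
  have : ψ = form.flip (inclPBT (PElt (sylvTree c))) := by
    refine FQSym_hom_ext fun n σ => ?_
    rw [LinearMap.flip_apply, FElt_eq_GElt, form_GElt_PElt]
    change sylvProj (G σ⁻¹) c = _
    rw [sylvProj_G_apply]
    exact if_congr eq_comm rfl rfl
  exact LinearMap.congr_fun this f

/-- In other words, the kernel of `π` on `FQSym` is the orthogonal of `PBT`: every `T` is the tree
of some class, namely that of `w_T`. -/
theorem sylvProj_eq_iff {f g : FQSym} : sylvProj f = sylvProj g ↔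
    form f ∘ₗ inclPBT.toLinearMap = form g ∘ₗ inclPBT.toLinearMap := by
  constructor
  · intro h
    refine PBT_hom_ext fun T => ?_
    have h1 := congrArg (fun f : Series Sylv => f (sylvCon.mk' (.ofList (treeWord T)))) h
    simp only [sylvProj_eq_form, sylvTree_treeWord] at h1
    exact h1
  · intro h
    ext c
    rw [sylvProj_eq_form, sylvProj_eq_form]
    exact LinearMap.congr_fun h _

theorem sylvProj_GElt {n : ℕ} (σ : Equiv.Perm (Fin n)) :
    sylvProj (GElt (treePerm (permTree σ))) = sylvProj (GElt σ) := by
  ext c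
  change sylvProj (G _) c = sylvProj (G _) c
  rw [sylvProj_G_apply, sylvProj_G_apply, permTree_treePerm]

/-! ### `PBT` as a retract, and its coproduct -/

/-- The linear projection of `FQSym` onto `PBT` that maps `F_σ` to `P_T` if `σ = w_T`, and to
`0` if `σ` is not of the form `w_T`. -/
def retractPBT : FQSym →ₗ[ℂ] PBT := basisF.constr ℂ fun s =>
  if (⟨_, treePerm (permTree s.2)⟩ : Σ n, Equiv.Perm (Fin n)) = s then PElt (permTree s.2) else 0

theorem retractPBT_FElt {n : ℕ} (σ : Equiv.Perm (Fin n)) : retractPBT (FElt σ) =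
    if (⟨_, treePerm (permTree σ)⟩ : Σ n, Equiv.Perm (Fin n)) = ⟨n, σ⟩ then PElt (permTree σ)
      else 0 := by
  rw [← basisF_apply ⟨n, σ⟩, retractPBT, Module.Basis.constr_basis]

theorem retractPBT_inclPBT (x : PBT) : retractPBT (inclPBT x) = x := by
  have : retractPBT ∘ₗ inclPBT.toLinearMap = LinearMap.id := by
    refine PBT_hom_ext fun T => ?_
    rw [LinearMap.comp_apply, AlgHom.toLinearMap_apply, inclPBT_PElt, map_sum,
      Finset.sum_eq_single (treePerm T)]
    · rw [retractPBT_FElt, permTree_treePerm, if_pos rfl, LinearMap.id_apply]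
    · intro σ hσ hne
      rw [retractPBT_FElt, (Finset.mem_filter.1 hσ).2, if_neg]
      intro h
      rw [Sigma.mk.injEq, heq_eq_eq] at h
      exact hne h.2.symm
    · exact fun h => (h (by simpa using permTree_treePerm T)).elim
  exact LinearMap.congr_fun this x

/-- The adjoint of the projection onto `PBT` replaces `G_σ` with `G_{w_T}` for `T = 𝒫(σ)`, which has
the same image under `π`. -/
theorem form_GElt_retractPBT {n : ℕ} (σ : Equiv.Perm (Fin n)) :
    form (GElt σ) ∘ₗ inclPBT.toLinearMap ∘ₗ retractPBT = form (GElt (treePerm (permTree σ))) := by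
  refine FQSym_hom_ext fun m τ => ?_
  rw [LinearMap.comp_apply, LinearMap.comp_apply, retractPBT_FElt]
  have h1 : form (GElt (treePerm (permTree σ))) (FElt τ) =
      if (⟨_, treePerm (permTree σ)⟩ : Σ n, Equiv.Perm (Fin n)) = ⟨m, τ⟩ then 1 else 0 := by
    rw [GElt, form_FElt, evalPerm_FElt]
    exact if_congr ⟨fun h => sigma_eq_of_inv_eq (s := ⟨_, treePerm (permTree σ)⟩) (t := ⟨m, τ⟩) h,
      congrArg sigmaInv⟩ rfl rfl
  rw [h1]
  by_cases h : permTree σ = permTree τ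
  · rw [h]
    split_ifs
    · rw [AlgHom.toLinearMap_apply, form_GElt_PElt, if_pos h]
    · rw [map_zero, map_zero]
  · rw [if_neg (c := _ = (⟨m, τ⟩ : Σ n, Equiv.Perm (Fin n))) (t := (1 : ℂ))]
    · split_ifs
      · rw [AlgHom.toLinearMap_apply, form_GElt_PElt, if_neg h]
      · rw [map_zero, map_zero]
    · intro h'
      refine h ?_
      have := congrArg (fun s : Σ n, Equiv.Perm (Fin n) => permTree s.2) h'
      simpa [permTree_treePerm] using this

/-- The coproduct of `PBT`. -/
def comulP : PBT →ₗ[ℂ] PBT ⊗[ℂ] PBT :=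
  TensorProduct.map retractPBT retractPBT ∘ₗ comulF ∘ₗ inclPBT.toLinearMap

/-- This says that the coproduct maps `PBT` into `PBT ⊗ PBT`. Paired with `G_σ ⊗ G_τ`, it compares
`⟨G_σ G_τ, x⟩` with the same expression where `σ` and `τ` are replaced by the permutations of their
trees. As `π` is multiplicative, the two products have the same image under `π`, hence the same
pairing with `PBT`. -/
theorem map_inclPBT_comulP : TensorProduct.map inclPBT.toLinearMap inclPBT.toLinearMap ∘ₗ comulP =
    CoalgebraStruct.comul ∘ₗ inclPBT.toLinearMap := by
  refine LinearMap.ext fun x => (separates_form_GElt.tensorForm separates_form_GElt).eq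
    fun ⟨⟨m, σ⟩, ⟨n, τ⟩⟩ => ?_
  simp only [LinearMap.comp_apply, comulP, tensorForm_map, LinearMap.comp_assoc]
  rw [form_GElt_retractPBT, form_GElt_retractPBT]
  change (tensorForm _ _ ∘ₗ comulF) _ = (tensorForm _ _ ∘ₗ comulF) _
  rw [tensorForm_comulF, tensorForm_comulF]
  refine LinearMap.congr_fun (sylvProj_eq_iff.1 ?_) x
  rw [Subalgebra.coe_mul, Subalgebra.coe_mul, map_mul, map_mul, sylvProj_GElt, sylvProj_GElt]

instance coalgebraP : Coalgebra ℂ PBT :=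
  coalgebraOfRetract inclPBT.toLinearMap retractPBT comulP retractPBT_inclPBT map_inclPBT_comulP

theorem comul_inclPBT (x : PBT) : CoalgebraStruct.comul (R := ℂ) (inclPBT x) =
    TensorProduct.map inclPBT.toLinearMap inclPBT.toLinearMap (CoalgebraStruct.comul (R := ℂ) x) :=
  (LinearMap.congr_fun map_inclPBT_comulP x).symm

theorem counit_inclPBT (x : PBT) :
    CoalgebraStruct.counit (R := ℂ) (inclPBT x) = CoalgebraStruct.counit (R := ℂ) x := rfl

/-- The span of the `P_T` with `T` of size `n`. -/
def degP (n : ℕ) : Submodule ℂ PBT := Submodule.span ℂ (PElt '' {T | T.numNodes = n})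

theorem retractPBT_mem_degP {n : ℕ} {x : FQSym} (hx : x ∈ degF n) : retractPBT x ∈ degP n := by
  have : degF n ≤ (degP n).comap retractPBT := by
    refine Submodule.span_le.2 ?_
    rintro _ ⟨σ, rfl⟩
    change retractPBT (FElt σ) ∈ degP n
    rw [retractPBT_FElt]
    split_ifs
    · exact Submodule.subset_span ⟨_, numNodes_permTree σ, rfl⟩
    · exact Submodule.zero_mem _
  exact this hx

theorem isConnectedGrading_degP : IsConnectedGrading degP where
  iSup_eq_top := by
    rw [eq_top_iff, ← basisP.span_eq, Submodule.span_le]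
    rintro _ ⟨T, rfl⟩
    rw [basisP_apply]
    exact Submodule.mem_iSup_of_mem T.numNodes (Submodule.subset_span ⟨T, rfl, rfl⟩)
  zero_le := by
    refine Submodule.span_le.2 ?_
    rintro _ ⟨T, hT, rfl⟩
    obtain rfl : T = .nil := by
      cases T with
      | nil => rfl
      | node a l r => simp [BinaryTree.numNodes] at hT
    rw [show PElt .nil = 1 from Subtype.ext P_nil]
    exact Submodule.mem_span_singleton_self _
  comul_mem n a ha := by
    have hle : degP n ≤ (degF n).comap inclPBT.toLinearMap := by
      refine Submodule.span_le.2 ?_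
      rintro _ ⟨T, rfl, rfl⟩
      change inclPBT (PElt T) ∈ degF _
      rw [inclPBT_PElt]
      exact Submodule.sum_mem _ fun σ _ => FElt_mem_degF σ
    have hle' : tensorDeg degF n ≤ (tensorDeg degP n).comap
        (TensorProduct.map retractPBT retractPBT) := by
      refine tensorDeg_le fun i j hij a ha b hb => ?_
      rw [Submodule.mem_comap, TensorProduct.map_tmul]
      exact tmul_mem_tensorDeg hij (retractPBT_mem_degP ha) (retractPBT_mem_degP hb)
    exact hle' (isConnectedGrading_degF.comul_mem n _ (hle ha))

theorem isHopf_PBT : IsHopf PBT :=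
  isHopf_FQSym.of_injective isConnectedGrading_degP inclPBT
    (Function.LeftInverse.injective (g := TensorProduct.map retractPBT retractPBT) fun t => by
      rw [← LinearMap.comp_apply, ← TensorProduct.map_comp,
        show retractPBT ∘ₗ inclPBT.toLinearMap = LinearMap.id from
          LinearMap.ext retractPBT_inclPBT, TensorProduct.map_id]
      rfl)
    counit_inclPBT comul_inclPBT

/-- The inclusion of `PBT` in `FQSym`, as a morphism of bialgebras. -/
def bialgInclPBT : PBT →ₐc[ℂ] FQSym where
  toLinearMap := inclPBT.toLinearMap
  counit_comp := LinearMap.ext counit_inclPBT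
  map_comp_comul := map_inclPBT_comulP
  map_one' := map_one inclPBT
  map_mul' := map_mul inclPBT

/-! ### The graded dual of `PBT` -/

section
variable {k A B C : Type*} [CommSemiring k] [Semiring A] [Algebra k A] [Semiring B] [Algebra k B]
  [Semiring C] [Algebra k C] (f : A →ₐ[k] B) (g : A →ₐ[k] C)

/-- Two quotients of an algebra by the same congruence are isomorphic. -/
def algEquivOfSurjective (hf : Function.Surjective f) (hg : Function.Surjective g)
    (h : ∀ x y, f x = f y ↔ g x = g y) : B ≃ₐ[k] C :=
  have hs : ∀ b, f (Function.surjInv hf b) = b := Function.surjInv_eq hf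
  have hs' : ∀ a, g (Function.surjInv hf (f a)) = g a := fun a => (h _ _).1 (hs _)
  AlgEquiv.ofBijective
    { toFun := fun b => g (Function.surjInv hf b)
      map_one' := by rw [← map_one f, hs', map_one]
      map_mul' := fun b c => by
        rw [← map_mul, ← h, hs, map_mul, hs, hs]
      map_zero' := by rw [← map_zero f, hs', map_zero]
      map_add' := fun b c => by
        rw [← map_add, ← h, hs, map_add, hs, hs]
      commutes' := fun r => by rw [← AlgHom.commutes f, hs', AlgHom.commutes] }
    ⟨fun b c hbc => by
      have := (h _ _).2 hbc
      rwa [hs, hs] at this, fun c => by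
      obtain ⟨a, rfl⟩ := hg c
      exact ⟨f a, hs' a⟩⟩

theorem algEquivOfSurjective_apply (hf : Function.Surjective f) (hg : Function.Surjective g)
    (h : ∀ x y, f x = f y ↔ g x = g y) (a : A) : algEquivOfSurjective f g hf hg h (f a) = g a :=
  (h _ _).1 (Function.surjInv_eq hf _)

end

/-- The linear form `⟨f, ·⟩` on `PBT` defined by an element `f` of `FQSym`. -/
def dualForm : FQSym →ₐ[ℂ] WithConv (PBT →ₗ[ℂ] ℂ) :=
  AlgHom.ofLinearMap
    { toFun := fun f => WithConv.toConv (form f ∘ₗ inclPBT.toLinearMap)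
      map_add' := fun f g => by rw [map_add, LinearMap.add_comp]; rfl
      map_smul' := fun c f => by rw [map_smul, LinearMap.smul_comp]; rfl }
    (by
      change WithConv.toConv (form 1 ∘ₗ inclPBT.toLinearMap) = _
      rw [form_one]; rfl)
    (fun f g => by
      change WithConv.toConv (form (f * g) ∘ₗ inclPBT.toLinearMap) = _
      rw [← tensorForm_comulF, LinearMap.comp_assoc]
      change WithConv.toConv (_ ∘ₗ CoalgebraStruct.comul ∘ₗ inclPBT.toLinearMap) = _
      rw [← map_inclPBT_comulP]
      refine congrArg WithConv.toConv (LinearMap.ext fun x => ?_)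
      exact tensorForm_map _ _ _ _ _)

/-- The graded dual algebra of `PBT`. -/
def dualPBT : Subalgebra ℂ (WithConv (PBT →ₗ[ℂ] ℂ)) := dualForm.range

/-- The morphism from `FQSym` to the graded dual of `PBT`. -/
def toDual : FQSym →ₐ[ℂ] dualPBT := dualForm.rangeRestrict

theorem toDual_surjective : Function.Surjective toDual := dualForm.rangeRestrict_surjective

/-- The canonical projection from `FQSym` to its image. -/
def toSylv : FQSym →ₐ[ℂ] sylvImage :=
  (sylvProj.comp FQSym.val).codRestrict sylvImage fun f => sylvProj_mem f.2

theorem toSylv_coe (f : FQSym) : (toSylv f : Series Sylv) = sylvProj f := rfl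

theorem toSylv_surjective : Function.Surjective toSylv := by
  rintro ⟨_, f, hf, rfl⟩
  exact ⟨⟨f, hf⟩, rfl⟩

theorem toDual_eq_iff (f g : FQSym) : toDual f = toDual g ↔ toSylv f = toSylv g := by
  rw [Subtype.ext_iff, Subtype.ext_iff, toSylv_coe, toSylv_coe, sylvProj_eq_iff]
  exact (WithConv.equiv _).injective.eq_iff.symm

/-- The isomorphism of algebras from the graded dual of `PBT` to the image of `FQSym`. -/
def dualEquiv : dualPBT ≃ₐ[ℂ] sylvImage :=
  algEquivOfSurjective toDual toSylv toDual_surjective toSylv_surjective toDual_eq_iff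

theorem dualEquiv_toDual (f : FQSym) : dualEquiv (toDual f) = toSylv f :=
  algEquivOfSurjective_apply _ _ _ _ _ f

/-! ### Coproducts on the dual of `PBT` and on the image of `π` -/

/-- The evaluation of linear forms at an element of `PBT`. -/
def evalDual (x : PBT) : dualPBT →ₗ[ℂ] ℂ where
  toFun φ := (φ : WithConv (PBT →ₗ[ℂ] ℂ)) x
  map_add' _ _ := rfl
  map_smul' _ _ := rfl

theorem separates_evalDual : Separates (k := ℂ) (V := dualPBT) evalDual := fun _ h =>
  Subtype.ext ((WithConv.equiv _).injective (LinearMap.ext h))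

theorem evalDual_comp_toDual (x : PBT) : evalDual x ∘ₗ toDual.toLinearMap = form (inclPBT x) :=
  LinearMap.ext fun f => form_comm f (inclPBT x)

theorem tensorForm_toDual (x y : PBT) (f : FQSym) :
    tensorForm (k := ℂ) (V := dualPBT) (W := dualPBT) (evalDual x) (evalDual y) (TensorProduct.map toDual.toLinearMap toDual.toLinearMap
      (CoalgebraStruct.comul (R := ℂ) f)) = evalDual (x * y) (toDual f) := by
  rw [tensorForm_map, evalDual_comp_toDual, evalDual_comp_toDual]
  refine (LinearMap.congr_fun (tensorForm_comulF _ _) f).trans ?_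
  rw [← map_mul, ← evalDual_comp_toDual]
  rfl

/-- The orthogonal of `PBT` is a coideal because `PBT` is closed under products: the pairing of `Δ
f` with `x ⊗ y` is `⟨f, x y⟩`. -/
theorem map_toDual_comul {f : FQSym} (hf : toDual f = 0) :
    TensorProduct.map toDual.toLinearMap toDual.toLinearMap (CoalgebraStruct.comul (R := ℂ) f) = 0 :=
  (separates_evalDual.tensorForm separates_evalDual) _ fun ⟨x, y⟩ => by
    rw [tensorForm_toDual, hf, map_zero]

theorem counit_eq_evalDual (f : FQSym) :
    CoalgebraStruct.counit (R := ℂ) f = evalDual 1 (toDual f) := by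
  change counitF f = (evalDual 1 ∘ₗ toDual.toLinearMap) f
  rw [evalDual_comp_toDual, map_one, form_one]

theorem counit_eq_zero_of_toDual {f : FQSym} (hf : toDual f = 0) :
    CoalgebraStruct.counit (R := ℂ) f = 0 := by
  rw [counit_eq_evalDual, hf, map_zero]

instance coalgebraD : Coalgebra ℂ dualPBT :=
  coalgebraOfSurjective (S := dualPBT) toDual.toLinearMap toDual_surjective
    (fun _ => map_toDual_comul) fun _ => counit_eq_zero_of_toDual

theorem comul_toDual (f : FQSym) : CoalgebraStruct.comul (R := ℂ) (toDual f) =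
    TensorProduct.map toDual.toLinearMap toDual.toLinearMap (CoalgebraStruct.comul (R := ℂ) f) := by
  have := coalgebraOfSurjective_comul (S := dualPBT) toDual.toLinearMap toDual_surjective
    (fun _ => map_toDual_comul) (fun _ => counit_eq_zero_of_toDual) f
  exact this

theorem counit_toDual (f : FQSym) : CoalgebraStruct.counit (R := ℂ) (toDual f) =
    CoalgebraStruct.counit (R := ℂ) f := by
  have := coalgebraOfSurjective_counit (S := dualPBT) toDual.toLinearMap toDual_surjective
    (fun _ => map_toDual_comul) (fun _ => counit_eq_zero_of_toDual) f
  exact this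

theorem map_toSylv (t : FQSym ⊗[ℂ] FQSym) :
    TensorProduct.map toSylv.toLinearMap toSylv.toLinearMap t =
      TensorProduct.map dualEquiv.toLinearMap dualEquiv.toLinearMap
        (TensorProduct.map toDual.toLinearMap toDual.toLinearMap t) := by
  have : toSylv.toLinearMap = dualEquiv.toLinearMap ∘ₗ toDual.toLinearMap :=
    LinearMap.ext fun f => (dualEquiv_toDual f).symm
  rw [this, TensorProduct.map_comp]
  rfl

theorem toDual_eq_zero {f : FQSym} (hf : toSylv f = 0) : toDual f = 0 := by
  rw [← map_zero toDual, toDual_eq_iff, hf, map_zero]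

theorem map_toSylv_comul {f : FQSym} (hf : toSylv f = 0) :
    TensorProduct.map toSylv.toLinearMap toSylv.toLinearMap (CoalgebraStruct.comul (R := ℂ) f) = 0 := by
  rw [map_toSylv, map_toDual_comul (toDual_eq_zero hf), map_zero]

theorem counit_eq_zero_of_toSylv {f : FQSym} (hf : toSylv f = 0) :
    CoalgebraStruct.counit (R := ℂ) f = 0 :=
  counit_eq_zero_of_toDual (toDual_eq_zero hf)

instance coalgebraS : Coalgebra ℂ sylvImage :=
  coalgebraOfSurjective toSylv.toLinearMap toSylv_surjective
    (fun _ => map_toSylv_comul) fun _ => counit_eq_zero_of_toSylv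

theorem comul_toSylv (f : FQSym) : CoalgebraStruct.comul (R := ℂ) (toSylv f) =
    TensorProduct.map toSylv.toLinearMap toSylv.toLinearMap (CoalgebraStruct.comul (R := ℂ) f) :=
  coalgebraOfSurjective_comul (S := sylvImage) toSylv.toLinearMap toSylv_surjective
    (fun _ => map_toSylv_comul) (fun _ => counit_eq_zero_of_toSylv) f

theorem counit_toSylv (f : FQSym) : CoalgebraStruct.counit (R := ℂ) (toSylv f) =
    CoalgebraStruct.counit (R := ℂ) f :=
  coalgebraOfSurjective_counit (S := sylvImage) toSylv.toLinearMap toSylv_surjective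
    (fun _ => map_toSylv_comul) (fun _ => counit_eq_zero_of_toSylv) f

theorem isHopf_dualPBT : IsHopf dualPBT :=
  isHopf_FQSym.of_surjective isConnectedGrading_degF toDual toDual_surjective counit_toDual
    comul_toDual

theorem isHopf_sylvImage : IsHopf sylvImage :=
  isHopf_FQSym.of_surjective isConnectedGrading_degF toSylv toSylv_surjective counit_toSylv
    comul_toSylv

/-- The projection of `FQSym` on its image, as a morphism of bialgebras. -/
def bialgToSylv : FQSym →ₐc[ℂ] sylvImage where
  toLinearMap := toSylv.toLinearMap
  counit_comp := LinearMap.ext counit_toSylv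
  map_comp_comul := LinearMap.ext fun f => (comul_toSylv f).symm
  map_one' := map_one toSylv
  map_mul' := map_mul toSylv

/-- The isomorphism of bialgebras from the graded dual of `PBT` to the image of `FQSym`. -/
def bialgDualEquiv : dualPBT ≃ₐc[ℂ] sylvImage where
  __ := dualEquiv.toLinearEquiv
  counit_comp := LinearMap.ext fun φ => by
    obtain ⟨f, rfl⟩ := toDual_surjective φ
    change CoalgebraStruct.counit (R := ℂ) (dualEquiv (toDual f)) = _
    rw [dualEquiv_toDual, counit_toSylv, counit_toDual]
  map_comp_comul := LinearMap.ext fun φ => by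
    obtain ⟨f, rfl⟩ := toDual_surjective φ
    change TensorProduct.map dualEquiv.toLinearMap dualEquiv.toLinearMap
      (CoalgebraStruct.comul (R := ℂ) (toDual f)) =
        CoalgebraStruct.comul (R := ℂ) (dualEquiv (toDual f))
    rw [dualEquiv_toDual, comul_toSylv, comul_toDual, map_toSylv]
  map_mul' := map_mul dualEquiv

/-! ### Gradings -/

/-- The projection of `FQSym` onto its component of degree `n`. -/
def projDeg (n : ℕ) : FQSym →ₗ[ℂ] FQSym := basisF.constr ℂ fun s =>
  if s.1 = n then FElt s.2 else 0

theorem projDeg_FElt (n : ℕ) {m : ℕ} (σ : Equiv.Perm (Fin m)) :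
    projDeg n (FElt σ) = if m = n then FElt σ else 0 := by
  have h := basisF.constr_basis ℂ (fun s => if s.1 = n then FElt s.2 else 0) ⟨m, σ⟩
  rwa [basisF_apply] at h

theorem projDeg_mem (n : ℕ) (f : FQSym) : projDeg n f ∈ degF n := by
  refine FQSym_induction (p := fun f => projDeg n f ∈ degF n) (by simp)
    (fun x y hx hy => by rw [map_add]; exact add_mem hx hy)
    (fun c x hx => by rw [map_smul]; exact Submodule.smul_mem _ c hx) (fun m σ => ?_) f
  rw [projDeg_FElt]
  split_ifs with h
  · subst h; exact FElt_mem_degF σ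
  · exact Submodule.zero_mem _

theorem F_apply_of_length_ne {n : ℕ} (σ : Equiv.Perm (Fin n)) {w : Word} (h : w.length ≠ n) :
    F σ w = 0 := by
  classical
  rw [F_apply, if_neg]
  exact fun hs => h (congrArg Sigma.fst hs)

theorem degF_apply {n : ℕ} {f : FQSym} (hf : f ∈ degF n) : (f : Series Word) ∈ degreePart n := by
  have : degF n ≤ (degreePart n).comap FQSym.val.toLinearMap := by
    refine Submodule.span_le.2 ?_
    rintro _ ⟨σ, rfl⟩ w hw
    exact F_apply_of_length_ne σ hw
  exact this hf

theorem projDeg_apply (n : ℕ) (f : FQSym) (w : Word) :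
    (projDeg n f : Series Word) w = if w.length = n then (f : Series Word) w else 0 := by
  refine FQSym_induction (p := fun f => (projDeg n f : Series Word) w =
    if w.length = n then (f : Series Word) w else 0) (by simp) (fun x y hx hy => ?_)
    (fun c x hx => ?_) (fun m σ => ?_) f
  · rw [map_add, Subalgebra.coe_add, Series.add_apply, hx, hy, Subalgebra.coe_add,
      Series.add_apply]
    split_ifs <;> simp
  · rw [map_smul, Subalgebra.coe_smul, Series.smul_apply, hx, Subalgebra.coe_smul,
      Series.smul_apply]
    split_ifs <;> simp
  · rw [projDeg_FElt]
    by_cases hm : m = n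
    · rw [if_pos hm]
      split_ifs with h
      · rfl
      · exact F_apply_of_length_ne σ (hm ▸ h)
    · rw [if_neg hm]
      split_ifs with h
      · exact (F_apply_of_length_ne σ fun h' => hm (h'.symm.trans h)).symm
      · rfl

theorem mem_degF_iff {n : ℕ} {f : FQSym} : f ∈ degF n ↔ (f : Series Word) ∈ degreePart n := by
  refine ⟨degF_apply, fun h => ?_⟩
  have : projDeg n f = f := Subtype.ext (Series.ext fun w => by
    rw [projDeg_apply]
    split_ifs with hw
    · rfl
    · exact (h w hw).symm)
  rw [← this]
  exact projDeg_mem n f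

theorem PElt_mem_PBTDeg (T : BinaryTree Unit) : PElt T ∈ PBTDeg T.numNodes := by
  intro w hw
  change P T w = 0
  rw [P, Series.sum_apply]
  exact Finset.sum_eq_zero fun σ _ => F_apply_of_length_ne σ hw

theorem toDual_mem_dualDeg {n : ℕ} {f : FQSym} (hf : f ∈ degF n) :
    (toDual f : WithConv (PBT →ₗ[ℂ] ℂ)) ∈ dualDeg n := by
  intro m hm x hx
  change form f (inclPBT x) = 0
  have : degF n ≤ LinearMap.ker (form.flip (inclPBT x)) := by
    refine Submodule.span_le.2 ?_
    rintro _ ⟨σ, rfl⟩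
    change form (FElt σ) (inclPBT x) = 0
    rw [form_FElt]
    refine hx _ fun h => hm ?_
    rw [← h]
    exact length_permWord σ
  exact this hf

/-- Distinct degrees are orthogonal, so on `P_T` of degree `n` only the degree `n` component of `f`
matters; in the other degrees both forms vanish. -/
theorem toDual_projDeg {n : ℕ} {f : FQSym}
    (hf : (toDual f : WithConv (PBT →ₗ[ℂ] ℂ)) ∈ dualDeg n) : toDual (projDeg n f) = toDual f := by
  refine Subtype.ext ((WithConv.equiv _).injective (PBT_hom_ext fun T => ?_))
  change form (projDeg n f) (inclPBT (PElt T)) = form f (inclPBT (PElt T))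
  by_cases hT : T.numNodes = n
  · have : form.flip (inclPBT (PElt T)) ∘ₗ projDeg n = form.flip (inclPBT (PElt T)) := by
      refine FQSym_hom_ext fun m σ => ?_
      rw [LinearMap.comp_apply, projDeg_FElt]
      split_ifs with hm
      · rfl
      · rw [map_zero, FElt_eq_GElt, LinearMap.flip_apply, form_GElt_PElt, if_neg]
        rintro rfl
        exact hm (by rw [← hT, numNodes_permTree])
    exact LinearMap.congr_fun this f
  · rw [show form f (inclPBT (PElt T)) = 0 from hf _ hT _ (PElt_mem_PBTDeg T)]
    exact toDual_mem_dualDeg (projDeg_mem n f) _ hT _ (PElt_mem_PBTDeg T)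

/-- Both gradings are images of the grading of `FQSym`: by `toDual_projDeg`, a form of degree `n` is
represented by a homogeneous element of degree `n`. -/
theorem mem_dualDeg_iff (n : ℕ) (φ : dualPBT) :
    (φ : WithConv (PBT →ₗ[ℂ] ℂ)) ∈ dualDeg n ↔ dualEquiv φ ∈ sylvImageDeg n := by
  obtain ⟨f, rfl⟩ := toDual_surjective φ
  constructor
  · intro h
    rw [← toDual_projDeg h, dualEquiv_toDual]
    exact ⟨projDeg n f, ⟨(projDeg n f).2, degF_apply (projDeg_mem n f)⟩, rfl⟩
  · rintro ⟨g, ⟨hg, hgn⟩, h⟩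
    have h1 : toSylv ⟨g, hg⟩ = dualEquiv (toDual f) := Subtype.ext h
    rw [← dualEquiv_toDual] at h1
    rw [← dualEquiv.injective h1]
    exact toDual_mem_dualDeg (mem_degF_iff.2 hgn)

theorem toSubmodule_dualPBT : Subalgebra.toSubmodule dualPBT = gradedDual := by
  refine le_antisymm ?_ (iSup_le fun n φ hφ => ?_)
  · rintro _ ⟨f, rfl⟩
    refine FQSym_induction (p := fun f => dualForm f ∈ gradedDual)
      (by rw [map_zero]; exact Submodule.zero_mem _)
      (fun x y hx hy => by rw [map_add]; exact add_mem hx hy)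
      (fun c x hx => by rw [map_smul]; exact Submodule.smul_mem _ c hx) (fun m σ => ?_) f
    exact Submodule.mem_iSup_of_mem m (toDual_mem_dualDeg (FElt_mem_degF σ))
  -- A form of degree `n` is expanded along the dual basis, which is finite in each degree.
  · refine ⟨∑ T ∈ BinaryTree.treesOfNumNodesEq n, φ (PElt T) • GElt (treePerm T),
      (WithConv.equiv _).injective (PBT_hom_ext fun T => ?_)⟩
    change form _ (inclPBT (PElt T)) = φ (PElt T)
    rw [map_sum, LinearMap.sum_apply]
    simp only [map_smul, LinearMap.smul_apply, form_GElt_PElt, permTree_treePerm, smul_eq_mul,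
      mul_ite, mul_one, mul_zero, Finset.sum_ite_eq', BinaryTree.mem_treesOfNumNodesEq]
    split_ifs with hT
    · rfl
    · exact (hφ _ hT _ (PElt_mem_PBTDeg T)).symm

theorem isGradedDualHopf_dualPBT : IsGradedDualHopf dualPBT where
  isHopf := isHopf_dualPBT
  toSubmodule_eq := toSubmodule_dualPBT
  comul_apply φ x y := by
    obtain ⟨f, rfl⟩ := toDual_surjective φ
    rw [comul_toDual]
    refine Eq.trans ?_ (tensorForm_toDual x y f)
    generalize TensorProduct.map toDual.toLinearMap toDual.toLinearMap _ = t
    induction t with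
    | zero => simp
    | add s t hs ht => simp only [map_add, LinearMap.add_apply, hs, ht]
    | tmul φ ψ => rfl
  counit_apply φ := by
    obtain ⟨f, rfl⟩ := toDual_surjective φ
    rw [counit_toDual, counit_eq_evalDual]
    rfl

/-! ### The basis of the `Q_T` -/

/-- The coefficient of a sylvester class, as a linear form on the image of `FQSym`. -/
def evalSylv (c : Sylv) : sylvImage →ₗ[ℂ] ℂ where
  toFun f := (f : Series Sylv) c
  map_add' _ _ := rfl
  map_smul' _ _ := rfl

/-- The basis of the `Q_T`. -/
def basisQ : Module.Basis (BinaryTree Unit) ℂ sylvImage :=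
  Module.Basis.mk (v := fun T => toSylv (GElt (treePerm T)))
    (linearIndependent_of_forms _
      -- The coefficient of the class of `w_T` is the coordinate along `Q_T`.
      (fun T => evalSylv (sylvCon.mk' (.ofList (treeWord T)))) fun T T' => by
        refine (sylvProj_G_apply (treePerm T') _).trans (if_congr ?_ rfl rfl)
        rw [sylvTree_treeWord, permTree_treePerm])
    (by
      intro x _
      obtain ⟨f, rfl⟩ := toSylv_surjective x
      refine FQSym_induction (p := fun f => toSylv f ∈ Submodule.span ℂ (Set.range fun T =>
        toSylv (GElt (treePerm T)))) (by rw [map_zero]; exact Submodule.zero_mem _)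
        (fun x y hx hy => by rw [map_add]; exact add_mem hx hy)
        (fun c x hx => by rw [map_smul]; exact Submodule.smul_mem _ c hx) (fun m σ => ?_) f
      -- `F_σ = G_{σ⁻¹}` has the same projection as `G_{w_T}`, where `T = 𝒫(σ⁻¹)`.
      refine Submodule.subset_span ⟨permTree σ⁻¹, Subtype.ext ?_⟩
      rw [FElt_eq_GElt]
      exact sylvProj_GElt σ⁻¹)

theorem basisQ_apply (T : BinaryTree Unit) : basisQ T = toSylv (GElt (treePerm T)) := by
  rw [basisQ, Module.Basis.mk_apply]

end Sylvester

end

theorem mainTheorem4 :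
    ∃ (cF : Coalgebra ℂ FQSym) (_ : Coalgebra ℂ PBT) (_ : Coalgebra ℂ sylvImage)
      (D : Subalgebra ℂ (WithConv (PBT →ₗ[ℂ] ℂ))) (_ : Coalgebra ℂ D),
      -- `FQSym` is a Hopf algebra, with its usual coproduct
      IsFQSymCoproduct cF ∧ IsHopf FQSym ∧
      -- `PBT` is a Hopf subalgebra of `FQSym`
      IsHopf PBT ∧ (∃ ι : PBT →ₐc[ℂ] FQSym, ∀ x : PBT, (ι x : Series Word) = x) ∧
      -- `π(FQSym)` is a quotient Hopf algebra of `FQSym`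
      IsHopf sylvImage ∧
      (∃ p : FQSym →ₐc[ℂ] sylvImage, ∀ f : FQSym, (p f : Series Sylv) = sylvProj f) ∧
      -- `D` is the graded dual Hopf algebra of `PBT`
      IsGradedDualHopf D ∧
      ∃ (bP : Module.Basis (BinaryTree Unit) ℂ PBT)
        (bQ : Module.Basis (BinaryTree Unit) ℂ sylvImage)
        (Φ : D ≃ₐc[ℂ] sylvImage),
        (∀ T, (bP T : Series Word) = P T) ∧
        (∀ T, (bQ T : Series Sylv) = Q T) ∧
        -- the isomorphism is homogeneous of degree `0`
        (∀ (n : ℕ) (φ : D), (φ : WithConv (PBT →ₗ[ℂ] ℂ)) ∈ dualDeg n ↔ Φ φ ∈ sylvImageDeg n) ∧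
        -- it identifies the basis dual to the `P_T` with the `Q_T`
        (∀ T T' : BinaryTree Unit, toForm D (Φ.symm (bQ T)) (bP T') = if T = T' then 1 else 0) := by
  refine ⟨coalgebraF, coalgebraP, coalgebraS, dualPBT, coalgebraD, fun n σ => comulF_FElt σ,
    isHopf_FQSym, isHopf_PBT, ⟨bialgInclPBT, fun x => rfl⟩, isHopf_sylvImage,
    ⟨bialgToSylv, fun f => rfl⟩, isGradedDualHopf_dualPBT, basisP, basisQ, bialgDualEquiv,
    fun T => by rw [basisP_apply]; rfl, fun T => by rw [basisQ_apply]; rfl, mem_dualDeg_iff,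
    fun T T' => ?_⟩
  -- `Q_T` corresponds to the form `⟨G_{w_T}, ·⟩`, whose value at `P_{T'}` tests whether `𝒫(w_T) =
  -- T` equals `T'`.
  have h : bialgDualEquiv.symm (basisQ T) = toDual (GElt (treePerm T)) := by
    rw [basisQ_apply, ← dualEquiv_toDual]
    exact bialgDualEquiv.symm_apply_apply _
  rw [h, basisP_apply]
  refine (form_GElt_PElt (treePerm T) T').trans (if_congr ?_ rfl rfl)
  rw [permTree_treePerm]
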